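/- Let $\{p,q,r\}$ be one of $\{3,3,6\}$, $\{3,4,4\}$, $\{4,3,6\}$, $\{5,3,6\}$, and let $\Gamma\subset \mathrm{PGL}(2,\mathbb{C})$ be the group of orientation-preserving isometries of the regular tessellation $\{p,q,r\}$ of $\mathbb{H}^3$ by ideal Platonic solids, normalized (in the upper half-space model) so that $0,\infty,1$ are consecutive vertices of a face. Let $u=e^{2\pi i/r}$, let $z\in\mathbb{Z}[u]$ with $z\neq 0$, let $p_w=\left(\begin{smallmatrix}1&w\\0&1\end{smallmatrix}\right)$, and let $N_z$ be the normal closure of $p_z$ in $\Gamma$; the quotient $\mathbb{H}^3/N_z$ is the universal regular tessellation of type $\{p,q,r\}$ and cusp modulus $z$. A regular tessellation of type $\{p,q,r\}$ is a manifold $\mathbb{H}^3/M$ with $M$ a torsion-free normal subgroup of $\Gamma$; it has cusp modulus $z$ if the set of $w\in\mathbb{C}$ with $p_w\in M$ is the ideal $\langle z\rangle$ of $\mathbb{Z}[u]$. A nanotube is $\mathbb{R}^{\ge 0}\times T_z^*$, where $T_z^*$ is the torus $\mathbb{C}/\langle z\rangle$ with the tessellation by regular $r$-gons that is dual to the tessellation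 $\{q,r\}$ with vertices in $\mathbb{Z}[u]/\langle z\rangle$. Let $X_0$ be a single nanotube, and let $X_{n+1}$ be obtained from $X_n$ by (1) attaching a nanotube to each open (unglued) face, respecting orientations, and then (2) making all gluings of open faces and all identifications of nanotubes that are needed to have $p$ nanotubes around each edge: if there are $p$ successive nanotubes around an edge and two open faces adjacent to it, these two faces are glued; if an edge cycle has a length different from $p$, or there are more than $p$ nanotubes around an edge, every $p$-th nanotube is identified; this is repeated until no more gluing or identification is necessary. Let $\partial X_n$ be the union of the open faces of $X_n$. Each nanotube is given the geometry of the Ford domain of the cusp, and a tessellation map $X_n\to\mathbb{H}^3/M$ is a continuous map that sends, for each pair of a face of a nanotube and a side of this face, the corresponding piece of the nanotube to such a piece of the dual tessellation of $\mathbb{H}^3/M$ by an orientation-preserving isometry coming from $\Gamma$. (a) Let $\mathbb{H}^3/M$ be a finite-volume regular tessellation of type $\{p,q,r\}$ with cusp modulus $z$. Then $X_0$ can be identified with a Ford domain of $\mathbb{H}^3/M$, that is, there is a tessellation map $f_0\colon X_0\to\mathbb{H}^3/M$ that is injective away from $\partial X_0$ and whose image is a Ford domain. For each such identification $f_0$ and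 each $n$, there is a unique tessellation map $f_n\colon X_n\to\mathbb{H}^3/M$ whose composition with the canonical map $X_0\to X_n$ is $f_0$, and $f_n$ is surjective for all sufficiently large $n$. If furthermore $M=N_z$, then for all sufficiently large $n$ the map $f_n$ is a homeomorphism (hence $X_n\cong\mathbb{H}^3/N_z$ as tessellated spaces) and $\partial X_n$ is empty. (b) Every $X_n$ consists of finitely many nanotube faces. If the (possibly orbifold) quotient $\mathbb{H}^3/N_z$ has finite volume, then $\partial X_n$ is empty for all sufficiently large $n$; that is, the algorithm that constructs $X_0,X_1,\dots$ until there are no open faces terminates. -/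

import Mathlib

open scoped MatrixGroups ENNReal ComplexConjugate

noncomputable section

namespace RegTess

/-! ### Hyperbolic 3-space in the upper half-space model -/

/-- The upper half-space `{(w, t) : w ∈ ℂ, t > 0}`; its boundary is `ℂ ∪ {∞}`. -/
def HypSpace : Type := {x : ℂ × ℝ // 0 < x.2}

namespace HypSpace

instance : TopologicalSpace HypSpace := inferInstanceAs (TopologicalSpace {x : ℂ × ℝ // 0 < x.2})

instance : MeasurableSpace HypSpace := inferInstanceAs (MeasurableSpace {x : ℂ × ℝ // 0 < x.2})

/-- The horizontal coordinate. -/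
def horiz (x : HypSpace) : ℂ := x.1.1

/-- The height coordinate. -/
def height (x : HypSpace) : ℝ := x.1.2

lemma height_pos (x : HypSpace) : 0 < x.height := x.2

lemma ext' {x y : HypSpace} (h₁ : x.horiz = y.horiz) (h₂ : x.height = y.height) : x = y :=
  Subtype.ext (Prod.ext h₁ h₂)

/-- `|c w + d|² + |c|² t²` for a matrix with lower row `(c, d)`. -/
def denom (g : GL (Fin 2) ℂ) (x : HypSpace) : ℝ :=
  Complex.normSq (g 1 0 * x.horiz + g 1 1) + Complex.normSq (g 1 0) * x.height ^ 2

lemma denom_pos (g : GL (Fin 2) ℂ) (x : HypSpace) : 0 < denom g x := by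
  have hdet : g.1.det ≠ 0 := g.det.ne_zero
  rw [Matrix.det_fin_two] at hdet
  have ht := x.height_pos
  unfold denom
  by_cases hc : g 1 0 = 0
  · have hd : g 1 1 ≠ 0 := by
      intro hd
      apply hdet
      simp [hc, hd]
    simpa [hc] using hd
  · have h1 : 0 < Complex.normSq (g 1 0) := Complex.normSq_pos.2 hc
    have h2 := Complex.normSq_nonneg (g 1 0 * x.horiz + g 1 1)
    positivity

/-- The Poincaré extension of the Möbius transformation `z ↦ (a z + b) / (c z + d)`. -/
def moebius (g : GL (Fin 2) ℂ) (x : HypSpace) : HypSpace :=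
  ⟨(((g 0 0 * x.horiz + g 0 1) * conj (g 1 0 * x.horiz + g 1 1)
        + g 0 0 * conj (g 1 0) * (x.height : ℂ) ^ 2) / (denom g x : ℂ),
    ‖g.1.det‖ * x.height / denom g x), by
    have h1 : 0 < ‖g.1.det‖ := norm_pos_iff.2 g.det.ne_zero
    have h2 := x.height_pos
    have h3 := denom_pos g x
    show 0 < ‖g.1.det‖ * x.height / denom g x
    positivity⟩

lemma denom_cast (g : GL (Fin 2) ℂ) (x : HypSpace) :
    (denom g x : ℂ) = (g 1 0 * x.horiz + g 1 1) * conj (g 1 0 * x.horiz + g 1 1)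
      + g 1 0 * conj (g 1 0) * (x.height : ℂ) ^ 2 := by
  simp only [denom, Complex.ofReal_add, Complex.ofReal_mul, Complex.ofReal_pow, Complex.mul_conj]

lemma norm_det_sq (g : GL (Fin 2) ℂ) :
    ((‖g.1.det‖ : ℝ) : ℂ) ^ 2 = (g 0 0 * g 1 1 - g 0 1 * g 1 0) *
      conj (g 0 0 * g 1 1 - g 0 1 * g 1 0) := by
  rw [Complex.mul_conj, Complex.normSq_eq_norm_sq, Matrix.det_fin_two]
  push_cast
  rfl

lemma mul_entry (g h : GL (Fin 2) ℂ) (i j : Fin 2) :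
    (g * h) i j = g i 0 * h 0 j + g i 1 * h 1 j := by
  simp [Matrix.mul_apply, Fin.sum_univ_two]

lemma denom_mul (g h : GL (Fin 2) ℂ) (x : HypSpace) :
    denom (g * h) x = denom g (moebius h x) * denom h x := by
  apply Complex.ofReal_injective
  have hD : (denom h x : ℂ) ≠ 0 := Complex.ofReal_ne_zero.2 (denom_pos h x).ne'
  have hn := norm_det_sq h
  have e1 : (moebius h x).horiz = ((h 0 0 * x.horiz + h 0 1) * conj (h 1 0 * x.horiz + h 1 1)
        + h 0 0 * conj (h 1 0) * (x.height : ℂ) ^ 2) / (denom h x : ℂ) := rfl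
  have e2 : (((moebius h x).height : ℝ) : ℂ) = (‖h.1.det‖ : ℂ) * x.height / denom h x := by
    rw [← Complex.ofReal_mul, ← Complex.ofReal_div]; rfl
  have hDe := denom_cast h x
  rw [Complex.ofReal_mul, denom_cast (g * h), denom_cast g, e1, e2]
  simp only [mul_entry, map_add, map_mul, map_div₀, map_pow, Complex.conj_ofReal, Complex.conj_conj,
    div_pow, mul_pow, hn, map_sub] at hDe ⊢
  generalize (denom h x : ℂ) = D at *
  field_simp
  subst hDe
  ring

lemma moebius_mul (g h : GL (Fin 2) ℂ) (x : HypSpace) :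
    moebius (g * h) x = moebius g (moebius h x) := by
  have hm := denom_mul g h x
  have hp := (denom_pos g (moebius h x)).ne'
  have hq := (denom_pos h x).ne'
  apply ext'
  · have hD : (denom h x : ℂ) ≠ 0 := Complex.ofReal_ne_zero.2 hq
    have hE : (denom g (moebius h x) : ℂ) ≠ 0 := Complex.ofReal_ne_zero.2 hp
    have hn := norm_det_sq h
    have e1 : (moebius h x).horiz = ((h 0 0 * x.horiz + h 0 1) * conj (h 1 0 * x.horiz + h 1 1)
          + h 0 0 * conj (h 1 0) * (x.height : ℂ) ^ 2) / (denom h x : ℂ) := rfl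
    have e2 : (((moebius h x).height : ℝ) : ℂ) = (‖h.1.det‖ : ℂ) * x.height / denom h x := by
      rw [← Complex.ofReal_mul, ← Complex.ofReal_div]; rfl
    have hDe := denom_cast h x
    have el : (moebius (g * h) x).horiz = (((g * h) 0 0 * x.horiz + (g * h) 0 1) *
        conj ((g * h) 1 0 * x.horiz + (g * h) 1 1)
        + (g * h) 0 0 * conj ((g * h) 1 0) * (x.height : ℂ) ^ 2) / (denom (g * h) x : ℂ) := rfl
    have er : (moebius g (moebius h x)).horiz =
        ((g 0 0 * (moebius h x).horiz + g 0 1) * conj (g 1 0 * (moebius h x).horiz + g 1 1)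
        + g 0 0 * conj (g 1 0) * (((moebius h x).height : ℝ) : ℂ) ^ 2) /
          (denom g (moebius h x) : ℂ) := rfl
    rw [el, er, hm, Complex.ofReal_mul, div_eq_div_iff (mul_ne_zero hE hD) hE, e1, e2]
    simp only [mul_entry, map_add, map_mul, map_div₀, map_pow, Complex.conj_ofReal,
      Complex.conj_conj, div_pow, mul_pow, hn, map_sub] at hDe ⊢
    generalize (denom g (moebius h x) : ℂ) = E at *
    generalize (denom h x : ℂ) = D at *
    field_simp
    subst hDe
    ring
  · show ‖(g * h).1.det‖ * x.height / denom (g * h) x =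
      ‖g.1.det‖ * (‖h.1.det‖ * x.height / denom h x) / denom g (moebius h x)
    rw [hm, Units.val_mul, Matrix.det_mul, norm_mul]
    field_simp

instance : MulAction (GL (Fin 2) ℂ) HypSpace where
  smul := moebius
  one_smul x := by
    show moebius 1 x = x
    apply ext'
    · simp [moebius, horiz, denom]
    · simp [moebius, height, denom]
  mul_smul := moebius_mul

lemma scalar_smul (u : ℂˣ) (x : HypSpace) :
    Matrix.GeneralLinearGroup.scalar (Fin 2) u • x = x := by
  have hu : Complex.normSq (u : ℂ) ≠ 0 := by simp
  show moebius _ x = x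
  apply ext'
  · show (_ / _ : ℂ) = _
    have : (u : ℂ) ≠ 0 := u.ne_zero
    simp [denom, ← Complex.mul_conj]
    field_simp
  · show (_ / _ : ℝ) = _
    simp [denom, Complex.normSq_eq_norm_sq]

/-- `PGL(2, ℂ)` acts on hyperbolic 3-space as its group of orientation-preserving isometries. -/
instance : MulAction PGL(2, ℂ) HypSpace :=
  Matrix.ProjGenLinGroup.mulActionOfGL scalar_smul

/-- The hyperbolic volume `dx dy dt / t³`. -/
def volume : MeasureTheory.Measure HypSpace :=
  MeasureTheory.Measure.comap (Subtype.val : {x : ℂ × ℝ // 0 < x.2} → ℂ × ℝ)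
    ((MeasureTheory.volume : MeasureTheory.Measure (ℂ × ℝ)).withDensity
      fun x => ENNReal.ofReal (1 / x.2 ^ 3))

end HypSpace

/-! ### The regular ideal tessellations `{p,q,r}` and their rotation groups -/

/-- The element of `PGL(2, ℂ)` represented by an invertible matrix. -/
def pgl (A : Matrix (Fin 2) (Fin 2) ℂ) (h : A.det ≠ 0) : PGL(2, ℂ) :=
  Matrix.ProjGenLinGroup.mk (Matrix.GeneralLinearGroup.mkOfDetNeZero A h)

/-- The four types `{3,3,6}`, `{3,4,4}`, `{4,3,6}`, `{5,3,6}` of regular tessellations of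
hyperbolic 3-space by ideal Platonic solids (tetrahedra, octahedra, cubes, dodecahedra). -/
inductive TessType
  | tetrahedral
  | octahedral
  | cubical
  | dodecahedral

namespace TessType

/-- The number of sides of a face of a solid. -/
def p : TessType → ℕ
  | tetrahedral => 3
  | octahedral => 3
  | cubical => 4
  | dodecahedral => 5

/-- The number of faces of a solid around a vertex of that solid. -/
def q : TessType → ℕ
  | tetrahedral => 3
  | octahedral => 4
  | cubical => 3
  | dodecahedral => 3

/-- The number of solids around an edge. -/
def r : TessType → ℕ
  | tetrahedral => 6
  | octahedral => 4
  | cubical => 6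
  | dodecahedral => 6

variable (T : TessType)

/-- `u = exp(2πi/r)`. -/
def u : ℂ := Complex.exp (2 * Real.pi * Complex.I / T.r)

lemma u_ne_zero : T.u ≠ 0 := Complex.exp_ne_zero _

/-- The constant `1 / (4 cos²(π/p))`; it equals `1` for `p = 3`. -/
def κ : ℝ := 1 / (4 * Real.cos (Real.pi / T.p) ^ 2)

lemma κ_pos : 0 < T.κ := by
  have hp : (3 : ℝ) ≤ T.p := by cases T <;> norm_num [p]
  have hcos : 0 < Real.cos (Real.pi / T.p) := by
    apply Real.cos_pos_of_mem_Ioo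
    have h0 := Real.pi_pos
    constructor
    · have : 0 < Real.pi / T.p := by positivity
      linarith
    · rw [div_lt_div_iff₀ (by linarith) (by norm_num)]
      nlinarith
  unfold κ
  positivity

/-- The rotation of order `p` about the centre of the face of the tessellation in which the
vertex `∞` has the two neighbours `0` and `1`; it maps `1 ↦ ∞ ↦ 0`. -/
def gP : PGL(2, ℂ) :=
  pgl !![0, (T.κ : ℂ); -1, 1] (by simpa [Matrix.det_fin_two] using T.κ_pos.ne')

/-- The rotation `w ↦ 1 - w / u` of order `q` about the line from `∞` through the centre of the
solid that lies over the `q`-gon of the tessellation `{q,r}` of `ℂ` with vertices in `ℤ[u]`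
to the left of the side from `0` to `1`. -/
def gQ : PGL(2, ℂ) :=
  pgl !![-1 / T.u, 1; 0, 1] (by simpa [Matrix.det_fin_two] using T.u_ne_zero)

/-- The rotation `w ↦ u w` of order `r` about the edge from `0` to `∞`. -/
def gR : PGL(2, ℂ) :=
  pgl !![T.u, 0; 0, 1] (by simpa [Matrix.det_fin_two] using T.u_ne_zero)

/-- The group of orientation-preserving isometries of the regular tessellation `{p,q,r}` of
hyperbolic 3-space, normalized such that `0, ∞, 1` are consecutive vertices of a face. It acts
simply transitively on the flags consisting of a solid, a face of the solid and an edge of the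
face, and is generated by the three rotations above (the standard generators of the rotation
subgroup of the Coxeter group `[p,q,r]`). -/
def Γ : Subgroup PGL(2, ℂ) := Subgroup.closure {T.gP, T.gQ, T.gR}

/-- The ring `ℤ[u] ⊆ ℂ`, i.e. the numbers `a + b u` with integers `a, b`. -/
abbrev cuspRing : Subalgebra ℤ ℂ := Algebra.adjoin ℤ {T.u}

/-- `u` as an element of `ℤ[u]`. -/
def uu : T.cuspRing := ⟨T.u, Algebra.subset_adjoin rfl⟩

end TessType

/-- The parabolic element `p_w : x ↦ x + w`. -/
def parabolic (w : ℂ) : PGL(2, ℂ) :=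
  pgl !![1, w; 0, 1] (by simp [Matrix.det_fin_two])

/-! ### Regular tessellations of manifolds -/

/-- The quotient `ℍ³ / M`. -/
abbrev QuotientSpace (M : Subgroup PGL(2, ℂ)) : Type :=
  Quotient (MulAction.orbitRel M HypSpace)

/-- The projection from hyperbolic 3-space to `ℍ³ / M`. -/
def proj (M : Subgroup PGL(2, ℂ)) (x : HypSpace) : QuotientSpace M := Quotient.mk _ x

/-- `ℍ³ / M` has finite volume: `M` has a fundamental domain of finite hyperbolic volume. -/
def FiniteVolume (M : Subgroup PGL(2, ℂ)) : Prop :=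
  ∃ D : Set HypSpace, MeasureTheory.IsFundamentalDomain M D HypSpace.volume ∧
    HypSpace.volume D < ∞

/-- `ℍ³ / M` is a regular tessellation (of a manifold) of type `{p,q,r}`: the group `M` is a
torsion-free normal subgroup of the group `Γ` of type `{p,q,r}`. -/
structure IsRegularTessellation (T : TessType) (M : Subgroup PGL(2, ℂ)) : Prop where
  le : M ≤ T.Γ
  normal : (M.subgroupOf T.Γ).Normal
  torsionFree : ∀ g ∈ M, g ≠ 1 → ¬ IsOfFinOrder g

/-- `z` is the cusp modulus of `ℍ³ / M`: the parabolic elements `p_w` that lie in `M` are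
exactly those for which `w` is in the ideal `⟨z⟩` of `ℤ[u]`. -/
def HasCuspModulus (T : TessType) (M : Subgroup PGL(2, ℂ)) (z : T.cuspRing) : Prop :=
  (M : Set PGL(2, ℂ)) ∩ Set.range parabolic =
    (fun w : T.cuspRing => parabolic (w : ℂ)) '' (Ideal.span {z} : Set T.cuspRing)

/-- The normal closure of `p_z` in `Γ`, whose quotient is the universal regular tessellation of
cusp modulus `z`. -/
def universalGroup (T : TessType) (z : T.cuspRing) : Subgroup PGL(2, ℂ) :=
  (Subgroup.normalClosure {g : T.Γ | (g : PGL(2, ℂ)) = parabolic (z : ℂ)}).map T.Γ.subtype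

/-- The set of points of hyperbolic 3-space that are, with respect to a `Γ`-invariant family of
horoballs, at least as close to the cusp `∞` as to any other cusp `γ⁻¹ ∞`. -/
def fordDomain (T : TessType) : Set HypSpace :=
  {x | ∀ γ ∈ T.Γ, (γ • x).height ≤ x.height}

/-! ### Complexes built from nanotubes -/

/-- The combinatorial data of a complex built from nanotubes. A flag is a pair of an `r`-gonal
face of a nanotube and a side of this face. -/
structure NanoComplex where
  /-- The flags. -/
  Flag : Type
  /-- Go to the next side (counterclockwise, as seen from the end of the nanotube) of the same
  face. -/
  rot : Flag → Flag
  /-- Go to the other face of the same nanotube that shares the given side. -/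
  flip : Flag → Flag
  /-- The face of the first flag is glued to the face of the second flag such that the sides of
  the flags are glued. -/
  Glued : Flag → Flag → Prop

namespace NanoComplex

/-- The face of a flag is open, i.e. not glued to any face. -/
def IsOpenFlag (X : NanoComplex) (c : X.Flag) : Prop := ∀ d, ¬ X.Glued c d

/-- The faces. -/
def Face (X : NanoComplex) : Type := Quot fun c d : X.Flag => d = X.rot c

/-- The open faces. -/
def OpenFace (X : NanoComplex) : Type :=
  {F : X.Face // ∃ c, Quot.mk _ c = F ∧ X.IsOpenFlag c}

/-- Some flag of a given open face. -/
def OpenFace.flag {X : NanoComplex} (F : X.OpenFace) : X.Flag := F.2.choose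

/-- A single nanotube `ℝ≥0 × T*_z`. The faces of its boundary torus `T*_z` are the `r`-gons dual
to the vertices `a ∈ ℤ[u] / ⟨z⟩` of `T_z`; the `k`-th side of the `r`-gon at `a` is dual to the
edge of `T_z` from `a` to `a + u ^ k`, and it is the `(k + r/2)`-th side of the `r`-gon at
`a + u ^ k`. No face is glued. -/
def nanotube (T : TessType) (z : T.cuspRing) : NanoComplex where
  Flag := (T.cuspRing ⧸ Ideal.span {z}) × ZMod T.r
  rot c := (c.1, c.2 + 1)
  flip c := (c.1 + Ideal.Quotient.mk _ (T.uu ^ c.2.val), c.2 + ((T.r / 2 : ℕ) : ZMod T.r))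
  Glued _ _ := False

/-- The gluings after attaching a nanotube to each open face `F`. The face `0` of the new nanotube
is glued to `F` reversing the orientation, side `0` being glued to the side of the chosen flag. -/
inductive AttachGlued (T : TessType) (z : T.cuspRing) (X : NanoComplex) :
    X.Flag ⊕ (X.OpenFace × (nanotube T z).Flag) →
      X.Flag ⊕ (X.OpenFace × (nanotube T z).Flag) → Prop
  | old (c d : X.Flag) : X.Glued c d → AttachGlued T z X (.inl c) (.inl d)
  | new (F : X.OpenFace) (j : ℕ) :
      AttachGlued T z X (.inl (X.rot^[j] F.flag)) (.inr (F, (0, -(j : ZMod T.r))))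
  | new' (F : X.OpenFace) (j : ℕ) :
      AttachGlued T z X (.inr (F, (0, -(j : ZMod T.r)))) (.inl (X.rot^[j] F.flag))

/-- First step: attach a nanotube to each open face. -/
def attach (T : TessType) (z : T.cuspRing) (X : NanoComplex) : NanoComplex where
  Flag := X.Flag ⊕ (X.OpenFace × (nanotube T z).Flag)
  rot := Sum.map X.rot (Prod.map id (nanotube T z).rot)
  flip := Sum.map X.flip (Prod.map id (nanotube T z).flip)
  Glued := AttachGlued T z X

mutual

/-- Second step, identifications: the least equivalence relation on flags that is compatible with
the nanotubes (if two flags are identified then so are the whole nanotubes) and that identifies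
two flags that are glued to the same flag. -/
inductive Identified (T : TessType) (X : NanoComplex) : X.Flag → X.Flag → Prop
  | refl (c : X.Flag) : Identified T X c c
  | symm (c d : X.Flag) : Identified T X c d → Identified T X d c
  | trans (c d e : X.Flag) : Identified T X c d → Identified T X d e → Identified T X c e
  | rot (c d : X.Flag) : Identified T X c d → Identified T X (X.rot c) (X.rot d)
  | flip (c d : X.Flag) : Identified T X c d → Identified T X (X.flip c) (X.flip d)
  | glued (c d d' : X.Flag) : ClosedGlued T X c d → ClosedGlued T X c d' → Identified T X d d'

/-- Second step, gluings: the least gluing relation extending the given one in which there are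
always `p` nanotubes around an edge. In the rule `edge`, the flags `c 0, …, c (p - 1)` belong to
`p` successive nanotubes around an edge; then the remaining face of the last one has to be glued to
the remaining face of the first one. If one of these two faces is already glued to something else,
this results in identifications of every `p`-th nanotube around the edge. -/
inductive ClosedGlued (T : TessType) (X : NanoComplex) : X.Flag → X.Flag → Prop
  | base (c d : X.Flag) : X.Glued c d → ClosedGlued T X c d
  | symm (c d : X.Flag) : ClosedGlued T X c d → ClosedGlued T X d c
  | congr (c c' d : X.Flag) : Identified T X c c' → ClosedGlued T X c d → ClosedGlued T X c' d
  | rot (c d : X.Flag) : ClosedGlued T X c d → ClosedGlued T X (X.rot c) (X.rot^[T.r - 1] d)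
  | edge (c : ℕ → X.Flag) :
      (∀ i, i + 1 < T.p → ClosedGlued T X (X.flip (c i)) (c (i + 1))) →
        ClosedGlued T X (X.flip (c (T.p - 1))) (c 0)

end

/-- The equivalence relation on flags given by the identifications. -/
def identifiedSetoid (T : TessType) (X : NanoComplex) : Setoid X.Flag where
  r := Identified T X
  iseqv := ⟨Identified.refl, fun h => Identified.symm _ _ h, fun h h' => Identified.trans _ _ _ h h'⟩

/-- Second step: glue and identify until there are `p` nanotubes around every edge that is not
an edge of an open face. -/
def closeEdges (T : TessType) (X : NanoComplex) : NanoComplex where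
  Flag := Quotient (identifiedSetoid T X)
  rot := Quotient.map X.rot fun c d h => Identified.rot c d h
  flip := Quotient.map X.flip fun c d h => Identified.flip c d h
  Glued := Quotient.lift₂ (ClosedGlued T X) fun a b a' b' (h : Identified T X a a')
    (h' : Identified T X b b') => propext
      ⟨fun g => .symm _ _ (.congr _ _ _ h' (.symm _ _ (.congr _ _ _ h g))),
        fun g => .symm _ _ (.congr _ _ _ (.symm _ _ h')
          (.symm _ _ (.congr _ _ _ (.symm _ _ h) g)))⟩

/-- The `n`-th stage of the construction of the universal regular tessellation. -/
def stage (T : TessType) (z : T.cuspRing) : ℕ → NanoComplex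
  | 0 => nanotube T z
  | n + 1 => ((stage T z n).attach T z).closeEdges T

/-! ### Geometric realization -/

/-- The part of the Ford domain at `∞` that belongs to one flag: it lies over the triangle spanned
by `0` and the side with midpoint `1/2` of the `r`-gon around `0` in the tessellation of `ℂ` dual to
`{q,r}`, and outside of the hemisphere that contains the `r`-gonal face. -/
def Piece (T : TessType) : Set HypSpace :=
  {x | |x.horiz.im| ≤ Real.tan (Real.pi / T.r) * x.horiz.re ∧ x.horiz.re ≤ 1 / 2 ∧
    T.κ ≤ Complex.normSq x.horiz + x.height ^ 2}

/-- The gluings between the pieces: the pieces of the flags of one nanotube are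
glued to each other along their vertical walls by the rotations `gR` (next side of the same face)
and `gQ * gR` (other face at the same side), and the bottoms of the
pieces of glued flags are glued by the half-turn `gP * gQ * gR`. -/
inductive RealRel (T : TessType) (X : NanoComplex) :
    (Σ _ : X.Flag, Piece T) → (Σ _ : X.Flag, Piece T) → Prop
  | rot (c : X.Flag) (x y : Piece T) :
      (x : HypSpace) = T.gR • (y : HypSpace) → RealRel T X ⟨c, x⟩ ⟨X.rot c, y⟩
  | flip (c : X.Flag) (x y : Piece T) :
      (x : HypSpace) = (T.gQ * T.gR) • (y : HypSpace) → RealRel T X ⟨c, x⟩ ⟨X.flip c, y⟩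
  | glue (c d : X.Flag) (x y : Piece T) : X.Glued c d →
      (x : HypSpace) = (T.gP * T.gQ * T.gR) • (y : HypSpace) → RealRel T X ⟨c, x⟩ ⟨d, y⟩

/-- The topological space obtained by gluing the nanotubes of the complex, where each nanotube has
the shape of a Ford domain. -/
def Space (T : TessType) (X : NanoComplex) : Type := Quot (RealRel T X)

instance (T : TessType) (X : NanoComplex) : TopologicalSpace (Space T X) :=
  inferInstanceAs (TopologicalSpace (Quot (RealRel T X)))

/-- The point of the space given by a point of the piece of a flag. -/
def Space.mk {T : TessType} {X : NanoComplex} (c : X.Flag) (x : Piece T) : Space T X :=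
  Quot.mk _ ⟨c, x⟩

/-- The boundary: the union of all open faces. -/
def boundary (T : TessType) (X : NanoComplex) : Set (Space T X) :=
  {y | ∃ (c : X.Flag) (x : Piece T), X.IsOpenFlag c ∧
    Complex.normSq (x : HypSpace).horiz + (x : HypSpace).height ^ 2 = T.κ ∧ y = Space.mk c x}

/-- The map on flags from one stage to the next. -/
def flagNext (T : TessType) (z : T.cuspRing) (n : ℕ) (c : (stage T z n).Flag) :
    (stage T z (n + 1)).Flag :=
  Quotient.mk (identifiedSetoid T ((stage T z n).attach T z)) (Sum.inl c)

/-- The map from one stage to the next. -/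
def next (T : TessType) (z : T.cuspRing) (n : ℕ) :
    Space T (stage T z n) → Space T (stage T z (n + 1)) :=
  Quot.map (fun y => ⟨flagNext T z n y.1, y.2⟩) fun _ _ h => by
    cases h with
    | rot c x y h => exact RealRel.rot (flagNext T z n c) x y h
    | flip c x y h => exact RealRel.flip (flagNext T z n c) x y h
    | glue c d x y hg h =>
      exact RealRel.glue (flagNext T z n c) (flagNext T z n d) x y
        (ClosedGlued.base (X := (stage T z n).attach T z) _ _ (AttachGlued.old c d hg)) h

/-- The map from the single initial nanotube to the `n`-th stage. -/
def fromInitial (T : TessType) (z : T.cuspRing) :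
    (n : ℕ) → Space T (stage T z 0) → Space T (stage T z n)
  | 0 => id
  | n + 1 => next T z n ∘ fromInitial T z n

/-- A map from a complex of nanotubes to `ℍ³ / M` that respects the tessellations: it is continuous
and it maps the piece of each flag by (the projection of) an element of `Γ`, hence isometrically and
preserving the orientation, to the piece of a flag of `ℍ³ / M`. -/
def IsTessellationMap (T : TessType) (M : Subgroup PGL(2, ℂ)) {X : NanoComplex}
    (f : Space T X → QuotientSpace M) : Prop :=
  Continuous f ∧ ∀ c : X.Flag, ∃ γ ∈ T.Γ, ∀ x : Piece T, f (Space.mk c x) = proj M (γ • (x : HypSpace))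

/-- An identification of the single initial nanotube with a Ford domain of `ℍ³ / M`, i.e. with the
image of the Ford domain at some cusp `γ ∞`. (The identification is injective only away from the open
faces since the faces of a Ford domain are glued to each other in `ℍ³ / M`.) -/
def IsFordIdentification (T : TessType) (z : T.cuspRing) (M : Subgroup PGL(2, ℂ))
    (f : Space T (stage T z 0) → QuotientSpace M) : Prop :=
  IsTessellationMap T M f ∧ Set.InjOn f (boundary T (stage T z 0))ᶜ ∧
    ∃ γ ∈ T.Γ, Set.range f = (fun x => proj M (γ • x)) '' fordDomain T

end NanoComplex

end RegTess

end

open RegTess RegTess.NanoComplex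

-- The argument replaces geometry by group actions. Put R = `gR`, F = `gQ * gR`, E = `gP * gQ * gR`.
-- The flags of the dual tessellation of `ℍ³ / M` are the cosets of M in Γ, and passing to the next
-- side, to the adjacent face, or through a face is right multiplication by R, F or E. A
-- tessellation map from a nanotube complex is therefore the same thing as a map of its flags to Γ/M
-- that turns these three moves into right multiplications (`IsFlagMap`, `realize`,
-- `IsTessellationMap.exists_isFlagMap`).
--
-- Existence and uniqueness of f_n: every rule for attaching, gluing and identifying reflects a
-- relation that holds in Γ, so a flag map extends to the next stage (`attachMap_isFlagMap`,
-- `IsFlagMap.closed`). All flags are reached from the base flag by moves, so its value there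
-- determines the flag map. Surjectivity: finite volume makes Γ/M finite, because the translates of
-- a chamber by coset representatives all have the same positive volume and embed disjointly in the
-- quotient. The ranges of the flag maps increase, so they stabilise; since each open face receives
-- a nanotube in the next stage, the stable range is closed under all three moves.
--
-- Termination: the direct limit of the stages has no open faces, and p nanotubes close up around
-- each edge. The defining relations of Γ thus hold for its moves, so Γ acts on its flags from the
-- right, transitively, with the translation by z acting trivially (`IsComplete.exists_action`).
-- Hence N_z acts trivially and the limit has at most [Γ : N_z] flags. If this index is finite, some
-- stage already equals the limit (`exists_stage_of_finite`), and a flag map to Γ/N_z is then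
-- injective. No torsion-freeness is needed here, which is why (b) covers orbifolds.
--
-- Two facts about Γ carry this: a presentation by the relations of the rotation subgroup of the
-- Coxeter group [p,q,r], and the knowledge of which points of the pieces are identified. Both come
-- from the action of the full Coxeter group by hyperbolic reflections. Four explicit functions on
-- the upper half-space transform like simple roots, so Tits' lemma applies: chambers cover the
-- space, and the stabilizer of a chamber point is generated by the reflections in the walls through
-- it. The latter turns equality of images into a chain of moves, giving injectivity
-- (`realize_inj`); local finiteness of the pieces makes the inverse continuous.

namespace CoxeterSystem

-- Tits' lemma for functions that transform like simple roots.

open CoxeterSystem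

variable {B : Type*} {M : CoxeterMatrix B} {W : Type*} [Group W] (cs : CoxeterSystem M W)

/-- The alternating product `s j * s i * s j * ⋯` with `k` factors. -/
noncomputable def altProd (j i : B) (k : ℕ) : W := (cs.wordProd (alternatingWord i j k))⁻¹

lemma altProd_zero (j i : B) : cs.altProd j i 0 = 1 := by simp [altProd, alternatingWord]

lemma altProd_succ (j i : B) (k : ℕ) :
    cs.altProd j i (k + 1) = cs.simple j * cs.altProd i j k := by
  simp [altProd, alternatingWord, wordProd_append]

lemma altProd_succ' (j i : B) (k : ℕ) :
    cs.altProd j i (k + 1) = cs.altProd j i k * cs.simple (if Even k then j else i) := by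
  simp [altProd, alternatingWord_succ', wordProd_cons]

lemma altProd_braid (j i : B) : cs.altProd j i (M i j) = cs.altProd i j (M i j) := by
  have := cs.wordProd_braidWord_eq i j
  simp only [braidWord] at this
  rw [altProd, altProd, this, M.symmetric]

lemma length_altProd_le (j i : B) (k : ℕ) : cs.length (cs.altProd j i k) ≤ k := by
  rw [altProd, length_inv]
  exact (cs.length_wordProd_le _).trans (by simp)

variable {X : Type*} [MulAction W X]

/-- A family of functions which the simple reflections transform like the simple roots. -/
def IsRootFamily (α : B → X → ℝ) : Prop :=
  ∀ i j x, α i (cs.simple j • x) = α i x + 2 * Real.cos (Real.pi / M i j) * α j x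

variable {cs} {α : B → X → ℝ}

lemma IsRootFamily.apply_self (h : cs.IsRootFamily α) (i : B) (x : X) :
    α i (cs.simple i • x) = - α i x := by
  rw [h]; simp; ring

/-- The dihedral group of `i` and `j` acts on the two functions by the recursion of sin (kθ) / sin θ
with θ = π / M i j. The factor sin θ stays on the left so that nothing has to be assumed about θ;
the parity test tells which letter comes last in the alternating product. -/
lemma IsRootFamily.apply_altProd (h : cs.IsRootFamily α) (k : ℕ) : ∀ (i j : B) (y : X),
    Real.sin (Real.pi / M i j) * α i (cs.altProd j i k • y) =
        Real.sin ((k + 1) * (Real.pi / M i j)) * (if Even k then α i y else α j y)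
        + Real.sin (k * (Real.pi / M i j)) * (if Even k then α j y else α i y) ∧
    Real.sin (Real.pi / M i j) * α j (cs.altProd j i k • y) =
        - Real.sin (k * (Real.pi / M i j)) * (if Even k then α i y else α j y)
        - Real.sin ((k - 1) * (Real.pi / M i j)) * (if Even k then α j y else α i y) := by
  induction k with
  | zero =>
    intro i j y
    constructor <;> simp [altProd_zero]
  | succ k ih =>
    intro i j y
    obtain ⟨h1, h2⟩ := ih j i y
    rw [M.symmetric j i] at h1 h2
    have e1 : (if Even (k + 1) then α i y else α j y) = if Even k then α j y else α i y := by
      rcases Nat.even_or_odd k with hk | hk <;> simp [Nat.even_add_one, hk]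
    have e2 : (if Even (k + 1) then α j y else α i y) = if Even k then α i y else α j y := by
      rcases Nat.even_or_odd k with hk | hk <;> simp [Nat.even_add_one, hk]
    rw [altProd_succ, mul_smul, e1, e2, h i j, h.apply_self]
    generalize (if Even k then α j y else α i y) = P at *
    generalize (if Even k then α i y else α j y) = Q at *
    generalize Real.pi / M i j = θ at *
    push_cast
    have t1 : Real.sin ((k + 1 + 1) * θ) =
        2 * Real.cos θ * Real.sin ((k + 1) * θ) - Real.sin (k * θ) := by
      have a : ((k : ℝ) + 1 + 1) * θ = (k + 1) * θ + θ := by ring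
      have b : (k : ℝ) * θ = (k + 1) * θ - θ := by ring
      rw [a, b, Real.sin_add, Real.sin_sub]; ring
    have t2 : Real.sin ((k + 1) * θ) =
        2 * Real.cos θ * Real.sin (k * θ) - Real.sin ((k - 1) * θ) := by
      have a : ((k : ℝ) + 1) * θ = k * θ + θ := by ring
      have b : ((k : ℝ) - 1) * θ = k * θ - θ := by ring
      rw [a, b, Real.sin_add, Real.sin_sub]; ring
    constructor
    · rw [t1]
      linear_combination h2 + 2 * Real.cos θ * h1 + (-Q) * t2
    · rw [show (k : ℝ) + 1 - 1 = k by ring]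
      linear_combination -h1

/-- Tits' lemma. The predicate `p` is `0 ≤ ·` or `0 < ·`. -/
theorem IsRootFamily.sign (h : cs.IsRootFamily α) (hM : ∀ i j, M i j ≠ 0) {p : ℝ → Prop}
    (hp : ∀ a b x y : ℝ, 0 ≤ a → 0 < b → p x → p y → p (a * x + b * y)) {x : X}
    (hx : ∀ i, p (α i x)) : ∀ (n : ℕ) (w : W), cs.length w = n → ∀ i,
      cs.length w < cs.length (cs.simple i * w) → p (α i (w • x)) := by
  intro n
  induction n using Nat.strong_induction_on with
  | _ n ih =>
  rintro w hw i hi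
  by_cases hw1 : w = 1
  · subst hw1; simpa using hx i
  obtain ⟨j, hj⟩ := cs.exists_leftDescent_of_ne_one hw1
  rw [isLeftDescent_iff] at hj
  have hij : i ≠ j := by rintro rfl; omega
  have hm2 : 2 ≤ M i j := by
    have := M.off_diagonal i j hij
    have := hM i j
    omega
  classical
  -- `Q k`: w has a length-additive alternating prefix with k letters that begins with `s_j`. The
  -- longest such prefix is split off.
  let Q : ℕ → Prop := fun k => ∃ v, w = cs.altProd j i k * v ∧ cs.length w = k + cs.length v
  have hQ1 : Q 1 := ⟨cs.simple j * w, by simp [altProd_succ, altProd_zero], by omega⟩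
  obtain ⟨v, hv, hlv⟩ : Q (Nat.findGreatest Q (M i j)) :=
    Nat.findGreatest_spec (m := 1) (by omega) hQ1
  have hk1 : 1 ≤ Nat.findGreatest Q (M i j) := Nat.le_findGreatest (by omega) hQ1
  -- A prefix of full length `M i j` could, by the braid relation, also be written with first letter
  -- `s_i`; then `s_i` would shorten w, against `hi`.
  have hkm : Nat.findGreatest Q (M i j) < M i j := by
    refine lt_of_le_of_ne (Nat.findGreatest_le _) fun he => ?_
    rw [he] at hv hlv
    obtain ⟨m, hm⟩ : ∃ m, M i j = m + 1 := ⟨M i j - 1, by omega⟩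
    rw [altProd_braid, hm, altProd_succ] at hv
    have h1 : cs.simple i * w = cs.altProd j i m * v := by
      rw [hv, mul_assoc, simple_mul_simple_cancel_left]
    have h2 := cs.length_mul_le (cs.altProd j i m) v
    have h3 := cs.length_altProd_le j i m
    rw [h1] at hi
    omega
  have hmax : ¬ Q (Nat.findGreatest Q (M i j) + 1) :=
    Nat.findGreatest_is_greatest (Nat.lt_succ_self _) hkm
  generalize Nat.findGreatest Q (M i j) = k at *
  -- Maximality of the prefix gives this ascent for v, and additivity of lengths gives `hprev`. So
  -- the induction hypothesis controls both functions at `v • x`.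
  have hnext : cs.length v < cs.length (cs.simple (if Even k then j else i) * v) := by
    by_contra hc
    apply hmax
    refine ⟨cs.simple (if Even k then j else i) * v, ?_, ?_⟩
    · rw [altProd_succ', hv, mul_assoc, simple_mul_simple_cancel_left]
    · have := cs.length_simple_mul v (if Even k then j else i)
      omega
  have hprev : cs.length v < cs.length (cs.simple (if Even k then i else j) * v) := by
    by_contra hc
    obtain ⟨k', rfl⟩ : ∃ k', k = k' + 1 := ⟨k - 1, by omega⟩
    have he : (if Even (k' + 1) then i else j) = if Even k' then j else i := by
      rcases Nat.even_or_odd k' with hk | hk <;> simp [Nat.even_add_one, hk]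
    rw [he] at hc
    have h0 := cs.length_simple_mul v (if Even k' then j else i)
    rw [altProd_succ', mul_assoc] at hv
    have h2 := cs.length_mul_le (cs.altProd j i k') (cs.simple (if Even k' then j else i) * v)
    have h3 := cs.length_altProd_le j i k'
    rw [← hv] at h2
    omega
  have hn := ih (cs.length v) (by omega) v rfl _ hnext
  have hpr := ih (cs.length v) (by omega) v rfl _ hprev
  have hf := (h.apply_altProd k i j (v • x)).1
  rw [← mul_smul, ← hv] at hf
  have hm0 : (0 : ℝ) < M i j := by exact_mod_cast (by omega : 0 < M i j)
  have hlt : ∀ a : ℝ, 0 < a → a < M i j → 0 < Real.sin (a * (Real.pi / M i j)) := by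
    intro a h0 h1
    apply Real.sin_pos_of_pos_of_lt_pi
    · have := Real.pi_pos; positivity
    · rw [mul_div_assoc', div_lt_iff₀ hm0]
      nlinarith [Real.pi_pos]
  have s0 : 0 < Real.sin (Real.pi / M i j) := by
    simpa using hlt 1 one_pos (by exact_mod_cast (by omega : 1 < M i j))
  have s1 : 0 < Real.sin (k * (Real.pi / M i j)) :=
    hlt k (by exact_mod_cast hk1) (by exact_mod_cast hkm)
  -- This coefficient vanishes when k + 1 = `M i j`, whereas the other is positive; hence the
  -- asymmetric assumptions `0 ≤ a`, `0 < b` in `hp`.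
  have s2 : 0 ≤ Real.sin ((k + 1) * (Real.pi / M i j)) := by
    apply Real.sin_nonneg_of_nonneg_of_le_pi
    · have := Real.pi_pos; positivity
    · rw [mul_div_assoc', div_le_iff₀ hm0]
      have : (k : ℝ) + 1 ≤ M i j := by exact_mod_cast hkm
      nlinarith [Real.pi_pos]
  have hres : α i (w • x) =
      (Real.sin ((k + 1) * (Real.pi / M i j)) / Real.sin (Real.pi / M i j)) *
        (if Even k then α i (v • x) else α j (v • x)) +
      (Real.sin (k * (Real.pi / M i j)) / Real.sin (Real.pi / M i j)) *
        (if Even k then α j (v • x) else α i (v • x)) := by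
    rw [div_mul_eq_mul_div, div_mul_eq_mul_div, ← add_div, eq_div_iff s0.ne']
    linear_combination hf
  rw [hres]
  apply hp _ _ _ _ (by positivity) (by positivity)
  · split_ifs with hk <;> simpa [hk] using hpr
  · split_ifs with hk <;> simpa [hk] using hn

theorem IsRootFamily.nonneg (h : cs.IsRootFamily α) (hM : ∀ i j, M i j ≠ 0) {x : X}
    (hx : ∀ i, 0 ≤ α i x) {w : W} {i : B} (hi : cs.length w < cs.length (cs.simple i * w)) :
    0 ≤ α i (w • x) :=
  h.sign hM (p := fun t => 0 ≤ t) (fun a b x y _ _ _ _ => by positivity) hx _ w rfl i hi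

theorem IsRootFamily.pos (h : cs.IsRootFamily α) (hM : ∀ i j, M i j ≠ 0) {x : X}
    (hx : ∀ i, 0 < α i x) {w : W} {i : B} (hi : cs.length w < cs.length (cs.simple i * w)) :
    0 < α i (w • x) :=
  h.sign hM (p := fun t => 0 < t) (fun a b x y _ _ _ _ => by positivity) hx _ w rfl i hi

/-- Every `w ≠ 1` is of the form `s i * w'` with `w'` shorter, and `α i` is nonnegative at `w' x`
for every `x` in the closed chamber. -/
theorem IsRootFamily.exists_descent (h : cs.IsRootFamily α) (hM : ∀ i j, M i j ≠ 0) {w : W}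
    (hw : w ≠ 1) : ∃ i w', w = cs.simple i * w' ∧ cs.length w = cs.length w' + 1 ∧
      (∀ x, (∀ j, 0 ≤ α j x) → 0 ≤ α i (w' • x)) ∧ (∀ x, (∀ j, 0 < α j x) → 0 < α i (w' • x)) := by
  obtain ⟨i, hi⟩ := cs.exists_leftDescent_of_ne_one hw
  rw [isLeftDescent_iff] at hi
  have hlt : cs.length (cs.simple i * w) < cs.length (cs.simple i * (cs.simple i * w)) := by
    rw [simple_mul_simple_cancel_left]; omega
  exact ⟨i, cs.simple i * w, by simp, by omega, fun x hx => h.nonneg hM hx hlt,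
    fun x hx => h.pos hM hx hlt⟩

/-- Two points of the closed chamber in the same orbit are equal, and the elements that fix a point
of the closed chamber are products of simple reflections which fix it. -/
theorem IsRootFamily.stabilizer (h : cs.IsRootFamily α) (hM : ∀ i j, M i j ≠ 0)
    (hfix : ∀ i x, α i x = 0 → cs.simple i • x = x) {x : X} (hx : ∀ i, 0 ≤ α i x) :
    ∀ (n : ℕ) (w : W), cs.length w = n → (∀ i, 0 ≤ α i (w • x)) →
      w • x = x ∧ w ∈ Subgroup.closure (cs.simple '' {i | α i x = 0}) := by
  intro n
  induction n with
  | zero =>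
    intro w hw _
    rw [length_eq_zero_iff] at hw
    subst hw
    exact ⟨one_smul _ _, one_mem _⟩
  | succ n ih =>
    intro w hw hwx
    obtain ⟨i, w', rfl, hl, hpos, -⟩ := h.exists_descent (w := w) hM
      (by rintro rfl; simp at hw)
    have h1 := hpos x hx
    have h2 := hwx i
    rw [mul_smul, h.apply_self] at h2
    -- Both `w' • x` and its mirror image lie on the nonnegative side of wall i, so the point is on
    -- the wall and the letter `s_i` can be dropped.
    have h0 : α i (w' • x) = 0 := by linarith
    have h3 := hfix i _ h0
    rw [mul_smul, h3] at hwx ⊢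
    obtain ⟨h4, h5⟩ := ih w' (by omega) hwx
    refine ⟨h4, mul_mem (Subgroup.subset_closure ⟨i, ?_, rfl⟩) h5⟩
    rwa [h4] at h0

end CoxeterSystem

-- The generators of Γ as matrices, and their relations.

namespace RegTess
lemma pgl_mul (A B : Matrix (Fin 2) (Fin 2) ℂ) (hA : A.det ≠ 0) (hB : B.det ≠ 0) :
    pgl A hA * pgl B hB = pgl (A * B) (by rw [Matrix.det_mul]; exact mul_ne_zero hA hB) := by
  rw [pgl, pgl, pgl, ← map_mul]
  congr 1
  ext i j
  simp [Matrix.GeneralLinearGroup.mkOfDetNeZero]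

lemma pgl_eq_of_smul {A B : Matrix (Fin 2) (Fin 2) ℂ} {hA : A.det ≠ 0} {hB : B.det ≠ 0} (c : ℂ)
    (hc : c ≠ 0) (h : A = c • B) : pgl A hA = pgl B hB := by
  symm
  rw [pgl, pgl, Matrix.ProjGenLinGroup.mk_eq_mk_iff]
  refine ⟨Units.mk0 c hc, ?_⟩
  ext i j
  simp [Matrix.GeneralLinearGroup.mkOfDetNeZero, h, mul_comm]

lemma pgl_one : pgl (1 : Matrix (Fin 2) (Fin 2) ℂ) (by simp) = 1 := by
  rw [pgl, ← map_one Matrix.ProjGenLinGroup.mk]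
  congr 1
  ext i j
  simp [Matrix.GeneralLinearGroup.mkOfDetNeZero]

lemma pgl_eq_one {A : Matrix (Fin 2) (Fin 2) ℂ} {hA : A.det ≠ 0} (c : ℂ) (h : A = c • 1) :
    pgl A hA = 1 := by
  rw [← pgl_one]
  refine pgl_eq_of_smul c ?_ h
  rintro rfl
  simp [h] at hA

lemma pgl_pow (A : Matrix (Fin 2) (Fin 2) ℂ) (h : A.det ≠ 0) (n : ℕ) :
    pgl A h ^ n = pgl (A ^ n) (by rw [Matrix.det_pow]; exact pow_ne_zero _ h) := by
  rw [pgl, pgl, ← map_pow]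
  congr 1
  ext i j
  simp [Matrix.GeneralLinearGroup.mkOfDetNeZero]

lemma smul_horiz (a b c d : ℂ) (h : (!![a, b; c, d] : Matrix (Fin 2) (Fin 2) ℂ).det ≠ 0) (x : HypSpace) :
   (pgl !![a, b; c, d] h • x).horiz = ((a * x.horiz + b) * conj (c * x.horiz + d) + a * conj c * (x.height : ℂ) ^ 2) /
     ((Complex.normSq (c * x.horiz + d) + Complex.normSq c * x.height ^ 2 : ℝ) : ℂ) := rfl
lemma smul_height (a b c d : ℂ) (h : (!![a, b; c, d] : Matrix (Fin 2) (Fin 2) ℂ).det ≠ 0) (x : HypSpace) :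
   (pgl !![a, b; c, d] h • x).height = ‖a * d - b * c‖ * x.height  /
     ((Complex.normSq (c * x.horiz + d) + Complex.normSq c * x.height ^ 2 : ℝ)) := by
  rw [← Matrix.det_fin_two_of]; rfl

namespace TessType

variable (T : TessType)

/-- The half-turn `w ↦ 1 - w` about the side of a face of a nanotube. -/
noncomputable def gF : PGL(2, ℂ) := T.gQ * T.gR

/-- The half-turn `w ↦ κ / w` by which two faces are glued. -/
noncomputable def gE : PGL(2, ℂ) := T.gP * T.gQ * T.gR

lemma gF_eq : T.gF = pgl !![-1, 1; 0, 1] (by simp) := by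
  rw [gF, gQ, gR, pgl_mul]
  congr 1
  have := T.u_ne_zero
  simp
  field_simp

lemma gE_eq : T.gE = pgl !![0, (T.κ : ℂ); 1, 0] (by simpa using T.κ_pos.ne') := by
  rw [gE, mul_assoc, ← gF, gF_eq, gP, pgl_mul]
  congr 1
  simp

lemma u_eq : T.u = Real.cos (2 * (Real.pi / T.r)) + Real.sin (2 * (Real.pi / T.r)) * Complex.I := by
  rw [u, Complex.ofReal_cos, Complex.ofReal_sin, ← Complex.exp_mul_I]
  congr 1
  push_cast
  ring

lemma norm_u : ‖T.u‖ = 1 := by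
  rw [u_eq, Complex.ofReal_cos, Complex.ofReal_sin, Complex.norm_cos_add_sin_mul_I]

lemma u_pow_r : T.u ^ T.r = 1 := by
  have hr : (T.r : ℂ) ≠ 0 := by cases T <;> simp [r]
  rw [u, ← Complex.exp_nat_mul, mul_div_cancel₀ _ hr, Complex.exp_two_pi_mul_I]

lemma gR_horiz (x : HypSpace) : (T.gR • x).horiz = T.u * x.horiz := by
  rw [gR, smul_horiz]; simp

lemma gR_height (x : HypSpace) : (T.gR • x).height = x.height := by
  rw [gR, smul_height]; simp [norm_u]

lemma gF_horiz (x : HypSpace) : (T.gF • x).horiz = 1 - x.horiz := by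
  rw [gF_eq, smul_horiz]; simp; ring

lemma gF_height (x : HypSpace) : (T.gF • x).height = x.height := by
  rw [gF_eq, smul_height]; simp

lemma gE_horiz (x : HypSpace) : (T.gE • x).horiz =
    T.κ * conj x.horiz / ((Complex.normSq x.horiz + x.height ^ 2 : ℝ) : ℂ) := by
  rw [gE_eq, smul_horiz]; simp

lemma gE_height (x : HypSpace) : (T.gE • x).height =
    T.κ * x.height / (Complex.normSq x.horiz + x.height ^ 2) := by
  rw [gE_eq, smul_height]; simp [abs_of_pos T.κ_pos]

/-- The matrix has trace 1 and determinant κ, and trace² / det = 1 / κ = 4 cos² (π / p)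
characterises a rotation by 2π / p. Verified by computing a scalar power for each value of p. -/
lemma gP_pow : T.gP ^ T.p = 1 := by
  have hκ : T.κ = 1 / (4 * Real.cos (Real.pi / T.p) ^ 2) := rfl
  have h2 : (!![0, (T.κ : ℂ); -1, 1] : Matrix (Fin 2) (Fin 2) ℂ) ^ 2 =
      !![-(T.κ : ℂ), (T.κ : ℂ); -1, 1 - (T.κ : ℂ)] := by
    rw [pow_two]; ext i j; fin_cases i <;> fin_cases j <;> simp; ring
  rw [show T.gP = pgl _ _ from rfl, pgl_pow]
  cases T with
  | tetrahedral =>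
    have h : κ tetrahedral = 1 := by rw [hκ]; norm_num [p]
    refine pgl_eq_one (-1) ?_
    rw [p, pow_succ, h2, h]
    ext i j; fin_cases i <;> fin_cases j <;> simp
  | octahedral =>
    have h : κ octahedral = 1 := by rw [hκ]; norm_num [p]
    refine pgl_eq_one (-1) ?_
    rw [p, pow_succ, h2, h]
    ext i j; fin_cases i <;> fin_cases j <;> simp
  | cubical =>
    have h : κ cubical = 1 / 2 := by rw [hκ]; norm_num [p, div_pow]
    refine pgl_eq_one (-(1 / 4)) ?_
    rw [p, show 4 = 2 * 2 from rfl, pow_mul, h2, h, pow_two]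
    ext i j; fin_cases i <;> fin_cases j <;> simp <;> norm_num
  | dodecahedral =>
    -- Here 2 cos (π / 5) is the golden ratio, and κ is its inverse square.
    have h : (κ dodecahedral) ^ 2 = 3 * κ dodecahedral - 1 := by
      have h5 : Real.sqrt 5 ^ 2 = 5 := Real.sq_sqrt (by norm_num)
      rw [hκ]
      simp only [p, Nat.cast_ofNat, Real.cos_pi_div_five]
      have h0 : (0 : ℝ) ≤ Real.sqrt 5 := Real.sqrt_nonneg _
      field_simp
      ring_nf
      have h4 : Real.sqrt 5 ^ 4 = 25 := by linear_combination (Real.sqrt 5 ^ 2 + 5) * h5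
      have h3 : Real.sqrt 5 ^ 3 = 5 * Real.sqrt 5 := by rw [pow_succ, h5]
      simp only [h3, h4, h5]
      ring
    have h' : (κ dodecahedral : ℂ) ^ 2 = 3 * κ dodecahedral - 1 := by exact_mod_cast h
    refine pgl_eq_one ((κ dodecahedral : ℂ) * (2 * κ dodecahedral - 1)) ?_
    rw [p, show 5 = 2 * 2 + 1 from rfl, pow_succ, pow_mul, h2, pow_two]
    ext i j; fin_cases i <;> fin_cases j <;> simp
    · ring
    · linear_combination (κ dodecahedral : ℂ) * h'
    · linear_combination -h'
    · linear_combination h'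

/-- The coefficient r / 2 - 2 equals 2 cos (2π / r): it is 1 for r = 6 and 0 for r = 4. -/
lemma u_sq : T.u ^ 2 = ((T.r / 2 - 2 : ℕ) : ℂ) * T.u - 1 := by
  have h3 : Real.sqrt 3 ^ 2 = 3 := Real.sq_sqrt (by norm_num)
  have h3' : (Real.sqrt 3 : ℂ) ^ 2 = 3 := by exact_mod_cast h3
  have h6 : (Real.cos (2 * (Real.pi / 6)) + Real.sin (2 * (Real.pi / 6)) * Complex.I) ^ 2 =
      (Real.cos (2 * (Real.pi / 6)) + Real.sin (2 * (Real.pi / 6)) * Complex.I) - 1 := by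
    rw [show 2 * (Real.pi / 6) = Real.pi / 3 by ring, Real.cos_pi_div_three,
      Real.sin_pi_div_three]
    push_cast
    linear_combination (1 / 4 * Complex.I ^ 2) * h3' + 3 / 4 * Complex.I_sq
  rw [u_eq]
  cases T
  · simpa [r] using h6
  · simp only [r, Nat.cast_ofNat]
    rw [show 2 * (Real.pi / 4) = Real.pi / 2 by ring]
    simp
  · simpa [r] using h6
  · simpa [r] using h6

lemma gQ_pow : T.gQ ^ T.q = 1 := by
  have hu := T.u_sq
  have h0 := T.u_ne_zero
  have h2 : (!![-1 / T.u, 1; 0, 1] : Matrix (Fin 2) (Fin 2) ℂ) ^ 2 =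
      !![(1 / T.u) ^ 2, -1 / T.u + 1; 0, 1] := by
    rw [pow_two]; ext i j; fin_cases i <;> fin_cases j <;> simp; ring
  have h3 : T.u ^ 2 = T.u - 1 → pgl !![-1 / T.u, 1; 0, 1] (by simpa using h0) ^ 3 = 1 := by
    intro hu
    have h6 : T.u ^ 3 = -1 := by linear_combination (T.u + 1) * hu
    rw [pgl_pow]
    refine pgl_eq_one 1 ?_
    rw [pow_succ, h2, Matrix.one_fin_two]
    ext i j; fin_cases i <;> fin_cases j <;> simp
    · field_simp
      linear_combination -h6
    · field_simp
      linear_combination hu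
  rw [show T.gQ = pgl _ _ from rfl]
  cases T
  · exact h3 (by simpa [r] using hu)
  · have hu4 : (TessType.octahedral).u ^ 2 = -1 := by simpa [r] using hu
    rw [pgl_pow]
    refine pgl_eq_one 1 ?_
    rw [q, show 4 = 2 * 2 from rfl, pow_mul, h2, pow_two, Matrix.one_fin_two]
    ext i j; fin_cases i <;> fin_cases j <;> simp [hu4]
  · exact h3 (by simpa [r] using hu)
  · exact h3 (by simpa [r] using hu)

lemma gR_pow : T.gR ^ T.r = 1 := by
  rw [gR, pgl_pow]
  refine pgl_eq_one 1 ?_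
  have : ∀ n, (!![T.u, 0; 0, 1] : Matrix (Fin 2) (Fin 2) ℂ) ^ n = !![T.u ^ n, 0; 0, 1] := by
    intro n
    induction n with
    | zero => simp [Matrix.one_fin_two]
    | succ n ih => rw [pow_succ, ih, pow_succ]; simp
  rw [this, u_pow_r, Matrix.one_fin_two, one_smul]

lemma gF_sq : T.gF ^ 2 = 1 := by
  rw [gF_eq, pgl_pow]
  refine pgl_eq_one 1 ?_
  rw [pow_two, Matrix.one_fin_two]; simp

lemma gE_sq : T.gE ^ 2 = 1 := by
  rw [gE_eq, pgl_pow]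
  refine pgl_eq_one T.κ ?_
  rw [pow_two, Matrix.one_fin_two]; simp

lemma gPQ_sq : (T.gP * T.gQ) ^ 2 = 1 := by
  rw [gP, gQ, pgl_mul, pgl_pow]
  refine pgl_eq_one (T.κ / T.u) ?_
  rw [pow_two, Matrix.one_fin_two]; simp
  ring_nf; simp

end TessType
end RegTess

-- The Coxeter group [p,q,r] and its action by hyperbolic reflections.

namespace RegTess
namespace TessType

variable (T : TessType)

/-- The Coxeter matrix of the linear diagram `[p,q,r]`. -/
def coxeterMatrix : CoxeterMatrix (Fin 4) where
  M := !![1, T.p, 2, 2; T.p, 1, T.q, 2; 2, T.q, 1, T.r; 2, 2, T.r, 1]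
  isSymm := by
    ext i j; fin_cases i <;> fin_cases j <;> rfl
  diagonal i := by fin_cases i <;> rfl
  off_diagonal i j h := by
    cases T <;> fin_cases i <;> fin_cases j <;> simp [p, q, r] at h ⊢

/-- The Coxeter group `[p,q,r]`. -/
abbrev W : Type := T.coxeterMatrix.Group

/-- The standard generators of the Coxeter group `[p,q,r]`. -/
def cs : CoxeterSystem T.coxeterMatrix T.W := T.coxeterMatrix.toCoxeterSystem

lemma coxeterMatrix_ne_zero (i j : Fin 4) : T.coxeterMatrix i j ≠ 0 := by
  cases T <;> fin_cases i <;> fin_cases j <;> simp [coxeterMatrix, p, q, r]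

/-- The relations between the rotations `E = s₀ s₃`, `F = s₁ s₃`, `R = s₂ s₃` and `1 = s₃ s₃`. -/
def IsRotationSystem {G : Type*} [Group G] (a : Fin 4 → G) : Prop :=
  a 3 = 1 ∧ ∀ i j, (a i * (a j)⁻¹) ^ T.coxeterMatrix i j = 1

variable {T}

lemma isRotationSystem_of_lt {G : Type*} [Group G] {a : Fin 4 → G} (h3 : a 3 = 1)
    (hr : a 2 ^ T.r = 1) (hF : a 1 ^ 2 = 1) (hE : a 0 ^ 2 = 1) (hq : (a 1 * (a 2)⁻¹) ^ T.q = 1)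
    (hp : (a 0 * a 1) ^ T.p = 1) (h02 : (a 0 * (a 2)⁻¹) ^ 2 = 1) : T.IsRotationSystem a := by
  have hp' : (a 0 * (a 1)⁻¹) ^ T.p = 1 := by
    rwa [inv_eq_of_mul_eq_one_left (a := a 1) (b := a 1) (by rw [← pow_two, hF])]
  clear hp
  have hsymm : ∀ i j n, (a i * (a j)⁻¹) ^ n = 1 → (a j * (a i)⁻¹) ^ n = 1 := by
    intro i j n h
    rw [← inv_inj, ← inv_pow]; simpa using h
  have hq' := hsymm _ _ _ hq
  have hp'' := hsymm _ _ _ hp'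
  have h02' := hsymm _ _ _ h02
  refine ⟨h3, fun i j => ?_⟩
  fin_cases i <;> fin_cases j <;> simp [coxeterMatrix, hr, hE, hF, hp', hq, hq', hp'', h02, h02', h3]

lemma IsRotationSystem.map {G H : Type*} [Group G] [Group H] {a : Fin 4 → G}
    (h : T.IsRotationSystem a) (f : G →* H) : T.IsRotationSystem (f ∘ a) :=
  ⟨by simp [h.1], fun i j => by simp [← map_inv, ← map_mul, ← map_pow, h.2]⟩

/-- If σ inverts all the `a i`, then `(a i σ)(a j σ) = a i (a j)⁻¹`, so the relations between
rotations become Coxeter relations between reflections. -/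
lemma IsRotationSystem.isLiftable {G : Type*} [Group G] {a : Fin 4 → G}
    (h : T.IsRotationSystem a) {σ : G} (ha : ∀ i, σ * a i * σ = (a i)⁻¹) :
    T.coxeterMatrix.IsLiftable (fun i => a i * σ) := by
  intro i j
  have := h.2 i j
  rw [← ha j] at this
  simpa only [mul_assoc] using this

variable (T)

/-- The rotations `E`, `F`, `R` and `1`. -/
noncomputable def gens : Fin 4 → PGL(2, ℂ) := ![T.gE, T.gF, T.gR, 1]

lemma isRotationSystem_gens : T.IsRotationSystem T.gens := by
  have hF : T.gF⁻¹ = T.gF := inv_eq_of_mul_eq_one_left (by rw [← pow_two, gF_sq])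
  apply isRotationSystem_of_lt rfl T.gR_pow T.gF_sq T.gE_sq
  · simpa [gens, gF] using T.gQ_pow
  · have : T.gE * T.gF = T.gP := by rw [← hF, gE, gF]; group
    simpa [gens, this] using T.gP_pow
  · simpa [gens, gE] using T.gPQ_sq

lemma closure_gens : Subgroup.closure (Set.range T.gens) = T.Γ := by
  apply le_antisymm
  · rw [Subgroup.closure_le]
    have hP : T.gP ∈ T.Γ := Subgroup.subset_closure (by simp)
    have hQ : T.gQ ∈ T.Γ := Subgroup.subset_closure (by simp)
    have hR : T.gR ∈ T.Γ := Subgroup.subset_closure (by simp)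
    rintro _ ⟨i, rfl⟩
    fin_cases i
    · exact mul_mem (mul_mem hP hQ) hR
    · exact mul_mem hQ hR
    · exact hR
    · exact one_mem _
  · rw [Γ, Subgroup.closure_le]
    have hE : T.gE ∈ Subgroup.closure (Set.range T.gens) := Subgroup.subset_closure ⟨0, rfl⟩
    have hF : T.gF ∈ Subgroup.closure (Set.range T.gens) := Subgroup.subset_closure ⟨1, rfl⟩
    have hR : T.gR ∈ Subgroup.closure (Set.range T.gens) := Subgroup.subset_closure ⟨2, rfl⟩
    rintro x (rfl | rfl | rfl)
    · have : T.gP = T.gE * T.gF⁻¹ := by rw [gE, gF]; group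
      rw [this]; exact mul_mem hE (inv_mem hF)
    · have : T.gQ = T.gF * T.gR⁻¹ := by rw [gF]; group
      rw [this]; exact mul_mem hF (inv_mem hR)
    · exact hR

lemma gens_mem (i : Fin 4) : T.gens i ∈ T.Γ := by
  rw [← closure_gens]; exact Subgroup.subset_closure ⟨i, rfl⟩

end TessType

namespace HypSpace

/-- The reflection in the vertical plane over the real line. -/
noncomputable def conjH : Equiv.Perm HypSpace :=
  Function.Involutive.toPerm (fun x => ⟨(conj x.horiz, x.height), x.height_pos⟩) fun x =>
    ext' (by simp [horiz]) rfl

lemma conjH_horiz (x : HypSpace) : (conjH x).horiz = conj x.horiz := rfl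

lemma conjH_height (x : HypSpace) : (conjH x).height = x.height := rfl

lemma conjH_mul_self : conjH * conjH = 1 := by
  ext x : 1
  exact ext' (by simp [conjH_horiz]) rfl

lemma normSq_add_pos (x : HypSpace) : 0 < Complex.normSq x.horiz + x.height ^ 2 := by
  have := x.height_pos
  have := Complex.normSq_nonneg x.horiz
  positivity

end HypSpace

namespace TessType

open HypSpace

variable (T : TessType)

lemma gE_smul_aux (x : HypSpace) : Complex.normSq (T.gE • x).horiz + (T.gE • x).height ^ 2 =
    T.κ ^ 2 / (Complex.normSq x.horiz + x.height ^ 2) := by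
  have := x.normSq_add_pos
  rw [gE_horiz, gE_height]
  simp only [Complex.normSq_div, Complex.normSq_mul, Complex.normSq_ofReal, Complex.normSq_conj]
  field_simp

/-- The input of `isLiftable`: each generator is a product of two reflections, the second being
`conjH`, and is therefore inverted under conjugation by it. -/
lemma conjH_gens (i : Fin 4) : conjH * MulAction.toPerm (T.gens i) * conjH =
    (MulAction.toPermHom PGL(2, ℂ) HypSpace (T.gens i))⁻¹ := by
  rw [eq_inv_iff_mul_eq_one]
  ext x : 1
  show conjH (T.gens i • conjH (T.gens i • x)) = x
  fin_cases i
  · have h1 := (T.gE • x).normSq_add_pos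
    have h2 := T.gE_smul_aux x
    have h3 := x.normSq_add_pos
    have h4 := T.κ_pos.ne'
    show conjH (T.gE • conjH (T.gE • x)) = x
    apply ext'
    · rw [conjH_horiz, gE_horiz, conjH_height, conjH_horiz, Complex.normSq_conj, h2, gE_horiz]
      have h3' := Complex.ofReal_ne_zero.2 h3.ne'
      have h4' := Complex.ofReal_ne_zero.2 h4
      generalize Complex.normSq x.horiz + x.height ^ 2 = n at *
      simp
      field_simp
    · rw [conjH_height, gE_height, conjH_height, conjH_horiz, Complex.normSq_conj, h2, gE_height]
      field_simp
  · show conjH (T.gF • conjH (T.gF • x)) = x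
    apply ext'
    · simp [conjH_horiz, gF_horiz]
    · simp [conjH_height, gF_height]
  · show conjH (T.gR • conjH (T.gR • x)) = x
    apply ext'
    · simp only [conjH_horiz, gR_horiz, map_mul, Complex.conj_conj]
      rw [← mul_assoc, mul_comm (conj _), Complex.mul_conj, Complex.normSq_eq_norm_sq, norm_u]
      simp
    · simp [conjH_height, gR_height]
  · show conjH ((1 : PGL(2, ℂ)) • conjH ((1 : PGL(2, ℂ)) • x)) = x
    simp only [one_smul]
    exact DFunLike.congr_fun conjH_mul_self x

/-- The action of the Coxeter group `[p,q,r]` by hyperbolic reflections. -/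
noncomputable def reflHom : T.W →* Equiv.Perm HypSpace :=
  T.cs.lift ⟨_, (T.isRotationSystem_gens.map (MulAction.toPermHom PGL(2, ℂ) HypSpace)).isLiftable
    T.conjH_gens⟩

noncomputable instance : MulAction T.W HypSpace := MulAction.compHom HypSpace T.reflHom

lemma simple_smul (i : Fin 4) (x : HypSpace) : T.cs.simple i • x = T.gens i • conjH x := by
  show T.reflHom (T.cs.simple i) x = _
  rw [reflHom, CoxeterSystem.lift_apply_simple]
  rfl

lemma simple_zero_horiz (x : HypSpace) : (T.cs.simple 0 • x).horiz =
    T.κ * x.horiz / ((Complex.normSq x.horiz + x.height ^ 2 : ℝ) : ℂ) := by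
  rw [simple_smul]
  show (T.gE • conjH x).horiz = _
  rw [gE_horiz, conjH_horiz, conjH_height, Complex.conj_conj, Complex.normSq_conj]

lemma simple_zero_height (x : HypSpace) : (T.cs.simple 0 • x).height =
    T.κ * x.height / (Complex.normSq x.horiz + x.height ^ 2) := by
  rw [simple_smul]
  show (T.gE • conjH x).height = _
  rw [gE_height, conjH_horiz, conjH_height, Complex.normSq_conj]

lemma simple_one_horiz (x : HypSpace) : (T.cs.simple 1 • x).horiz = 1 - conj x.horiz := by
  rw [simple_smul]
  show (T.gF • conjH x).horiz = _
  rw [gF_horiz, conjH_horiz]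

lemma simple_two_horiz (x : HypSpace) : (T.cs.simple 2 • x).horiz = T.u * conj x.horiz := by
  rw [simple_smul]
  show (T.gR • conjH x).horiz = _
  rw [gR_horiz, conjH_horiz]

lemma simple_three_smul (x : HypSpace) : T.cs.simple 3 • x = conjH x := by
  rw [simple_smul]
  exact one_smul _ _

lemma simple_height {i : Fin 4} (hi : i ≠ 0) (x : HypSpace) :
    (T.cs.simple i • x).height = x.height := by
  rw [simple_smul]
  fin_cases i
  · exact absurd rfl hi
  · exact T.gF_height _
  · exact T.gR_height _
  · show ((1 : PGL(2, ℂ)) • conjH x).height = _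
    rw [one_smul]; rfl

/-- The four walls of the fundamental chamber. -/
noncomputable def root : Fin 4 → HypSpace → ℝ := ![
  fun x => (Complex.normSq x.horiz + x.height ^ 2 - T.κ) * Real.cos (Real.pi / T.p) / x.height,
  fun x => (1 / 2 - x.horiz.re) / x.height,
  fun x => (Real.sin (Real.pi / T.r) * x.horiz.re - Real.cos (Real.pi / T.r) * x.horiz.im)
    / x.height,
  fun x => x.horiz.im / x.height]

lemma root_zero (x : HypSpace) : T.root 0 x =
    (Complex.normSq x.horiz + x.height ^ 2 - T.κ) * Real.cos (Real.pi / T.p) / x.height := rfl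

lemma root_one (x : HypSpace) : T.root 1 x = (1 / 2 - x.horiz.re) / x.height := rfl

lemma root_two (x : HypSpace) : T.root 2 x =
    (Real.sin (Real.pi / T.r) * x.horiz.re - Real.cos (Real.pi / T.r) * x.horiz.im)
    / x.height := rfl

lemma root_three (x : HypSpace) : T.root 3 x = x.horiz.im / x.height := rfl

lemma cos_p_pos : 0 < Real.cos (Real.pi / T.p) := by
  have hp : (3 : ℝ) ≤ T.p := by cases T <;> norm_num [p]
  apply Real.cos_pos_of_mem_Ioo
  have h0 := Real.pi_pos
  constructor
  · have : 0 < Real.pi / T.p := by positivity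
    linarith
  · rw [div_lt_div_iff₀ (by linarith) (by norm_num)]
    nlinarith

lemma κ_eq : 4 * Real.cos (Real.pi / T.p) ^ 2 * T.κ = 1 := by
  have := T.cos_p_pos
  rw [κ]
  field_simp

/-- Because the vertices are ideal, the tessellation {q,r} around a vertex is Euclidean: 1 / q + 1 /
r = 1 / 2. -/
lemma cos_q : Real.cos (Real.pi / T.q) = Real.sin (Real.pi / T.r) := by
  cases T <;> simp [q, r]

lemma cos_r_pos : 0 < Real.cos (Real.pi / T.r) := by
  cases T <;> simp [r]

lemma sin_r_pos : 0 < Real.sin (Real.pi / T.r) := by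
  cases T <;> simp [r]

lemma simple_two_re (x : HypSpace) : (T.cs.simple 2 • x).horiz.re =
    (2 * Real.cos (Real.pi / T.r) ^ 2 - 1) * x.horiz.re +
      2 * Real.sin (Real.pi / T.r) * Real.cos (Real.pi / T.r) * x.horiz.im := by
  rw [simple_two_horiz, u_eq, Real.cos_two_mul, Real.sin_two_mul]
  simp only [Complex.mul_re, Complex.add_re, Complex.add_im, Complex.ofReal_re, Complex.ofReal_im,
    Complex.mul_im, Complex.I_re, Complex.I_im, Complex.conj_re, Complex.conj_im]
  ring

lemma simple_two_im (x : HypSpace) : (T.cs.simple 2 • x).horiz.im =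
    2 * Real.sin (Real.pi / T.r) * Real.cos (Real.pi / T.r) * x.horiz.re -
    (2 * Real.cos (Real.pi / T.r) ^ 2 - 1) * x.horiz.im := by
  rw [simple_two_horiz, u_eq, Real.cos_two_mul, Real.sin_two_mul]
  simp only [Complex.mul_re, Complex.add_re, Complex.add_im, Complex.ofReal_re, Complex.ofReal_im,
    Complex.mul_im, Complex.I_re, Complex.I_im, Complex.conj_re, Complex.conj_im]
  ring

/-- Treated separately since wall 0 is the only hemisphere, its reflection being an inversion. The
angle π / p with wall 1 is where the value of κ enters. -/
lemma root_simple_zero (i : Fin 4) (x : HypSpace) : T.root i (T.cs.simple 0 • x) =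
    T.root i x + 2 * Real.cos (Real.pi / T.coxeterMatrix i 0) * T.root 0 x := by
  have hc := T.cos_p_pos
  have hκ := T.κ_eq
  have hκ0 := T.κ_pos
  have ht := x.height_pos
  have hn := x.normSq_add_pos
  have h1 : (T.cs.simple 0 • x).horiz.re =
      T.κ * x.horiz.re / (Complex.normSq x.horiz + x.height ^ 2) := by
    rw [simple_zero_horiz, Complex.div_ofReal_re, Complex.re_ofReal_mul]
  have h2 : (T.cs.simple 0 • x).horiz.im =
      T.κ * x.horiz.im / (Complex.normSq x.horiz + x.height ^ 2) := by
    rw [simple_zero_horiz, Complex.div_ofReal_im, Complex.im_ofReal_mul]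
  have h3 := T.simple_zero_height x
  have h4 : Complex.normSq (T.cs.simple 0 • x).horiz + (T.cs.simple 0 • x).height ^ 2 =
      T.κ ^ 2 / (Complex.normSq x.horiz + x.height ^ 2) := by
    rw [Complex.normSq_apply, h1, h2, h3]
    field_simp
    rw [Complex.normSq_apply]
    ring
  fin_cases i <;>
    simp only [Fin.zero_eta, Fin.mk_one, Fin.reduceFinMk, root_zero, root_one, root_two, root_three,
      h1, h2]
  · have : T.coxeterMatrix 0 0 = 1 := rfl
    rw [this, h4, h3]
    simp
    field_simp
    ring
  · have : T.coxeterMatrix 1 0 = T.p := rfl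
    rw [this, h3]
    field_simp
    linear_combination (-(Complex.normSq x.horiz + x.height ^ 2) + T.κ) * hκ
  · have : T.coxeterMatrix 2 0 = 2 := rfl
    rw [this, h3]
    simp
    field_simp
  · have : T.coxeterMatrix 3 0 = 2 := rfl
    rw [this, h3]
    simp
    field_simp

/-- Walls i and j meet at the angle π / m, where m is the Coxeter matrix entry, so the reflection in
j changes function i by 2 cos (π / m) times function j. This brings hyperbolic space within the
scope of Tits' lemma. -/
lemma isRootFamily : T.cs.IsRootFamily T.root := by
  have hc := T.cos_p_pos
  have hκ := T.κ_eq
  have hs := Real.sin_sq_add_cos_sq (Real.pi / T.r)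
  intro i j x
  have ht := x.height_pos
  have m2 : Real.cos (Real.pi / (2 : ℕ)) = 0 := by simp
  have m1 : Real.cos (Real.pi / (1 : ℕ)) = -1 := by simp
  fin_cases j
  · exact T.root_simple_zero i x
  · have h1 : (T.cs.simple 1 • x).horiz.re = 1 - x.horiz.re := by simp [simple_one_horiz]
    have h2 : (T.cs.simple 1 • x).horiz.im = x.horiz.im := by simp [simple_one_horiz]
    have h3 : (T.cs.simple 1 • x).height = x.height := T.simple_height (by decide) x
    have e0 : T.coxeterMatrix 0 1 = T.p := rfl
    have e1 : T.coxeterMatrix 1 1 = 1 := rfl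
    have e2 : T.coxeterMatrix 2 1 = T.q := rfl
    have e3 : T.coxeterMatrix 3 1 = 2 := rfl
    fin_cases i <;>
      simp only [Fin.zero_eta, Fin.mk_one, Fin.reduceFinMk, root_zero, root_one, root_two,
        root_three, Complex.normSq_apply, h1, h2, h3, e0, e1, e2, e3, m1, m2, cos_q] <;>
      field_simp <;> ring
  · have h1 := T.simple_two_re x
    have h2 := T.simple_two_im x
    have h3 : (T.cs.simple 2 • x).height = x.height := T.simple_height (by decide) x
    have h4 : Complex.normSq (T.cs.simple 2 • x).horiz = Complex.normSq x.horiz := by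
      rw [simple_two_horiz, Complex.normSq_mul, Complex.normSq_eq_norm_sq, norm_u]; simp
    have e0 : T.coxeterMatrix 0 2 = 2 := rfl
    have e1 : T.coxeterMatrix 1 2 = T.q := rfl
    have e2 : T.coxeterMatrix 2 2 = 1 := rfl
    have e3 : T.coxeterMatrix 3 2 = T.r := rfl
    fin_cases i <;>
      simp only [Fin.zero_eta, Fin.mk_one, Fin.reduceFinMk, root_zero, root_one, root_two,
        root_three, h1, h2, h3, h4, e0, e1, e2, e3, m1, m2, cos_q] <;>
      field_simp
    · ring
    · linear_combination -4 * x.horiz.re * hs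
    · linear_combination (2 * Real.cos (Real.pi / T.r) * x.horiz.im) * hs
    · ring
  · have h1 : (T.cs.simple 3 • x).horiz.re = x.horiz.re := by
      rw [simple_three_smul, conjH_horiz, Complex.conj_re]
    have h2 : (T.cs.simple 3 • x).horiz.im = -x.horiz.im := by
      rw [simple_three_smul, conjH_horiz, Complex.conj_im]
    have h3 : (T.cs.simple 3 • x).height = x.height := T.simple_height (by decide) x
    have e0 : T.coxeterMatrix 0 3 = 2 := rfl
    have e1 : T.coxeterMatrix 1 3 = 2 := rfl
    have e2 : T.coxeterMatrix 2 3 = T.r := rfl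
    have e3 : T.coxeterMatrix 3 3 = 1 := rfl
    fin_cases i <;>
      simp only [Fin.zero_eta, Fin.mk_one, Fin.reduceFinMk, root_zero, root_one, root_two,
        root_three, Complex.normSq_apply, h1, h2, h3, e0, e1, e2, e3, m1, m2] <;>
      field_simp <;> ring

lemma simple_smul_of_root_eq_zero (i : Fin 4) (x : HypSpace) (h : T.root i x = 0) :
    T.cs.simple i • x = x := by
  have ht := x.height_pos
  have hs := Real.sin_sq_add_cos_sq (Real.pi / T.r)
  fin_cases i
  · have h0 : Complex.normSq x.horiz + x.height ^ 2 = T.κ := by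
      have := T.cos_p_pos.ne'
      have h : T.root 0 x = 0 := h
      rw [root_zero] at h
      field_simp at h
      nlinarith [mul_right_cancel₀ this (h.trans (by ring : x.height * 0 = 0 * _))]
    have hκ := T.κ_pos.ne'
    have hκ' := Complex.ofReal_ne_zero.2 hκ
    apply ext'
    · show (T.cs.simple 0 • x).horiz = _
      rw [simple_zero_horiz, h0]
      field_simp
    · show (T.cs.simple 0 • x).height = _
      rw [simple_zero_height, h0]
      field_simp
  · have h0 : x.horiz.re = 1 / 2 := by
      have h : T.root 1 x = 0 := h
      rw [root_one] at h
      field_simp at h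
      linarith
    apply ext' _ (T.simple_height (by decide) x)
    show (T.cs.simple 1 • x).horiz = _
    rw [simple_one_horiz]
    apply Complex.ext
    · simp [h0]; norm_num
    · simp
  · have h0 : Real.sin (Real.pi / T.r) * x.horiz.re = Real.cos (Real.pi / T.r) * x.horiz.im := by
      have h : T.root 2 x = 0 := h
      rw [root_two] at h
      field_simp at h
      linarith
    apply ext' _ (T.simple_height (by decide) x)
    apply Complex.ext
    · refine (T.simple_two_re x).trans ?_
      linear_combination (-2 * Real.sin (Real.pi / T.r)) * h0 + 2 * x.horiz.re * hs
    · refine (T.simple_two_im x).trans ?_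
      linear_combination (2 * Real.cos (Real.pi / T.r)) * h0
  · have h0 : x.horiz.im = 0 := by
      have h : T.root 3 x = 0 := h
      rw [root_three] at h
      field_simp at h
      linarith
    apply ext' _ (T.simple_height (by decide) x)
    show (T.cs.simple 3 • x).horiz = _
    rw [simple_three_smul, conjH_horiz]
    apply Complex.ext <;> simp [h0]

end TessType
end RegTess

-- Hyperbolic distance, chambers and local finiteness.

namespace RegTess

namespace HypSpace

/-- The hyperbolic cosine of the hyperbolic distance. -/
noncomputable def coshDist (x y : HypSpace) : ℝ :=
  (Complex.normSq (x.horiz - y.horiz) + x.height ^ 2 + y.height ^ 2) / (2 * x.height * y.height)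

lemma coshDist_comm (x y : HypSpace) : coshDist x y = coshDist y x := by
  rw [coshDist, coshDist, ← neg_sub y.horiz, Complex.normSq_neg]
  ring

lemma coshDist_self (x : HypSpace) : coshDist x x = 1 := by
  have := x.height_pos
  simp [coshDist]
  field_simp
  norm_num

lemma one_le_coshDist (x y : HypSpace) : 1 ≤ coshDist x y := by
  have := x.height_pos
  have := y.height_pos
  rw [coshDist, le_div_iff₀ (by positivity)]
  nlinarith [Complex.normSq_nonneg (x.horiz - y.horiz), sq_nonneg (x.height - y.height)]

/-- The triangle inequality with cosh (s + t) ≤ 2 cosh s cosh t; this weak form suffices for all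
boundedness arguments. -/
lemma coshDist_le_mul (x y z : HypSpace) :
    coshDist x z ≤ 2 * coshDist x y * coshDist y z := by
  have hx := x.height_pos
  have hy := y.height_pos
  have hz := z.height_pos
  have e : x.horiz - z.horiz = (x.horiz - y.horiz) + (y.horiz - z.horiz) := by ring
  rw [coshDist, coshDist, coshDist, e]
  generalize x.horiz - y.horiz = a
  generalize y.horiz - z.horiz = b
  -- By |a|²|b|² = (a·b)² + (a×b)², the difference of the two sides is a sum of squares.
  have key : y.height ^ 2 * (Complex.normSq (a + b) + x.height ^ 2 + z.height ^ 2) ≤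
      (Complex.normSq a + x.height ^ 2 + y.height ^ 2) *
        (Complex.normSq b + y.height ^ 2 + z.height ^ 2) := by
    simp only [Complex.normSq_apply, Complex.add_re, Complex.add_im]
    nlinarith [sq_nonneg (y.height ^ 2 - (a.re * b.re + a.im * b.im)),
      sq_nonneg (a.re * b.im - a.im * b.re), sq_nonneg (x.height * z.height),
      mul_nonneg (sq_nonneg a.re) (sq_nonneg z.height),
      mul_nonneg (sq_nonneg a.im) (sq_nonneg z.height),
      mul_nonneg (sq_nonneg b.re) (sq_nonneg x.height),
      mul_nonneg (sq_nonneg b.im) (sq_nonneg x.height)]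
  rw [mul_assoc 2 (_ / _), div_mul_div_comm, mul_div_assoc', div_le_div_iff₀ (by positivity) (by positivity)]
  have : 0 < x.height * z.height := by positivity
  nlinarith [mul_le_mul_of_nonneg_left key this.le]

@[fun_prop]
lemma continuous_horiz : Continuous horiz := continuous_fst.comp continuous_subtype_val

@[fun_prop]
lemma continuous_height : Continuous height := continuous_snd.comp continuous_subtype_val

lemma continuous_coshDist : Continuous fun p : HypSpace × HypSpace => coshDist p.1 p.2 := by
  unfold coshDist
  refine Continuous.div ?_ ?_ fun p => ?_
  · have := Complex.continuous_normSq
    fun_prop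
  · fun_prop
  · have := p.1.height_pos
    have := p.2.height_pos
    positivity

lemma exists_isCompact_coshDist (b : HypSpace) (D : ℝ) :
    ∃ K : Set HypSpace, IsCompact K ∧ {x | coshDist x b ≤ D} ⊆ K := by
  have hb := b.height_pos
  rcases le_or_gt D 0 with hD | hD
  · refine ⟨∅, isCompact_empty, fun x hx => ?_⟩
    have := one_le_coshDist x b
    have hx : coshDist x b ≤ D := hx
    linarith
  let C : Set (ℂ × ℝ) := Metric.closedBall b.horiz (2 * D * b.height) ×ˢ
    Set.Icc (b.height / (2 * D)) (2 * D * b.height)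
  have hC : IsCompact C := (isCompact_closedBall _ _).prod isCompact_Icc
  refine ⟨(Subtype.val : {x : ℂ × ℝ // 0 < x.2} → ℂ × ℝ) ⁻¹' C, ?_, ?_⟩
  · refine (Topology.IsInducing.subtypeVal.isCompact_preimage_iff ?_).2 hC
    rintro ⟨w, t⟩ h
    have : 0 < b.height / (2 * D) := by positivity
    exact ⟨⟨(w, t), this.trans_le h.2.1⟩, rfl⟩
  · intro x hx
    have hx : coshDist x b ≤ D := hx
    have ht := x.height_pos
    rw [coshDist, div_le_iff₀ (by positivity)] at hx
    have hn := Complex.normSq_nonneg (x.horiz - b.horiz)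
    have h1 : x.height ≤ 2 * D * b.height := by
      by_contra! hc
      nlinarith
    have h2 : b.height / (2 * D) ≤ x.height := by
      rw [div_le_iff₀ (by positivity)]
      by_contra! hc
      nlinarith
    refine ⟨?_, h2, h1⟩
    show dist x.horiz b.horiz ≤ _
    rw [dist_eq_norm]
    refine abs_le_of_sq_le_sq' ?_ (by positivity) |>.2
    rw [← Complex.normSq_eq_norm_sq]
    nlinarith

end HypSpace

namespace TessType

open HypSpace

variable (T : TessType)

/-- In the hyperboloid model `root i` is the Lorentz product with a unit normal of wall i.
Consequently, reflecting a point across a wall to the side away from `basePt` increases its distance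
from `basePt`, which drives the estimates below. -/
lemma coshDist_simple_smul (i : Fin 4) (x y : HypSpace) :
    coshDist (T.cs.simple i • x) y = coshDist x y + 2 * T.root i x * T.root i y := by
  have hx := x.height_pos
  have hy := y.height_pos
  have hs := Real.sin_sq_add_cos_sq (Real.pi / T.r)
  have hc := T.cos_p_pos
  have hκ := T.κ_eq
  have hκ0 := T.κ_pos
  have hn := x.normSq_add_pos
  fin_cases i
  · have h1 : (T.cs.simple 0 • x).horiz.re =
        T.κ * x.horiz.re / (Complex.normSq x.horiz + x.height ^ 2) := by
      rw [simple_zero_horiz, Complex.div_ofReal_re, Complex.re_ofReal_mul]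
    have h2 : (T.cs.simple 0 • x).horiz.im =
        T.κ * x.horiz.im / (Complex.normSq x.horiz + x.height ^ 2) := by
      rw [simple_zero_horiz, Complex.div_ofReal_im, Complex.im_ofReal_mul]
    have h3 := T.simple_zero_height x
    simp only [Fin.zero_eta, coshDist, root_zero, Complex.normSq_apply, Complex.sub_re,
      Complex.sub_im, h1, h2, h3] at hn ⊢
    have : ∀ a b : ℝ, 2 * (a * Real.cos (Real.pi / T.p) / x.height) *
      (b * Real.cos (Real.pi / T.p) / y.height) = 2 * a * b / (4 * T.κ) / (x.height * y.height) := by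
      intro a b
      field_simp
      linear_combination a * b * hκ
    rw [this]
    field_simp
    ring
  · have h3 : (T.cs.simple 1 • x).height = x.height := T.simple_height (by decide) x
    simp only [Fin.mk_one, coshDist, root_one, Complex.normSq_apply, Complex.sub_re,
      Complex.sub_im, h3, simple_one_horiz, Complex.one_re, Complex.one_im, Complex.conj_re,
      Complex.conj_im]
    field_simp
    ring
  · have h3 : (T.cs.simple 2 • x).height = x.height := T.simple_height (by decide) x
    simp only [Fin.reduceFinMk, coshDist, root_two, Complex.normSq_apply, Complex.sub_re,
      Complex.sub_im, h3, simple_two_re, simple_two_im]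
    generalize Real.sin (Real.pi / T.r) = s at *
    generalize Real.cos (Real.pi / T.r) = c at *
    have h1 : (2 * c ^ 2 - 1) * x.horiz.re + 2 * s * c * x.horiz.im =
        x.horiz.re - 2 * s * (s * x.horiz.re - c * x.horiz.im) := by
      linear_combination 2 * x.horiz.re * hs
    rw [h1]
    field_simp
    linear_combination 4 * (s * x.horiz.re - c * x.horiz.im) ^ 2 * hs
  · simp only [Fin.reduceFinMk, coshDist, root_three, Complex.normSq_apply, Complex.sub_re,
      Complex.sub_im, simple_three_smul, conjH_horiz, conjH_height, Complex.conj_re,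
      Complex.conj_im]
    field_simp
    ring

lemma coshDist_smul_smul (w : T.W) (x y : HypSpace) :
    coshDist (w • x) (w • y) = coshDist x y := by
  induction w using T.cs.simple_induction_left with
  | one => simp
  | mul_simple_left w i ih =>
    rw [mul_smul, mul_smul, coshDist_simple_smul, coshDist_comm, coshDist_simple_smul,
      T.isRootFamily.apply_self, coshDist_comm, ih]
    ring

/-- A point in the interior of the fundamental chamber. -/
noncomputable def basePt : HypSpace :=
  ⟨(⟨1 / 4, Real.sin (Real.pi / T.r) / 8⟩, 2), by norm_num⟩

lemma κ_le_one : T.κ ≤ 1 := by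
  have hc : 1 / 2 ≤ Real.cos (Real.pi / T.p) := by
    rw [← Real.cos_pi_div_three]
    have hp : (3 : ℝ) ≤ T.p := by cases T <;> norm_num [p]
    apply Real.cos_le_cos_of_nonneg_of_le_pi (by positivity)
    · linarith [Real.pi_pos]
    · gcongr
  have := T.κ_eq
  have h4 : 1 ≤ 4 * Real.cos (Real.pi / T.p) ^ 2 := by nlinarith
  nlinarith [mul_le_mul_of_nonneg_right h4 T.κ_pos.le]

lemma root_basePt_pos (i : Fin 4) : 0 < T.root i T.basePt := by
  have hs := T.sin_r_pos
  have hc := T.cos_p_pos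
  have hc1 := Real.cos_le_one (Real.pi / T.r)
  have hκ := T.κ_le_one
  have h1 : T.basePt.horiz.re = 1 / 4 := rfl
  have h2 : T.basePt.horiz.im = Real.sin (Real.pi / T.r) / 8 := rfl
  have h3 : T.basePt.height = 2 := rfl
  fin_cases i <;> simp only [Fin.zero_eta, Fin.mk_one, Fin.reduceFinMk, root_zero, root_one,
    root_two, root_three, Complex.normSq_apply, h1, h2, h3]
  · have : 0 < 1 / 4 * (1 / 4) + Real.sin (Real.pi / T.r) / 8 * (Real.sin (Real.pi / T.r) / 8)
        + 2 ^ 2 - T.κ := by nlinarith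
    positivity
  · norm_num
  · have : 0 < Real.sin (Real.pi / T.r) * (1 / 4) - Real.cos (Real.pi / T.r) *
        (Real.sin (Real.pi / T.r) / 8) := by nlinarith
    positivity
  · positivity

/-- The closed fundamental chamber of the Coxeter group. -/
def chamber : Set HypSpace := {x | ∀ i, 0 ≤ T.root i x}

lemma basePt_mem : T.basePt ∈ T.chamber := fun i => (T.root_basePt_pos i).le

lemma coshDist_basePt_le {x : HypSpace} (hx : x ∈ T.chamber) (w : T.W) :
    coshDist x T.basePt ≤ coshDist (w • x) T.basePt := by
  induction hn : T.cs.length w generalizing w with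
  | zero =>
    rw [CoxeterSystem.length_eq_zero_iff] at hn
    simp [hn]
  | succ n ih =>
    obtain ⟨i, w', rfl, hl, h1, -⟩ := T.isRootFamily.exists_descent (w := w)
      T.coxeterMatrix_ne_zero (by rintro rfl; simp at hn)
    rw [mul_smul, coshDist_simple_smul]
    have := ih w' (by omega)
    have := mul_nonneg (h1 x hx) (T.root_basePt_pos i).le
    linarith

/-- Building w letter by letter, the first reflection adds 2 `root i basePt` ² and the later ones
only increase the distance, so the minimum over the four walls gives the gap. -/
lemma exists_coshDist_basePt : ∃ ε > 1, ∀ w : T.W, w ≠ 1 →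
    ε ≤ coshDist (w • T.basePt) T.basePt := by
  obtain ⟨k, hk⟩ := Finite.exists_min (fun i => T.root i T.basePt)
  have hk0 := T.root_basePt_pos k
  refine ⟨1 + 2 * (T.root k T.basePt * T.root k T.basePt), by nlinarith, fun w hw => ?_⟩
  induction hn : T.cs.length w generalizing w with
  | zero =>
    rw [CoxeterSystem.length_eq_zero_iff] at hn
    exact absurd hn hw
  | succ n ih =>
    obtain ⟨i, w', rfl, hl, -, h1⟩ := T.isRootFamily.exists_descent T.coxeterMatrix_ne_zero hw
    rw [mul_smul, coshDist_simple_smul]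
    by_cases hw' : w' = 1
    · subst hw'
      have := mul_self_le_mul_self hk0.le (hk i)
      rw [one_smul, coshDist_self]
      linarith
    · have := ih w' hw' (by omega)
      have := mul_pos (h1 _ T.root_basePt_pos) (T.root_basePt_pos i)
      linarith

/-- The orbit of `basePt` is uniformly separated, by the previous gap and invariance of distance, so
it meets a compact set in finitely many points. -/
lemma finite_coshDist_basePt (D : ℝ) :
    {w : T.W | coshDist (w • T.basePt) T.basePt ≤ D}.Finite := by
  obtain ⟨ε, hε, hsep⟩ := T.exists_coshDist_basePt
  obtain ⟨K, hK, hDK⟩ := exists_isCompact_coshDist T.basePt D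
  have : {w : T.W | w • T.basePt ∈ K}.Finite := by
    refine hK.induction_on (p := fun A => {w : T.W | w • T.basePt ∈ A}.Finite) (by simp)
      (fun A B hAB hB => hB.subset (Set.preimage_mono (f := fun w : T.W => w • T.basePt) hAB))
      (fun A B hA hB => (hA.union hB).subset
        (Set.preimage_union (f := fun w : T.W => w • T.basePt)).le) fun y _ => ?_
    have h1 : {p : HypSpace × HypSpace | coshDist p.1 p.2 < ε} ∈ nhds (y, y) := by
      apply (isOpen_lt continuous_coshDist continuous_const).mem_nhds
      simpa [coshDist_self] using hε
    rw [nhds_prod_eq, Filter.mem_prod_same_iff] at h1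
    obtain ⟨U, hU, hUU⟩ := h1
    refine ⟨U, mem_nhdsWithin_of_mem_nhds hU, Set.Subsingleton.finite ?_⟩
    intro w hw w' hw'
    change w • T.basePt ∈ U at hw
    change w' • T.basePt ∈ U at hw'
    by_contra hne
    have h2 : ε ≤ coshDist ((w'⁻¹ * w) • T.basePt) T.basePt :=
      hsep (w'⁻¹ * w) fun h => hne (inv_mul_eq_one.1 h).symm
    have h3 := @hUU (w • T.basePt, w' • T.basePt) (Set.mk_mem_prod hw hw')
    rw [Set.mem_ofPred_eq] at h3
    have h4 := T.coshDist_smul_smul w' ((w'⁻¹ * w) • T.basePt) T.basePt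
    rw [smul_smul, mul_inv_cancel_left] at h4
    linarith
  exact this.subset fun w hw => hDK hw

/-- The chamber is not compact. But points of the chamber are the nearest to `basePt` in their
orbits, so x is as near as `w • x`, which bounds the distance of `w • basePt`. -/
lemma finite_smul_chamber (D : ℝ) :
    {w : T.W | ∃ x ∈ T.chamber, coshDist (w • x) T.basePt ≤ D}.Finite := by
  refine (T.finite_coshDist_basePt (2 * D * D)).subset ?_
  rintro w ⟨x, hx, h⟩
  have h1 := T.coshDist_basePt_le hx w
  have h2 := coshDist_le_mul (w • T.basePt) (w • x) T.basePt
  rw [T.coshDist_smul_smul, coshDist_comm T.basePt x] at h2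
  have h3 := one_le_coshDist x T.basePt
  have h4 := one_le_coshDist (w • x) T.basePt
  show coshDist (w • T.basePt) T.basePt ≤ _
  calc _ ≤ _ := h2
    _ ≤ 2 * D * D := by gcongr <;> linarith

/-- The chambers cover hyperbolic space. -/
lemma exists_smul_mem_chamber (x : HypSpace) : ∃ w : T.W, w • x ∈ T.chamber := by
  have hfin : {w : T.W | coshDist (w • x) T.basePt ≤ coshDist x T.basePt}.Finite := by
    refine (T.finite_coshDist_basePt
      (2 * coshDist T.basePt x * coshDist x T.basePt)).subset fun w hw => ?_
    have h2 := coshDist_le_mul (w • T.basePt) (w • x) T.basePt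
    rw [T.coshDist_smul_smul] at h2
    have h3 := one_le_coshDist T.basePt x
    have hw : coshDist (w • x) T.basePt ≤ coshDist x T.basePt := hw
    show coshDist (w • T.basePt) T.basePt ≤ _
    calc _ ≤ _ := h2
      _ ≤ _ := by gcongr
  obtain ⟨w, hw, hmin⟩ := Set.exists_min_image _ (fun w : T.W => coshDist (w • x) T.basePt) hfin
    ⟨1, by simp⟩
  refine ⟨w, fun i => ?_⟩
  -- At a point of the orbit nearest to `basePt`, a negative root would allow a reflection to a
  -- still nearer point.
  by_contra! hneg
  have h1 : coshDist ((T.cs.simple i * w) • x) T.basePt < coshDist (w • x) T.basePt := by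
    rw [mul_smul, coshDist_simple_smul]
    have := mul_neg_of_neg_of_pos hneg (T.root_basePt_pos i)
    linarith
  have := hmin _ (h1.le.trans hw)
  linarith

lemma stabilizer_chamber {x : HypSpace} (hx : x ∈ T.chamber) {w : T.W} (hw : w • x ∈ T.chamber) :
    w • x = x ∧ w ∈ Subgroup.closure (T.cs.simple '' {i | T.root i x = 0}) :=
  T.isRootFamily.stabilizer T.coxeterMatrix_ne_zero T.simple_smul_of_root_eq_zero hx _ w rfl hw

lemma eq_one_of_smul_basePt {w : T.W} (h : w • T.basePt = T.basePt) : w = 1 := by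
  obtain ⟨ε, hε, hsep⟩ := T.exists_coshDist_basePt
  by_contra hw
  have := hsep w hw
  rw [h, coshDist_self] at this
  linarith

/-- The points of the fundamental chamber are the highest in their orbits, and the other highest
points are obtained from them by the stabilizer of `∞`. -/
lemma height_smul_le {x : HypSpace} (hx : x ∈ T.chamber) (w : T.W) :
    (w • x).height ≤ x.height ∧ ((w • x).height = x.height →
      ∃ w' ∈ Subgroup.closure (T.cs.simple '' {0}ᶜ), w • x = w' • x) := by
  induction hn : T.cs.length w generalizing w with
  | zero =>
    rw [CoxeterSystem.length_eq_zero_iff] at hn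
    exact ⟨by simp [hn], fun _ => ⟨1, one_mem _, by simp [hn]⟩⟩
  | succ n ih =>
    obtain ⟨i, w', rfl, hl, h1, -⟩ := T.isRootFamily.exists_descent (w := w)
      T.coxeterMatrix_ne_zero (by rintro rfl; simp at hn)
    obtain ⟨h2, h3⟩ := ih w' (by omega)
    have h4 := h1 x hx
    rw [mul_smul]
    -- Only `s_0` changes heights. From the nonnegative side of wall 0 it lowers the point, or fixes
    -- it if the point is on the wall.
    by_cases hi : i = 0
    · subst hi
      have hp := (w' • x).normSq_add_pos
      have ht := (w' • x).height_pos
      have hκ := T.κ_pos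
      have hc := T.cos_p_pos
      rw [root_zero, le_div_iff₀ ht, zero_mul, mul_nonneg_iff_of_pos_right hc] at h4
      have h5 : (T.cs.simple 0 • w' • x).height ≤ (w' • x).height := by
        rw [simple_zero_height, div_le_iff₀ hp]
        nlinarith
      refine ⟨h5.trans h2, fun h6 => ?_⟩
      have h7 : (T.cs.simple 0 • w' • x).height = (w' • x).height := le_antisymm h5 (by linarith)
      rw [T.simple_smul_of_root_eq_zero]
      · exact h3 (by linarith)
      · rw [simple_zero_height, div_eq_iff hp.ne'] at h7
        rw [root_zero]
        have : Complex.normSq (w' • x).horiz + (w' • x).height ^ 2 - T.κ = 0 := by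
          apply mul_left_cancel₀ ht.ne'
          linarith
        simp [this]
    · rw [T.simple_height hi]
      refine ⟨h2, fun h6 => ?_⟩
      obtain ⟨v, hv, he⟩ := h3 h6
      exact ⟨T.cs.simple i * v, mul_mem (Subgroup.subset_closure ⟨i, hi, rfl⟩) hv,
        by rw [he, mul_smul]⟩

end TessType
end RegTess

-- The rotation group inside the Coxeter group, and its presentation.

namespace RegTess

open HypSpace

/-- `PGL(2, ℂ)` acts faithfully on hyperbolic space. -/
lemma pgl_eq_one_of_smul {g : PGL(2, ℂ)} (h : ∀ x : HypSpace, g • x = x) : g = 1 := by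
  induction g using Matrix.ProjGenLinGroup.induction_on with
  | mk A =>
  have hh : ∀ x : HypSpace, moebius A x = x := h
  set a := A 0 0
  set b := A 0 1
  set c := A 1 0
  set d := A 1 1
  have hor : ∀ x : HypSpace, (a * x.horiz + b) * conj (c * x.horiz + d)
      + a * conj c * (x.height : ℂ) ^ 2 = x.horiz * (denom A x : ℂ) := by
    intro x
    have := congrArg horiz (hh x)
    have h0 : (denom A x : ℂ) ≠ 0 := Complex.ofReal_ne_zero.2 (denom_pos A x).ne'
    exact (div_eq_iff h0).1 this
  have hei : ∀ x : HypSpace, ‖A.1.det‖ = denom A x := by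
    intro x
    have := congrArg height (hh x)
    have h0 := (denom_pos A x).ne'
    have h1 : ‖A.1.det‖ * x.height / denom A x = x.height := this
    rw [div_eq_iff h0, mul_comm] at h1
    exact mul_left_cancel₀ x.height_pos.ne' h1
  let x1 : HypSpace := ⟨(0, 1), one_pos⟩
  let x2 : HypSpace := ⟨(0, 2), two_pos⟩
  let x3 : HypSpace := ⟨(1, 1), one_pos⟩
  have hc : c = 0 := by
    have h12 := (hei x1).symm.trans (hei x2)
    have e1 : denom A x1 = Complex.normSq (c * 0 + d) + Complex.normSq c * 1 ^ 2 := rfl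
    have e2 : denom A x2 = Complex.normSq (c * 0 + d) + Complex.normSq c * 2 ^ 2 := rfl
    rw [e1, e2] at h12
    apply Complex.normSq_eq_zero.1
    linarith
  have hd : d ≠ 0 := by
    intro hd
    have := denom_pos A x1
    have e1 : denom A x1 = Complex.normSq (c * 0 + d) + Complex.normSq c * 1 ^ 2 := rfl
    rw [e1, hc, hd] at this
    simp at this
  have hcd : conj d ≠ 0 := by simpa using hd
  have hb : b = 0 := by
    have h1 : (a * 0 + b) * conj (c * 0 + d) + a * conj c * ((1 : ℝ) : ℂ) ^ 2 =
      0 * (denom A x1 : ℂ) := hor x1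
    rw [hc] at h1
    simpa [hd] using h1
  have ha : a = d := by
    have h1 : (a * 1 + b) * conj (c * 1 + d) + a * conj c * ((1 : ℝ) : ℂ) ^ 2 =
      1 * (denom A x3 : ℂ) := hor x3
    have e1 : denom A x3 = Complex.normSq (c * 1 + d) + Complex.normSq c * 1 ^ 2 := rfl
    rw [e1, hc, hb] at h1
    simp only [mul_one, zero_add, add_zero, map_zero, one_mul, one_pow, mul_zero,
      Complex.ofReal_one, ← Complex.mul_conj] at h1
    exact mul_right_cancel₀ hcd h1
  rw [Matrix.ProjGenLinGroup.mk_eq_one, Matrix.GeneralLinearGroup.center_eq_range_scalar]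
  refine ⟨Units.mk0 d hd, ?_⟩
  ext i j
  fin_cases i <;> fin_cases j
  · exact ha.symm
  · exact hb.symm
  · exact hc.symm
  · rfl

lemma pgl_ext {g h : PGL(2, ℂ)} (H : ∀ x : HypSpace, g • x = h • x) : g = h := by
  rw [← inv_mul_eq_one]
  exact pgl_eq_one_of_smul fun x => by rw [mul_smul, inv_smul_eq_iff, H]

namespace TessType

variable (T : TessType)

lemma simple_mul_simple_three_smul (i : Fin 4) (x : HypSpace) :
    (T.cs.simple i * T.cs.simple 3) • x = T.gens i • x := by
  rw [mul_smul, simple_smul, simple_three_smul]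
  congr 1
  exact DFunLike.congr_fun conjH_mul_self x

lemma W_eq_of_smul {v w : T.W} (h : ∀ x : HypSpace, v • x = w • x) : v = w := by
  rw [← inv_mul_eq_one]
  apply T.eq_one_of_smul_basePt
  rw [mul_smul, inv_smul_eq_iff, h]

/-- The parity is recorded because it is what separates rotations from reflections later on. -/
lemma exists_W_smul_eq {γ : PGL(2, ℂ)} (hγ : γ ∈ T.Γ) :
    ∃ w : T.W, T.cs.lengthParity w = 1 ∧ ∀ x : HypSpace, w • x = γ • x := by
  rw [← closure_gens] at hγ
  induction hγ using Subgroup.closure_induction with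
  | mem _ h =>
    obtain ⟨i, rfl⟩ := h
    refine ⟨_, ?_, T.simple_mul_simple_three_smul i⟩
    rw [map_mul, CoxeterSystem.lengthParity_simple, CoxeterSystem.lengthParity_simple]
    rfl
  | one => exact ⟨1, map_one _, fun x => by simp⟩
  | mul a b _ _ ha hb =>
    obtain ⟨v, hv, hv'⟩ := ha
    obtain ⟨w, hw, hw'⟩ := hb
    exact ⟨v * w, by rw [map_mul, hv, hw, one_mul], fun x => by rw [mul_smul, mul_smul, hv', hw']⟩
  | inv a _ ha =>
    obtain ⟨v, hv, hv'⟩ := ha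
    exact ⟨v⁻¹, by rw [map_inv, hv, inv_one], fun x => by
      rw [inv_smul_eq_iff, hv', smul_inv_smul]⟩

/-- The embedding of the rotation group into the Coxeter group. -/
noncomputable def toW : T.Γ →* T.W :=
  MonoidHom.mk' (fun γ => (T.exists_W_smul_eq γ.2).choose) fun a b => T.W_eq_of_smul fun x => by
    rw [(T.exists_W_smul_eq (a * b).2).choose_spec.2, mul_smul,
      (T.exists_W_smul_eq a.2).choose_spec.2, (T.exists_W_smul_eq b.2).choose_spec.2, ← mul_smul]
    rfl

lemma toW_smul (γ : T.Γ) (x : HypSpace) : T.toW γ • x = (γ : PGL(2, ℂ)) • x :=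
  (T.exists_W_smul_eq γ.2).choose_spec.2 x

lemma lengthParity_toW (γ : T.Γ) : T.cs.lengthParity (T.toW γ) = 1 :=
  (T.exists_W_smul_eq γ.2).choose_spec.1

/-- The generators as elements of the rotation group. -/
noncomputable def genΓ (i : Fin 4) : T.Γ := ⟨T.gens i, T.gens_mem i⟩

lemma toW_genΓ (i : Fin 4) : T.toW (T.genΓ i) = T.cs.simple i * T.cs.simple 3 :=
  T.W_eq_of_smul fun x => by rw [toW_smul, simple_mul_simple_three_smul]; rfl

lemma isRotationSystem_genΓ : T.IsRotationSystem T.genΓ := by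
  obtain ⟨h1, h2⟩ := T.isRotationSystem_gens
  exact ⟨Subtype.ext h1, fun i j => Subtype.ext (h2 i j)⟩

lemma Γ_induction {P : T.Γ → Prop} (mem : ∀ i, P (T.genΓ i)) (one : P 1)
    (mul : ∀ a b, P a → P b → P (a * b)) (inv : ∀ a, P a → P a⁻¹) (γ : T.Γ) : P γ := by
  obtain ⟨γ, hγ⟩ := γ
  have hγ' := hγ
  rw [← closure_gens] at hγ'
  induction hγ' using Subgroup.closure_induction with
  | mem _ h => obtain ⟨i, rfl⟩ := h; exact mem i
  | one => exact one
  | mul a b ha hb iha ihb =>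
    rw [closure_gens] at ha hb
    exact mul _ _ (iha ha) (ihb hb)
  | inv a ha iha =>
    rw [closure_gens] at ha
    exact inv _ (iha ha)

/-- The presentation of the rotation group. -/
theorem exists_hom_of_isRotationSystem {G : Type*} [Group G] {a : Fin 4 → G}
    (ha : T.IsRotationSystem a) : ∃ η : T.Γ →* G, ∀ i, η (T.genΓ i) = a i := by
  -- G need not have an automorphism that inverts all `a i`. Doubling supplies one: the pair `(a i,
  -- (a i)⁻¹)` acts on two copies of G, and the swap σ of the copies inverts it, so the universal
  -- property of the Coxeter group applies.
  let D : G × G →* Equiv.Perm (G ⊕ G) := (Equiv.Perm.sumCongrHom G G).comp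
    (MonoidHom.prodMap (MulAction.toPermHom G G) (MulAction.toPermHom G G))
  have hD : Function.Injective D := by
    rintro ⟨g, h⟩ ⟨g', h'⟩ he
    have h1 := DFunLike.congr_fun he (Sum.inl 1)
    have h2 := DFunLike.congr_fun he (Sum.inr 1)
    simpa [D] using And.intro h1 h2
  let σ : Equiv.Perm (G ⊕ G) := Equiv.sumComm G G
  let A : Fin 4 → G × G := fun i => (a i, (a i)⁻¹)
  have hA : T.IsRotationSystem A := by
    refine ⟨by simp [A, ha.1], fun i j => ?_⟩
    have h1 : ((a i)⁻¹ * ((a j)⁻¹)⁻¹) ^ T.coxeterMatrix i j = 1 := by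
      have h2 := ha.2 i j
      have h3 : (a i)⁻¹ * ((a j)⁻¹)⁻¹ = (a i)⁻¹ * (a i * (a j)⁻¹)⁻¹ * ((a i)⁻¹)⁻¹ := by group
      rw [h3, conj_pow, inv_pow, h2]
      group
    simp only [A, Prod.inv_mk, Prod.mk_mul_mk, Prod.pow_mk, ha.2 i j, h1]
    rfl
  have hσ : ∀ i, σ * D (A i) * σ = (D (A i))⁻¹ := by
    intro i
    rw [← map_inv]
    ext x : 1
    rcases x with x | x <;> simp [σ, D, A]
  let Λ : T.W →* Equiv.Perm (G ⊕ G) := T.cs.lift ⟨_, (hA.map D).isLiftable hσ⟩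
  have hΛ : ∀ i, Λ (T.toW (T.genΓ i)) = D (A i) := by
    intro i
    have h3 : σ * σ = 1 := by ext x : 1; rcases x with x | x <;> rfl
    have h4 : D (A 3) = 1 := by rw [hA.1, map_one]
    rw [toW_genΓ, map_mul, CoxeterSystem.lift_apply_simple, CoxeterSystem.lift_apply_simple]
    show D (A i) * σ * (D (A 3) * σ) = _
    rw [h4, one_mul, mul_assoc, h3, mul_one]
  -- On rotations the swaps cancel, so the image lies in the copy of G × G, whose first factor gives
  -- the desired homomorphism.
  have hmem : ∀ γ : T.Γ, Λ (T.toW γ) ∈ D.range := by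
    refine T.Γ_induction (fun i => ⟨A i, (hΛ i).symm⟩) ?_ ?_ ?_
    · rw [map_one, map_one]; exact one_mem _
    · intro a b ha hb
      rw [map_mul, map_mul]; exact mul_mem ha hb
    · intro a ha
      rw [map_inv, map_inv]; exact inv_mem ha
  refine ⟨(MonoidHom.fst G G).comp (((MonoidHom.ofInjective hD).symm.toMonoidHom).comp
    ((Λ.comp T.toW).codRestrict D.range hmem)), fun i => ?_⟩
  have : (MonoidHom.ofInjective hD).symm ⟨Λ (T.toW (T.genΓ i)), hmem _⟩ = A i := by
    rw [MulEquiv.symm_apply_eq]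
    exact Subtype.ext (hΛ i)
  exact congrArg Prod.fst this

lemma conjH_gens_smul (i : Fin 4) (x : HypSpace) :
    conjH (T.gens i • x) = (T.gens i)⁻¹ • conjH x := by
  have h := DFunLike.congr_fun (T.conjH_gens i) (conjH x)
  rw [← map_inv] at h
  have h2 : conjH (conjH x) = x := DFunLike.congr_fun conjH_mul_self x
  have h3 : conjH (T.gens i • conjH (conjH x)) = (T.gens i)⁻¹ • conjH x := h
  rwa [h2] at h3

/-- Elements of the Coxeter group agree with rotations up to the reflection `conjH`. -/
lemma exists_gens_smul_eq {I : Set (Fin 4)} {w : T.W}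
    (hw : w ∈ Subgroup.closure (T.cs.simple '' I)) : ∃ γ ∈ Subgroup.closure (T.gens '' I),
      (∀ x : HypSpace, w • x = γ • x) ∨ (∀ x : HypSpace, w • x = γ • conjH x) := by
  have h2 : ∀ x, conjH (conjH x) = x := fun x => DFunLike.congr_fun conjH_mul_self x
  have key : ∀ w : T.W, ∀ i ∈ I, (∃ γ ∈ Subgroup.closure (T.gens '' I),
      (∀ x : HypSpace, w • x = γ • x) ∨ (∀ x : HypSpace, w • x = γ • conjH x)) →
      (∃ γ ∈ Subgroup.closure (T.gens '' I), (∀ x : HypSpace, (w * T.cs.simple i) • x = γ • x) ∨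
        (∀ x : HypSpace, (w * T.cs.simple i) • x = γ • conjH x)) := by
    rintro w i hi ⟨γ, hγ, h | h⟩
    · refine ⟨γ * T.gens i, mul_mem hγ (Subgroup.subset_closure ⟨i, hi, rfl⟩), Or.inr fun x => ?_⟩
      rw [mul_smul, h, simple_smul, mul_smul]
    · refine ⟨γ * (T.gens i)⁻¹, mul_mem hγ (inv_mem (Subgroup.subset_closure ⟨i, hi, rfl⟩)),
        Or.inl fun x => ?_⟩
      rw [mul_smul, h, simple_smul, conjH_gens_smul, h2, mul_smul]
  induction hw using Subgroup.closure_induction_right with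
  | one => exact ⟨1, one_mem _, Or.inl fun x => by simp⟩
  | mul_right w _ v hv ih =>
    obtain ⟨i, hi, rfl⟩ := hv
    exact key w i hi ih
  | mul_inv_cancel w _ v hv ih =>
    obtain ⟨i, hi, rfl⟩ := hv
    rw [CoxeterSystem.inv_simple]
    exact key w i hi ih

/-- A piece consists of two chambers since Γ contains only the even elements of the reflection
group. -/
lemma mem_Piece_iff (x : HypSpace) : x ∈ Piece T ↔ x ∈ T.chamber ∨ conjH x ∈ T.chamber := by
  have hs := T.sin_r_pos
  have hc := T.cos_r_pos
  have hp := T.cos_p_pos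
  have ht := x.height_pos
  have hch : ∀ y : HypSpace, y ∈ T.chamber ↔ T.κ ≤ Complex.normSq y.horiz + y.height ^ 2 ∧
      y.horiz.re ≤ 1 / 2 ∧ y.horiz.im ≤ Real.tan (Real.pi / T.r) * y.horiz.re ∧
      0 ≤ y.horiz.im := by
    intro y
    have ht := y.height_pos
    simp only [chamber, Set.mem_ofPred_eq, Fin.forall_fin_succ, Fin.succ_zero_eq_one,
      Fin.succ_one_eq_two, root_zero, root_one]
    have e2 : T.root (Fin.succ 2) y = y.horiz.im / y.height := rfl
    have e1 : T.root 2 y = _ := T.root_two y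
    simp only [e1, e2, Real.tan_eq_sin_div_cos, le_div_iff₀ ht, zero_mul,
      mul_nonneg_iff_of_pos_right hp, div_mul_eq_mul_div, le_div_iff₀ hc, sub_nonneg,
      IsEmpty.forall_iff, and_true, mul_comm y.horiz.im]
  rw [hch, hch, conjH_horiz, conjH_height, Complex.normSq_conj, Complex.conj_re, Complex.conj_im]
  show (|x.horiz.im| ≤ Real.tan (Real.pi / T.r) * x.horiz.re ∧ x.horiz.re ≤ 1 / 2 ∧
    T.κ ≤ Complex.normSq x.horiz + x.height ^ 2) ↔ _
  rcases le_total 0 x.horiz.im with h | h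
  · rw [abs_of_nonneg h]
    constructor
    · rintro ⟨h1, h2, h3⟩; exact Or.inl ⟨h3, h2, h1, h⟩
    · rintro (⟨h1, h2, h3, _⟩ | ⟨h1, h2, h3, h4⟩)
      · exact ⟨h3, h2, h1⟩
      · exact ⟨by linarith, h2, h1⟩
  · rw [abs_of_nonpos h]
    constructor
    · rintro ⟨h1, h2, h3⟩; exact Or.inr ⟨h3, h2, h1, by linarith⟩
    · rintro (⟨h1, h2, h3, _⟩ | ⟨h1, h2, h3, h4⟩)
      · exact ⟨by linarith, h2, h1⟩
      · exact ⟨h3, h2, h1⟩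

/-- A rotation that fixes a point which lies on at most one wall of the chamber is trivial. -/
lemma eq_one_of_smul_eq {x : HypSpace} {k : Fin 4} (hk : 0 ≤ T.root k x)
    (hx : ∀ i ≠ k, 0 < T.root i x) {γ : PGL(2, ℂ)} (hγ : γ ∈ T.Γ) (h : γ • x = x) : γ = 1 := by
  have hxc : x ∈ T.chamber := fun i => by
    by_cases hi : i = k
    · rwa [hi]
    · exact (hx i hi).le
  have hw : T.toW ⟨γ, hγ⟩ • x = x := (T.toW_smul _ _).trans h
  have hmem := (T.stabilizer_chamber hxc (w := T.toW ⟨γ, hγ⟩) (by rwa [hw])).2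
  have hsub : T.cs.simple '' {i | T.root i x = 0} ⊆ {T.cs.simple k} := by
    rintro _ ⟨i, hi, rfl⟩
    by_cases hik : i = k
    · rw [hik]; rfl
    · exact absurd hi (hx i hik).ne'
  have hmem' := Subgroup.closure_mono hsub hmem
  rw [Subgroup.mem_closure_singleton] at hmem'
  obtain ⟨n, hn⟩ := hmem'
  have hpar := T.lengthParity_toW ⟨γ, hγ⟩
  -- The stabilizer in the Coxeter group is contained in {1, s_k}, and s_k is excluded by parity.
  have h1 : T.toW ⟨γ, hγ⟩ = 1 := by
    rcases Int.even_or_odd' n with ⟨m, rfl | rfl⟩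
    · rw [← hn, zpow_mul, zpow_ofNat, CoxeterSystem.simple_sq, one_zpow]
    · rw [zpow_add, zpow_mul, zpow_ofNat, CoxeterSystem.simple_sq, one_zpow, one_mul,
        zpow_one] at hn
      rw [← hn, CoxeterSystem.lengthParity_simple] at hpar
      exact absurd hpar (by decide)
  exact pgl_eq_one_of_smul fun y => by
    have := T.toW_smul ⟨γ, hγ⟩ y
    rw [h1, one_smul] at this
    exact this.symm

/-- Such a generic wall point has trivial rotation stabilizer (`eq_one_of_smul_eq`), so it detects
how the pieces on both sides of the wall are related. -/
lemma exists_wall_point {k : Fin 4} (hk : k ≠ 3) :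
    ∃ x, T.root k x = 0 ∧ ∀ i ≠ k, 0 < T.root i x := by
  have hs := T.sin_r_pos
  have hc := T.cos_r_pos
  have hp := T.cos_p_pos
  have hc1 := Real.cos_le_one (Real.pi / T.r)
  have hp1 := Real.cos_le_one (Real.pi / T.p)
  have hs1 := Real.sin_le_one (Real.pi / T.r)
  have hκ := T.κ_le_one
  have hκ' := T.κ_eq
  have hκ0 := T.κ_pos
  have hκ4 : 1 / 4 ≤ T.κ := by
    have : Real.cos (Real.pi / T.p) ^ 2 ≤ 1 := by nlinarith
    nlinarith [mul_le_mul_of_nonneg_right this hκ0.le]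
  have hlt : 0 < T.κ - ((1 / 4) ^ 2 + (Real.sin (Real.pi / T.r) / 8) ^ 2) := by nlinarith
  have h0 : ∀ y : HypSpace, y.height = 2 → 0 < T.root 0 y := by
    intro y hy
    have := Complex.normSq_nonneg y.horiz
    have : 0 < Complex.normSq y.horiz + y.height ^ 2 - T.κ := by rw [hy]; linarith
    rw [root_zero, hy]
    rw [hy] at this
    exact div_pos (mul_pos this hp) two_pos
  fin_cases k
  -- The height puts the point on the hemisphere |w|² + t² = κ; κ ≥ 1/4 leaves room for it.
  · refine ⟨⟨(⟨1 / 4, Real.sin (Real.pi / T.r) / 8⟩, Real.sqrt (T.κ - ((1 / 4) ^ 2 +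
      (Real.sin (Real.pi / T.r) / 8) ^ 2))), Real.sqrt_pos.2 hlt⟩, ?_, fun i hi => ?_⟩
    · show ((1 / 4 * (1 / 4) + Real.sin (Real.pi / T.r) / 8 * (Real.sin (Real.pi / T.r) / 8))
        + (Real.sqrt _) ^ 2 - T.κ) * _ / _ = 0
      rw [Real.sq_sqrt hlt.le]
      ring
    · have hq := Real.sqrt_pos.2 hlt
      fin_cases i
      · exact absurd rfl hi
      · refine div_pos ?_ hq
        show (0 : ℝ) < 1 / 2 - 1 / 4
        norm_num
      · refine div_pos ?_ hq
        show 0 < Real.sin (Real.pi / T.r) * (1 / 4) - Real.cos (Real.pi / T.r) *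
          (Real.sin (Real.pi / T.r) / 8)
        nlinarith
      · refine div_pos ?_ hq
        show 0 < Real.sin (Real.pi / T.r) / 8
        positivity
  · refine ⟨⟨(⟨1 / 2, Real.sin (Real.pi / T.r) / 4⟩, 2), two_pos⟩, ?_, fun i hi => ?_⟩
    · show ((1 : ℝ) / 2 - 1 / 2) / 2 = 0
      norm_num
    · fin_cases i
      · exact h0 _ rfl
      · exact absurd rfl hi
      · refine div_pos ?_ two_pos
        show 0 < Real.sin (Real.pi / T.r) * (1 / 2) - Real.cos (Real.pi / T.r) *
          (Real.sin (Real.pi / T.r) / 4)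
        nlinarith
      · refine div_pos ?_ two_pos
        show 0 < Real.sin (Real.pi / T.r) / 4
        positivity
  · refine ⟨⟨(⟨Real.cos (Real.pi / T.r) / 4, Real.sin (Real.pi / T.r) / 4⟩, 2), two_pos⟩, ?_,
      fun i hi => ?_⟩
    · show (Real.sin (Real.pi / T.r) * (Real.cos (Real.pi / T.r) / 4) -
        Real.cos (Real.pi / T.r) * (Real.sin (Real.pi / T.r) / 4)) / 2 = 0
      ring
    · fin_cases i
      · exact h0 _ rfl
      · refine div_pos ?_ two_pos
        show 0 < 1 / 2 - Real.cos (Real.pi / T.r) / 4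
        linarith
      · exact absurd rfl hi
      · refine div_pos ?_ two_pos
        show 0 < Real.sin (Real.pi / T.r) / 4
        positivity
  · exact absurd rfl hk

end TessType
end RegTess

-- The stabilizer of the cusp ∞ and the universal cover of a nanotube.

namespace RegTess

open HypSpace

lemma parabolic_horiz (w : ℂ) (x : HypSpace) : (parabolic w • x).horiz = x.horiz + w := by
  rw [parabolic, smul_horiz]; simp

lemma parabolic_height (w : ℂ) (x : HypSpace) : (parabolic w • x).height = x.height := by
  rw [parabolic, smul_height]; simp

lemma parabolic_add (v w : ℂ) : parabolic (v + w) = parabolic v * parabolic w :=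
  pgl_ext fun x => ext' (by rw [mul_smul]; simp only [parabolic_horiz]; ring)
    (by rw [mul_smul]; simp only [parabolic_height])

lemma parabolic_zero : parabolic 0 = 1 :=
  pgl_ext fun x => ext' (by simp [parabolic_horiz]) (by simp [parabolic_height])

lemma parabolic_neg (w : ℂ) : parabolic (-w) = (parabolic w)⁻¹ := by
  rw [eq_inv_iff_mul_eq_one, ← parabolic_add, neg_add_cancel, parabolic_zero]

lemma parabolic_injective : Function.Injective parabolic := by
  intro v w h
  let x : HypSpace := ⟨(0, 1), one_pos⟩
  have := congrArg (fun g : PGL(2, ℂ) => (g • x).horiz) h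
  simpa [parabolic_horiz] using this

namespace TessType

variable (T : TessType)

instance : NeZero T.r := ⟨by cases T <;> simp [r]⟩

instance : NeZero T.p := ⟨by cases T <;> simp [p]⟩

lemma gR_pow_horiz (n : ℕ) (x : HypSpace) : (T.gR ^ n • x).horiz = T.u ^ n * x.horiz := by
  induction n with
  | zero => simp
  | succ n ih => rw [pow_succ', mul_smul, gR_horiz, ih, pow_succ']; ring

lemma gR_pow_height (n : ℕ) (x : HypSpace) : (T.gR ^ n • x).height = x.height := by
  induction n with
  | zero => simp
  | succ n ih => rw [pow_succ', mul_smul, gR_height, ih]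

lemma gR_pow_mul_parabolic (n : ℕ) (w : ℂ) :
    T.gR ^ n * parabolic w = parabolic (T.u ^ n * w) * T.gR ^ n :=
  pgl_ext fun x => ext'
    (by rw [mul_smul, mul_smul]; simp only [parabolic_horiz, gR_pow_horiz]; ring)
    (by rw [mul_smul, mul_smul]; simp only [parabolic_height, gR_pow_height])

lemma u_pow_half : T.u ^ (T.r / 2) = -1 := by
  have h := T.u_sq
  cases T <;> simp only [r, Nat.reduceDiv, Nat.reduceSub, Nat.cast_one, one_mul, Nat.cast_zero,
    zero_mul, zero_sub] at h ⊢
  · linear_combination (u tetrahedral + 1) * h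
  · exact h
  · linear_combination (u cubical + 1) * h
  · linear_combination (u dodecahedral + 1) * h

lemma gF_eq_parabolic : T.gF = parabolic 1 * T.gR ^ (T.r / 2) :=
  pgl_ext fun x => ext'
    (by rw [mul_smul, gF_horiz, parabolic_horiz, gR_pow_horiz, u_pow_half]; ring)
    (by rw [mul_smul, gF_height, parabolic_height, gR_pow_height])

lemma isPrimitiveRoot_u : IsPrimitiveRoot T.u T.r :=
  Complex.isPrimitiveRoot_exp _ (NeZero.ne _)

lemma gR_pow_val_natCast (n : ℕ) : T.gR ^ (n : ZMod T.r).val = T.gR ^ n := by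
  rw [ZMod.val_natCast, ← pow_eq_pow_mod n T.gR_pow]

lemma gR_pow_val_add (k : ZMod T.r) (n : ℕ) : T.gR ^ (k + n).val = T.gR ^ k.val * T.gR ^ n := by
  conv_lhs => rw [← ZMod.natCast_zmod_val k]
  rw [← Nat.cast_add, gR_pow_val_natCast, pow_add]

lemma gR_pow_val_neg (j : ℕ) : T.gR ^ (-(j : ZMod T.r)).val = (T.gR ^ j)⁻¹ := by
  have h := T.gR_pow_val_add (-(j : ZMod T.r)) j
  rw [neg_add_cancel, ZMod.val_zero, pow_zero] at h
  exact eq_inv_of_mul_eq_one_left h.symm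

lemma mem_cuspRing_iff (a : ℂ) : a ∈ T.cuspRing ↔ ∃ m n : ℤ, a = m + n * T.u := by
  constructor
  · intro h
    induction h using Algebra.adjoin_induction with
    | mem x hx => exact ⟨0, 1, by simp_all⟩
    | algebraMap r => exact ⟨r, 0, by simp⟩
    | add x y _ _ hx hy =>
      obtain ⟨m, n, rfl⟩ := hx
      obtain ⟨m', n', rfl⟩ := hy
      exact ⟨m + m', n + n', by push_cast; ring⟩
    | mul x y _ _ hx hy =>
      obtain ⟨m, n, rfl⟩ := hx
      obtain ⟨m', n', rfl⟩ := hy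
      refine ⟨m * m' - n * n', m * n' + n * m' + n * n' * (T.r / 2 - 2 : ℕ), ?_⟩
      push_cast
      linear_combination (n * n' : ℂ) * T.u_sq
  · rintro ⟨m, n, rfl⟩
    exact add_mem (intCast_mem _ m) (mul_mem (intCast_mem _ n) T.uu.2)

/-- The stabilizer of `∞` in the rotation group. -/
noncomputable def cuspGroup : Subgroup PGL(2, ℂ) := Subgroup.closure (T.gens '' {0}ᶜ)

lemma cuspGroup_le : T.cuspGroup ≤ T.Γ := by
  rw [cuspGroup, Subgroup.closure_le]
  rintro _ ⟨i, _, rfl⟩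
  exact T.gens_mem i

lemma gR_mem_cuspGroup : T.gR ∈ T.cuspGroup := Subgroup.subset_closure ⟨2, by simp, rfl⟩

lemma gF_mem_cuspGroup : T.gF ∈ T.cuspGroup := Subgroup.subset_closure ⟨1, by simp, rfl⟩

lemma cuspGroup_height {γ : PGL(2, ℂ)} (h : γ ∈ T.cuspGroup) (x : HypSpace) :
    (γ • x).height = x.height := by
  induction h using Subgroup.closure_induction generalizing x with
  | mem _ h =>
    obtain ⟨i, hi, rfl⟩ := h
    fin_cases i
    · exact absurd rfl hi
    · exact T.gF_height x
    · exact T.gR_height x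
    · exact congrArg height (one_smul PGL(2, ℂ) x)
  | one => rw [one_smul]
  | mul a b _ _ ha hb => rw [mul_smul, ha, hb]
  | inv a _ ha => rw [← ha, smul_inv_smul]

lemma parabolic_mem_cuspGroup (a : T.cuspRing) : parabolic a ∈ T.cuspGroup := by
  have h1 : parabolic 1 ∈ T.cuspGroup := by
    have : parabolic 1 = T.gF * (T.gR ^ (T.r / 2))⁻¹ := by rw [gF_eq_parabolic]; group
    rw [this]
    exact mul_mem T.gF_mem_cuspGroup (inv_mem (pow_mem T.gR_mem_cuspGroup _))
  have hu : parabolic T.u ∈ T.cuspGroup := by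
    rw [← mul_inv_cancel_right (parabolic T.u) T.gR]
    have h2 : parabolic T.u * T.gR = T.gR * parabolic 1 := by
      have := T.gR_pow_mul_parabolic 1 1
      simpa using this.symm
    rw [h2]
    exact mul_mem (mul_mem T.gR_mem_cuspGroup h1) (inv_mem T.gR_mem_cuspGroup)
  have hz : ∀ (w : ℂ) (n : ℤ), parabolic w ∈ T.cuspGroup → parabolic (n * w) ∈ T.cuspGroup := by
    intro w n hw
    have hn : ∀ n : ℕ, parabolic (n * w) ∈ T.cuspGroup := by
      intro n
      induction n with
      | zero => simp [parabolic_zero]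
      | succ n ih => push_cast; rw [add_mul, one_mul, parabolic_add]; exact mul_mem ih hw
    obtain ⟨m, rfl | rfl⟩ := n.eq_nat_or_neg
    · simpa using hn m
    · have := inv_mem (hn m)
      rw [← parabolic_neg] at this
      simpa using this
  obtain ⟨m, n, h⟩ := (T.mem_cuspRing_iff a).1 a.2
  rw [h, parabolic_add, ← mul_one (m : ℂ)]
  exact mul_mem (hz _ _ h1) (hz _ _ hu)

/-- The translation by an element of `ℤ[u]` as an element of the rotation group. -/
noncomputable def parabolicΓ (a : T.cuspRing) : T.Γ :=
  ⟨parabolic a, T.cuspGroup_le (T.parabolic_mem_cuspGroup a)⟩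

lemma parabolicΓ_add (a b : T.cuspRing) :
    T.parabolicΓ (a + b) = T.parabolicΓ a * T.parabolicΓ b :=
  Subtype.ext (by simp [parabolicΓ, parabolic_add])

lemma parabolicΓ_zero : T.parabolicΓ 0 = 1 := Subtype.ext (by simp [parabolicΓ, parabolic_zero])

/-- The cusp stabilizer coordinates: translation part and power of the rotation. -/
noncomputable def cuspElt (x : T.cuspRing × ZMod T.r) : T.Γ :=
  T.parabolicΓ x.1 * T.genΓ 2 ^ x.2.val

lemma coe_cuspElt (x : T.cuspRing × ZMod T.r) :
    (T.cuspElt x : PGL(2, ℂ)) = parabolic x.1 * T.gR ^ x.2.val := rfl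

lemma cuspElt_horiz (x : T.cuspRing × ZMod T.r) (y : HypSpace) :
    ((T.cuspElt x : PGL(2, ℂ)) • y).horiz = T.u ^ x.2.val * y.horiz + x.1 := by
  rw [coe_cuspElt, mul_smul, parabolic_horiz, gR_pow_horiz]

lemma cuspElt_injective : Function.Injective T.cuspElt := by
  rintro ⟨a, k⟩ ⟨b, l⟩ h
  have h1 : ∀ y : HypSpace, T.u ^ k.val * y.horiz + a = T.u ^ l.val * y.horiz + b := fun y => by
    rw [← T.cuspElt_horiz (a, k), ← T.cuspElt_horiz (b, l), h]
  have h2 := h1 ⟨(0, 1), one_pos⟩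
  have h3 := h1 ⟨(1, 1), one_pos⟩
  simp only [horiz, mul_zero, zero_add, mul_one] at h2 h3
  rw [h2, add_left_inj] at h3
  have h4 := T.isPrimitiveRoot_u.pow_inj (ZMod.val_lt k) (ZMod.val_lt l) h3
  exact Prod.ext (Subtype.ext h2) (ZMod.val_injective _ h4)

/-- The next side of the same face, on the universal cover of a nanotube. -/
def coverRot (x : T.cuspRing × ZMod T.r) : T.cuspRing × ZMod T.r := (x.1, x.2 + 1)

/-- The adjacent face, on the universal cover of a nanotube. -/
noncomputable def coverFlip (x : T.cuspRing × ZMod T.r) : T.cuspRing × ZMod T.r :=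
  (x.1 + T.uu ^ x.2.val, x.2 + ((T.r / 2 : ℕ) : ZMod T.r))

lemma cuspElt_coverRot (x : T.cuspRing × ZMod T.r) :
    T.cuspElt (T.coverRot x) = T.cuspElt x * T.genΓ 2 := by
  apply Subtype.ext
  have := T.gR_pow_val_add x.2 1
  rw [Nat.cast_one, pow_one] at this
  show parabolic x.1 * T.gR ^ (x.2 + 1).val = parabolic x.1 * T.gR ^ x.2.val * T.gR
  rw [this, mul_assoc]

/-- F is p_1 R^(r/2), and moving R^k past p_1 turns it into p_w with w = u^k. This explains the
formula for `flip` in `nanotube`. -/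
lemma cuspElt_coverFlip (x : T.cuspRing × ZMod T.r) :
    T.cuspElt (T.coverFlip x) = T.cuspElt x * T.genΓ 1 := by
  apply Subtype.ext
  show parabolic ((x.1 + T.uu ^ x.2.val : T.cuspRing) : ℂ) *
    T.gR ^ (x.2 + ((T.r / 2 : ℕ) : ZMod T.r)).val = parabolic x.1 * T.gR ^ x.2.val * T.gF
  have h := T.gR_pow_mul_parabolic x.2.val 1
  rw [mul_one] at h
  rw [gR_pow_val_add, gF_eq_parabolic, mul_assoc (parabolic x.1), ← mul_assoc (T.gR ^ x.2.val), h,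
    mul_assoc (parabolic (T.u ^ _)),
    ← mul_assoc (parabolic _) (parabolic _), ← parabolic_add]
  rfl

lemma cuspElt_mul_parabolicΓ (x : T.cuspRing × ZMod T.r) (a : T.cuspRing) :
    T.cuspElt x * T.parabolicΓ a = T.cuspElt (x.1 + T.uu ^ x.2.val * a, x.2) := by
  apply Subtype.ext
  show parabolic x.1 * T.gR ^ x.2.val * parabolic a =
    parabolic ((x.1 + T.uu ^ x.2.val * a : T.cuspRing) : ℂ) * T.gR ^ x.2.val
  rw [mul_assoc, gR_pow_mul_parabolic, ← mul_assoc, ← parabolic_add]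
  rfl

end TessType
end RegTess

-- Relations between rotations, and flags as group elements.

namespace RegTess

namespace TessType

variable {T : TessType}

/-- A rotation system in the image of the rotation group. -/
lemma isRotationSystem_comp {G : Type*} [Group G] (π : T.Γ →* G) :
    T.IsRotationSystem (π ∘ T.genΓ) := T.isRotationSystem_genΓ.map π

section Relations

variable {G : Type*} [Group G] {a : Fin 4 → G}

lemma IsRotationSystem.pow_r (h : T.IsRotationSystem a) : a 2 ^ T.r = 1 := by
  have := h.2 2 3
  rwa [h.1, inv_one, mul_one] at this

lemma IsRotationSystem.one_mul_one (h : T.IsRotationSystem a) : a 1 * a 1 = 1 := by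
  have := h.2 1 3
  rw [h.1, inv_one, mul_one] at this
  rw [← pow_two]; exact this

lemma IsRotationSystem.zero_mul_zero (h : T.IsRotationSystem a) : a 0 * a 0 = 1 := by
  have := h.2 0 3
  rw [h.1, inv_one, mul_one] at this
  rw [← pow_two]; exact this

lemma IsRotationSystem.pow_r_sub_one (h : T.IsRotationSystem a) : a 2 ^ (T.r - 1) = (a 2)⁻¹ := by
  rw [eq_inv_iff_mul_eq_one, ← pow_succ, Nat.sub_add_cancel (NeZero.one_le), h.pow_r]

lemma IsRotationSystem.pow_q (h : T.IsRotationSystem a) : (a 1 * a 2 ^ (T.r - 1)) ^ T.q = 1 := by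
  rw [h.pow_r_sub_one]; exact h.2 1 2

/-- A gluing reverses the cyclic order of the sides of a face. -/
lemma IsRotationSystem.zero_mul_inv (h : T.IsRotationSystem a) : a 0 * (a 2)⁻¹ = a 2 * a 0 := by
  have h1 : (a 0 * (a 2)⁻¹) ^ 2 = 1 := h.2 0 2
  rw [pow_two, mul_eq_one_iff_eq_inv] at h1
  rw [h1, mul_inv_rev, inv_inv, inv_eq_of_mul_eq_one_left h.zero_mul_zero]

lemma IsRotationSystem.pow_p (h : T.IsRotationSystem a) : (a 1 * a 0) ^ T.p = 1 := by
  have h1 : (a 1 * (a 0)⁻¹) ^ T.p = 1 := h.2 1 0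
  rwa [inv_eq_of_mul_eq_one_left h.zero_mul_zero] at h1

end Relations

end TessType

namespace NanoComplex

open TessType

variable {T : TessType} {z : T.cuspRing}

/-! ### Flag maps -/

/-- A map from flags to a group which turns the moves between flags into right multiplication by
the generators of the rotation group. -/
structure IsFlagMap {G : Type*} [Group G] (π : T.Γ →* G) (X : NanoComplex) (φ : X.Flag → G) :
    Prop where
  rot : ∀ c, φ (X.rot c) = φ c * π (T.genΓ 2)
  flip : ∀ c, φ (X.flip c) = φ c * π (T.genΓ 1)
  glued : ∀ c d, X.Glued c d → φ d = φ c * π (T.genΓ 0)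

/-- The covering of a nanotube by a tessellated half-space. -/
def nanotubeProj (T : TessType) (z : T.cuspRing) (x : T.cuspRing × ZMod T.r) :
    (nanotube T z).Flag := (Ideal.Quotient.mk _ x.1, x.2)

lemma nanotubeProj_surjective : Function.Surjective (nanotubeProj T z) := by
  rintro ⟨a, k⟩
  obtain ⟨a, rfl⟩ := Ideal.Quotient.mk_surjective a
  exact ⟨(a, k), rfl⟩

lemma nanotubeProj_coverRot (x : T.cuspRing × ZMod T.r) :
    nanotubeProj T z (T.coverRot x) = (nanotube T z).rot (nanotubeProj T z x) := rfl

lemma nanotubeProj_coverFlip (x : T.cuspRing × ZMod T.r) :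
    nanotubeProj T z (T.coverFlip x) = (nanotube T z).flip (nanotubeProj T z x) := rfl

section FlagMap

variable {G : Type*} [Group G] {π : T.Γ →* G}

/-- Conjugation by R multiplies translations by u, so the translations in the kernel form an ideal.
-/
lemma map_parabolicΓ_eq_one (hπ : π (T.parabolicΓ z) = 1) {w : T.cuspRing}
    (hw : w ∈ Ideal.span {z}) : π (T.parabolicΓ w) = 1 := by
  have hu : ∀ a, π (T.parabolicΓ a) = 1 → π (T.parabolicΓ (T.uu * a)) = 1 := by
    intro a ha
    have h1 : T.genΓ 2 * T.parabolicΓ a = T.parabolicΓ (T.uu * a) * T.genΓ 2 := by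
      have := T.gR_pow_mul_parabolic 1 a
      rw [pow_one, pow_one] at this
      exact Subtype.ext this
    have h2 := congrArg π h1
    rw [map_mul, map_mul, ha, mul_one] at h2
    exact right_eq_mul.1 h2
  have hz : ∀ (n : ℤ) a, π (T.parabolicΓ a) = 1 → π (T.parabolicΓ (n * a)) = 1 := by
    intro n a ha
    have hn : ∀ n : ℕ, π (T.parabolicΓ (n * a)) = 1 := by
      intro n
      induction n with
      | zero => simp [parabolicΓ_zero]
      | succ n ih => rw [Nat.cast_succ, add_mul, one_mul, parabolicΓ_add, map_mul, ih, ha, one_mul]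
    obtain ⟨m, rfl | rfl⟩ := n.eq_nat_or_neg
    · simpa using hn m
    · have h1 := T.parabolicΓ_add (m * a) (-(m * a))
      rw [add_neg_cancel, parabolicΓ_zero] at h1
      have h2 := congrArg π h1
      rw [map_mul, hn, map_one, one_mul] at h2
      simpa using h2.symm
  obtain ⟨a, rfl⟩ := Ideal.mem_span_singleton'.1 hw
  obtain ⟨m, n, h⟩ := (T.mem_cuspRing_iff a).1 a.2
  have ha : a * z = (m : T.cuspRing) * z + n * (T.uu * z) := by
    apply Subtype.ext
    push_cast
    rw [h]
    show _ = _ + _ * (T.u * _)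
    ring
  rw [ha, parabolicΓ_add, map_mul, hz m z hπ, hz n _ (hu z hπ), one_mul]

/-- The flag map of a nanotube with a given value at the flag `(0, 0)`. -/
noncomputable def nanotubeMap (π : T.Γ →* G) (g : G) (c : (nanotube T z).Flag) : G :=
  g * π (T.cuspElt (Function.surjInv nanotubeProj_surjective c))

/-- Two lifts of a flag differ by a translation in the ideal ⟨z⟩, which π kills; so the choice of
the lift is immaterial. -/
lemma nanotubeMap_proj (hπ : π (T.parabolicΓ z) = 1) (g : G) (x : T.cuspRing × ZMod T.r) :
    nanotubeMap π g (nanotubeProj T z x) = g * π (T.cuspElt x) := by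
  have h := Function.surjInv_eq nanotubeProj_surjective (nanotubeProj T z x)
  rw [nanotubeMap]
  generalize Function.surjInv _ _ = y at h
  obtain ⟨b, k⟩ := x
  obtain ⟨a, l⟩ := y
  obtain ⟨h1, rfl⟩ := Prod.ext_iff.1 h
  have h2 : a - b ∈ Ideal.span {z} := Ideal.Quotient.eq.1 h1
  have h3 := map_parabolicΓ_eq_one hπ h2
  have h4 := T.parabolicΓ_add (a - b) b
  rw [sub_add_cancel] at h4
  simp only [nanotubeProj, cuspElt, map_mul]
  rw [h4, map_mul, h3, one_mul]

lemma nanotubeMap_isFlagMap (hπ : π (T.parabolicΓ z) = 1) (g : G) :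
    IsFlagMap π (nanotube T z) (nanotubeMap π g) where
  rot c := by
    obtain ⟨x, rfl⟩ := nanotubeProj_surjective c
    rw [← nanotubeProj_coverRot, nanotubeMap_proj hπ, nanotubeMap_proj hπ, cuspElt_coverRot,
      map_mul, mul_assoc]
  flip c := by
    obtain ⟨x, rfl⟩ := nanotubeProj_surjective c
    rw [← nanotubeProj_coverFlip, nanotubeMap_proj hπ, nanotubeMap_proj hπ, cuspElt_coverFlip,
      map_mul, mul_assoc]
  glued _ _ h := h.elim

lemma nanotubeMap_neg (hπ : π (T.parabolicΓ z) = 1) (g : G) (j : ℕ) :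
    nanotubeMap π g ((0, -(j : ZMod T.r)) : (nanotube T z).Flag) = g * (π (T.genΓ 2) ^ j)⁻¹ := by
  have : ((0, -(j : ZMod T.r)) : (nanotube T z).Flag) = nanotubeProj T z (0, -(j : ZMod T.r)) := rfl
  rw [this, nanotubeMap_proj hπ, cuspElt, parabolicΓ_zero, one_mul, ← map_pow, ← map_inv]
  congr 2
  exact Subtype.ext (T.gR_pow_val_neg j)

lemma IsFlagMap.rot_iterate {X : NanoComplex} {φ : X.Flag → G} (h : IsFlagMap π X φ) (n : ℕ)
    (c : X.Flag) : φ (X.rot^[n] c) = φ c * π (T.genΓ 2) ^ n := by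
  induction n with
  | zero => simp
  | succ n ih => rw [Function.iterate_succ_apply', h.rot, ih, pow_succ, mul_assoc]

/-- The extension of a flag map to the attached nanotubes. -/
noncomputable def attachMap (π : T.Γ →* G) {X : NanoComplex} (φ : X.Flag → G) :
    (X.attach T z).Flag → G :=
  Sum.elim φ fun x => nanotubeMap π (φ x.1.flag * π (T.genΓ 0)) x.2

/-- The value at flag (0, 0) of a new nanotube is forced by the gluing to the chosen flag; the other
sides of the face agree because E R⁻ʲ = Rʲ E. -/
lemma attachMap_isFlagMap (hπ : π (T.parabolicΓ z) = 1) {X : NanoComplex} {φ : X.Flag → G}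
    (h : IsFlagMap π X φ) : IsFlagMap π (X.attach T z) (attachMap π φ) where
  rot c := by
    rcases c with c | ⟨F, c⟩
    · exact h.rot c
    · exact (nanotubeMap_isFlagMap hπ _).rot c
  flip c := by
    rcases c with c | ⟨F, c⟩
    · exact h.flip c
    · exact (nanotubeMap_isFlagMap hπ _).flip c
  glued c d hg := by
    have hr := isRotationSystem_comp π
    have hE : π (T.genΓ 0) * π (T.genΓ 0) = 1 := hr.zero_mul_zero
    have key : ∀ (g : G) (j : ℕ), g * π (T.genΓ 0) * (π (T.genΓ 2) ^ j)⁻¹ =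
        g * π (T.genΓ 2) ^ j * π (T.genΓ 0) := by
      intro g j
      rw [mul_assoc, mul_assoc]
      congr 1
      have h1 : SemiconjBy (π (T.genΓ 0)) (π (T.genΓ 2))⁻¹ (π (T.genΓ 2)) := hr.zero_mul_inv
      rw [← inv_pow]
      exact (h1.pow_right j).eq
    cases hg with
    | old c d hcd => exact h.glued c d hcd
    | new F j =>
      show nanotubeMap π _ _ = φ _ * _
      rw [nanotubeMap_neg hπ, h.rot_iterate, key]
    | new' F j =>
      show φ _ = nanotubeMap π _ _ * _
      rw [nanotubeMap_neg hπ, h.rot_iterate, key, mul_assoc, hE, mul_one]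

/-- Each step around the edge multiplies by F E, and (F E)^p = 1. -/
lemma IsFlagMap.edge {X : NanoComplex} {φ : X.Flag → G} (h : IsFlagMap π X φ) (c : ℕ → X.Flag)
    (hc : ∀ i, i + 1 < T.p → φ (c (i + 1)) = φ (X.flip (c i)) * π (T.genΓ 0)) :
    φ (c 0) = φ (X.flip (c (T.p - 1))) * π (T.genΓ 0) := by
  have hr := isRotationSystem_comp π
  have h1 : ∀ i, i < T.p → φ (c i) = φ (c 0) * (π (T.genΓ 1) * π (T.genΓ 0)) ^ i := by
    intro i
    induction i with
    | zero => simp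
    | succ i ih =>
      intro hi
      rw [hc i hi, h.flip, ih (by omega), pow_succ]
      simp only [mul_assoc]
  have hp : 0 < T.p := NeZero.pos _
  have h2 : (π (T.genΓ 1) * π (T.genΓ 0)) ^ T.p = 1 := hr.pow_p
  rw [h.flip, h1 (T.p - 1) (by omega), mul_assoc, mul_assoc, ← pow_succ, Nat.sub_add_cancel hp, h2,
    mul_one]

/-- Each closing rule expresses a relation of Γ: involutivity of E for symmetry, E R⁻¹ = R E for
`rot`, (F E)^p = 1 for `edge`. Identifications are respected since both flags arise from one flag by
multiplication with E. -/
lemma IsFlagMap.closed {X : NanoComplex} {φ : X.Flag → G} (h : IsFlagMap π X φ) :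
    (∀ c d, Identified T X c d → φ c = φ d) ∧
    (∀ c d, ClosedGlued T X c d → φ d = φ c * π (T.genΓ 0)) := by
  have hr := isRotationSystem_comp π
  have hE : π (T.genΓ 0) * π (T.genΓ 0) = 1 := hr.zero_mul_zero
  have hER : π (T.genΓ 0) * (π (T.genΓ 2))⁻¹ = π (T.genΓ 2) * π (T.genΓ 0) := hr.zero_mul_inv
  have hR : π (T.genΓ 2) ^ (T.r - 1) = (π (T.genΓ 2))⁻¹ := hr.pow_r_sub_one
  -- The two predicates are mutually inductive, so both statements are proved together; each
  -- recursor yields one of them.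
  have k1 : ∀ {c d}, Identified T X c d → φ c = φ d := fun {c d} hcd =>
    Identified.rec (motive_1 := fun c d _ => φ c = φ d)
      (motive_2 := fun c d _ => φ d = φ c * π (T.genΓ 0))
      (fun _ => rfl) (fun _ _ _ => Eq.symm) (fun _ _ _ _ _ => Eq.trans)
      (fun c d _ ih => by rw [h.rot, h.rot, ih]) (fun c d _ ih => by rw [h.flip, h.flip, ih])
      (fun c d d' _ _ ih ih' => ih.trans ih'.symm)
      (fun c d hcd => h.glued c d hcd) (fun c d _ ih => by rw [ih, mul_assoc, hE, mul_one])
      (fun c c' d _ _ ih ih' => by rw [ih', ih])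
      (fun c d _ ih => by rw [h.rot_iterate, hR, h.rot, ih, mul_assoc, mul_assoc, hER])
      (fun c _ ih => h.edge c ih) hcd
  refine ⟨fun c d => k1, fun c d hcd => ?_⟩
  exact ClosedGlued.rec (motive_1 := fun c d _ => φ c = φ d)
      (motive_2 := fun c d _ => φ d = φ c * π (T.genΓ 0))
      (fun _ => rfl) (fun _ _ _ => Eq.symm) (fun _ _ _ _ _ => Eq.trans)
      (fun c d _ ih => by rw [h.rot, h.rot, ih]) (fun c d _ ih => by rw [h.flip, h.flip, ih])
      (fun c d d' _ _ ih ih' => ih.trans ih'.symm)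
      (fun c d hcd => h.glued c d hcd) (fun c d _ ih => by rw [ih, mul_assoc, hE, mul_one])
      (fun c c' d _ _ ih ih' => by rw [ih', ih])
      (fun c d _ ih => by rw [h.rot_iterate, hR, h.rot, ih, mul_assoc, mul_assoc, hER])
      (fun c _ ih => h.edge c ih) hcd

/-- The projection to the complex with closed edges. -/
def toClosed (T : TessType) {X : NanoComplex} (c : X.Flag) : (X.closeEdges T).Flag :=
  Quotient.mk (identifiedSetoid T X) c

lemma toClosed_surjective (X : NanoComplex) :
    Function.Surjective (toClosed T : X.Flag → (X.closeEdges T).Flag) := Quotient.mk_surjective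

lemma exists_closeEdges_isFlagMap {X : NanoComplex} {φ : X.Flag → G} (h : IsFlagMap π X φ) :
    ∃ ψ : (X.closeEdges T).Flag → G, IsFlagMap π (X.closeEdges T) ψ ∧
      ∀ c, ψ (toClosed T c) = φ c := by
  refine ⟨Quotient.lift φ h.closed.1, ⟨?_, ?_, ?_⟩, fun c => rfl⟩
  · intro c
    obtain ⟨c, rfl⟩ := toClosed_surjective X c
    exact h.rot c
  · intro c
    obtain ⟨c, rfl⟩ := toClosed_surjective X c
    exact h.flip c
  · intro c d
    obtain ⟨c, rfl⟩ := toClosed_surjective X c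
    obtain ⟨d, rfl⟩ := toClosed_surjective X d
    exact h.closed.2 c d

lemma exists_flagNext_isFlagMap (hπ : π (T.parabolicΓ z) = 1) {n : ℕ}
    {φ : (stage T z n).Flag → G} (h : IsFlagMap π _ φ) :
    ∃ ψ : (stage T z (n + 1)).Flag → G, IsFlagMap π _ ψ ∧ ∀ c, ψ (flagNext T z n c) = φ c := by
  obtain ⟨ψ, h1, h2⟩ := exists_closeEdges_isFlagMap (attachMap_isFlagMap (z := z) hπ h)
  exact ⟨ψ, h1, fun c => h2 (.inl c)⟩

end FlagMap

/-! ### Elementary properties of the stages -/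

/-- The flags of the initial nanotube in the `n`-th stage. -/
noncomputable def initialFlag (T : TessType) (z : T.cuspRing) :
    (n : ℕ) → (nanotube T z).Flag → (stage T z n).Flag
  | 0 => id
  | n + 1 => flagNext T z n ∘ initialFlag T z n

lemma exists_isFlagMap {G : Type*} [Group G] {π : T.Γ →* G} (hπ : π (T.parabolicΓ z) = 1)
    {φ : (nanotube T z).Flag → G} (h : IsFlagMap π _ φ) (n : ℕ) :
    ∃ ψ : (stage T z n).Flag → G, IsFlagMap π _ ψ ∧ ∀ c, ψ (initialFlag T z n c) = φ c := by
  induction n with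
  | zero => exact ⟨φ, h, fun _ => rfl⟩
  | succ n ih =>
    obtain ⟨ψ, h1, h2⟩ := ih
    obtain ⟨ψ', h3, h4⟩ := exists_flagNext_isFlagMap hπ h1
    exact ⟨ψ', h3, fun c => (h4 _).trans (h2 c)⟩

lemma flagNext_rot (n : ℕ) (c : (stage T z n).Flag) :
    flagNext T z n ((stage T z n).rot c) = (stage T z (n + 1)).rot (flagNext T z n c) := rfl

lemma flagNext_flip (n : ℕ) (c : (stage T z n).Flag) :
    flagNext T z n ((stage T z n).flip c) = (stage T z (n + 1)).flip (flagNext T z n c) := rfl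

lemma flagNext_glued {n : ℕ} {c d : (stage T z n).Flag} (h : (stage T z n).Glued c d) :
    (stage T z (n + 1)).Glued (flagNext T z n c) (flagNext T z n d) :=
  ClosedGlued.base (X := (stage T z n).attach T z) _ _ (AttachGlued.old c d h)

/-- Every flag lies on the image of a nanotube. -/
def IsNanotubeUnion (T : TessType) (z : T.cuspRing) (X : NanoComplex) : Prop :=
  ∀ c, ∃ ν : (nanotube T z).Flag → X.Flag, (∀ x, ν ((nanotube T z).rot x) = X.rot (ν x)) ∧
    (∀ x, ν ((nanotube T z).flip x) = X.flip (ν x)) ∧ c ∈ Set.range ν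

lemma isNanotubeUnion_stage (n : ℕ) : IsNanotubeUnion T z (stage T z n) := by
  induction n with
  | zero => exact fun c => ⟨id, fun _ => rfl, fun _ => rfl, c, rfl⟩
  | succ n ih =>
    intro c
    obtain ⟨c, rfl⟩ := toClosed_surjective _ c
    rcases c with c | ⟨F, c⟩
    · obtain ⟨ν, h1, h2, x, rfl⟩ := ih c
      exact ⟨flagNext T z n ∘ ν, fun x => congrArg (flagNext T z n) (h1 x),
        fun x => congrArg (flagNext T z n) (h2 x), x, rfl⟩
    · exact ⟨fun x => toClosed T (X := (stage T z n).attach T z) (.inr (F, x)),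
        fun _ => rfl, fun _ => rfl, c, rfl⟩

section NanotubeUnion

variable {X : NanoComplex} (hX : IsNanotubeUnion T z X)

include hX

/-- Reduces identities between `rot` and `flip` to the cover, where flags are faithfully represented
by elements of Γ through `cuspElt`. -/
lemma IsNanotubeUnion.exists_cover (c : X.Flag) : ∃ ν : T.cuspRing × ZMod T.r → X.Flag,
    Function.Semiconj ν T.coverRot X.rot ∧ Function.Semiconj ν T.coverFlip X.flip ∧
    (∀ x a, ν (x.1 + T.uu ^ x.2.val * (a * z), x.2) = ν x) ∧ c ∈ Set.range ν := by
  obtain ⟨ν, h1, h2, x, rfl⟩ := hX c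
  obtain ⟨y, rfl⟩ := nanotubeProj_surjective x
  refine ⟨ν ∘ nanotubeProj T z, fun x => h1 (nanotubeProj T z x), fun x => h2 (nanotubeProj T z x), fun x a => ?_, y, rfl⟩
  refine congrArg ν (Prod.ext (Ideal.Quotient.eq.2 ?_) rfl)
  rw [add_sub_cancel_left, ← mul_assoc]
  exact Ideal.mul_mem_left _ _ (Ideal.mem_span_singleton_self z)

lemma IsNanotubeUnion.rot_iterate (c : X.Flag) : X.rot^[T.r] c = c := by
  obtain ⟨ν, h1, h2, -, x, rfl⟩ := hX.exists_cover c
  rw [← (h1.iterate_right T.r) x]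
  congr 1
  apply T.cuspElt_injective
  have h : ∀ n x, T.cuspElt (T.coverRot^[n] x) = T.cuspElt x * T.genΓ 2 ^ n := by
    intro n x
    induction n with
    | zero => simp
    | succ n ih => rw [Function.iterate_succ_apply', cuspElt_coverRot, ih, pow_succ, mul_assoc]
  rw [h, T.isRotationSystem_genΓ.pow_r, mul_one]

lemma IsNanotubeUnion.flip_flip (c : X.Flag) : X.flip (X.flip c) = c := by
  obtain ⟨ν, h1, h2, -, x, rfl⟩ := hX.exists_cover c
  rw [← h2, ← h2]
  congr 1
  apply T.cuspElt_injective
  rw [cuspElt_coverFlip, cuspElt_coverFlip, mul_assoc, T.isRotationSystem_genΓ.one_mul_one, mul_one]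

lemma IsNanotubeUnion.rot_flip_iterate (c : X.Flag) :
    (X.rot^[T.r - 1] ∘ X.flip)^[T.q] c = c := by
  obtain ⟨ν, h1, h2, -, x, rfl⟩ := hX.exists_cover c
  rw [← (((h1.iterate_right (T.r - 1)).comp_right h2).iterate_right T.q) x]
  congr 1
  apply T.cuspElt_injective
  have h : ∀ n x, T.cuspElt (T.coverRot^[n] x) = T.cuspElt x * T.genΓ 2 ^ n := by
    intro n x
    induction n with
    | zero => simp
    | succ n ih => rw [Function.iterate_succ_apply', cuspElt_coverRot, ih, pow_succ, mul_assoc]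
  have h' : ∀ n x, T.cuspElt ((T.coverRot^[T.r - 1] ∘ T.coverFlip)^[n] x) =
      T.cuspElt x * (T.genΓ 1 * T.genΓ 2 ^ (T.r - 1)) ^ n := by
    intro n x
    induction n with
    | zero => simp
    | succ n ih =>
      rw [Function.iterate_succ_apply', Function.comp_apply, h, cuspElt_coverFlip, ih, pow_succ]
      simp only [mul_assoc]
  rw [h', T.isRotationSystem_genΓ.pow_q, mul_one]

lemma IsNanotubeUnion.exists_rot_iterate {c d : X.Flag}
    (h : Quot.mk _ c = (Quot.mk _ d : X.Face)) : ∃ j, d = X.rot^[j] c := by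
  rw [Quot.eq] at h
  induction h with
  | rel x y h => exact ⟨1, h⟩
  | refl x => exact ⟨0, rfl⟩
  | symm x y _ ih =>
    obtain ⟨j, hj⟩ := ih
    -- The inverse of rot^j, as rot has order dividing r.
    refine ⟨j * (T.r - 1), ?_⟩
    rw [hj, ← Function.iterate_add_apply]
    have : j * (T.r - 1) + j = T.r * j := by
      obtain ⟨m, hm⟩ : ∃ m, T.r = m + 1 := ⟨T.r - 1, (Nat.sub_add_cancel NeZero.one_le).symm⟩
      rw [hm, Nat.add_sub_cancel]; ring
    rw [this, Function.iterate_mul]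
    have hid : X.rot^[T.r] = id := funext hX.rot_iterate
    rw [hid, Function.iterate_id, id]
  | trans x y w _ _ ih ih' =>
    obtain ⟨j, rfl⟩ := ih
    obtain ⟨k, rfl⟩ := ih'
    exact ⟨k + j, (Function.iterate_add_apply _ _ _ _).symm⟩

end NanotubeUnion

section CloseEdges

variable {X : NanoComplex}

lemma closeEdges_glued_symm {c d : (X.closeEdges T).Flag} (h : (X.closeEdges T).Glued c d) :
    (X.closeEdges T).Glued d c := by
  obtain ⟨c, rfl⟩ := toClosed_surjective X c
  obtain ⟨d, rfl⟩ := toClosed_surjective X d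
  exact ClosedGlued.symm c d h

lemma closeEdges_glued_unique {c d d' : (X.closeEdges T).Flag} (h : (X.closeEdges T).Glued c d)
    (h' : (X.closeEdges T).Glued c d') : d = d' := by
  obtain ⟨c, rfl⟩ := toClosed_surjective X c
  obtain ⟨d, rfl⟩ := toClosed_surjective X d
  obtain ⟨d', rfl⟩ := toClosed_surjective X d'
  exact Quotient.sound (Identified.glued c d d' h h')

lemma closeEdges_rot_iterate (n : ℕ) (c : X.Flag) :
    (X.closeEdges T).rot^[n] (toClosed T c) = toClosed T (X.rot^[n] c) := by
  induction n with
  | zero => rfl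
  | succ n ih => rw [Function.iterate_succ_apply', ih, Function.iterate_succ_apply']; rfl

lemma closeEdges_glued_rot {c d : (X.closeEdges T).Flag} (h : (X.closeEdges T).Glued c d) :
    (X.closeEdges T).Glued ((X.closeEdges T).rot c) ((X.closeEdges T).rot^[T.r - 1] d) := by
  obtain ⟨c, rfl⟩ := toClosed_surjective X c
  obtain ⟨d, rfl⟩ := toClosed_surjective X d
  rw [closeEdges_rot_iterate]
  exact ClosedGlued.rot c d h

lemma closeEdges_glued_edge (c : ℕ → (X.closeEdges T).Flag)
    (h : ∀ i, i + 1 < T.p → (X.closeEdges T).Glued ((X.closeEdges T).flip (c i)) (c (i + 1))) :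
    (X.closeEdges T).Glued ((X.closeEdges T).flip (c (T.p - 1))) (c 0) := by
  choose b hb using fun i => toClosed_surjective X (c i)
  obtain rfl : (fun i => toClosed T (b i)) = c := funext hb
  exact ClosedGlued.edge b h

end CloseEdges

/-- In the next stage, all old faces are glued. -/
lemma exists_glued_flagNext (n : ℕ) (c : (stage T z n).Flag) :
    ∃ d, (stage T z (n + 1)).Glued (flagNext T z n c) d := by
  by_cases hc : (stage T z n).IsOpenFlag c
  · obtain ⟨F, hF⟩ : ∃ F : (stage T z n).OpenFace,
        Quot.mk _ F.flag = (Quot.mk _ c : (stage T z n).Face) :=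
      ⟨⟨Quot.mk _ c, c, rfl, hc⟩, OpenFace.flag.eq_1 _ ▸
        (⟨Quot.mk _ c, c, rfl, hc⟩ : (stage T z n).OpenFace).2.choose_spec.1⟩
    obtain ⟨j, hj⟩ := (isNanotubeUnion_stage (z := z) n).exists_rot_iterate hF
    subst hj
    exact ⟨toClosed T _,
      ClosedGlued.base (T := T) (X := (stage T z n).attach T z) _ _ (AttachGlued.new F j)⟩
  · simp only [IsOpenFlag, not_forall, not_not] at hc
    obtain ⟨d, hd⟩ := hc
    exact ⟨_, flagNext_glued hd⟩

/-- A nanotube is connected: after suitable rotations flips translate by any power of u. These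
include -1 and -u because u^(r/2) = -1, so they generate ℤ[u]. -/
lemma nanotube_induction {S : (nanotube T z).Flag → Prop} (h0 : S (0, 0))
    (hrot : ∀ c, S c → S ((nanotube T z).rot c)) (hflip : ∀ c, S c → S ((nanotube T z).flip c))
    (c : (nanotube T z).Flag) : S c := by
  have hr : ∀ a k, S (a, k) → ∀ l, S (a, l) := by
    intro a k h l
    have h1 : ∀ n : ℕ, S (a, k + n) := by
      intro n
      induction n with
      | zero => simpa using h
      | succ n ih => rw [Nat.cast_succ, ← add_assoc]; exact hrot _ ih
    have h2 := h1 (l - k).val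
    rwa [ZMod.natCast_zmod_val, add_sub_cancel] at h2
  let A : T.cuspRing → Prop := fun a => S (Ideal.Quotient.mk _ a, 0)
  have hA : ∀ a (n : ℕ), A a → A (a + T.uu ^ n) := by
    intro a n h
    have h1 := hflip _ (hr _ _ h n)
    have h2 : T.uu ^ (n : ZMod T.r).val = T.uu ^ n := by
      have : T.uu ^ T.r = 1 := Subtype.ext T.u_pow_r
      rw [ZMod.val_natCast, ← pow_eq_pow_mod n this]
    have h3 : (nanotube T z).flip (Ideal.Quotient.mk (Ideal.span {z}) a, (n : ZMod T.r)) =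
        (Ideal.Quotient.mk _ (a + T.uu ^ n), (n : ZMod T.r) + ((T.r / 2 : ℕ) : ZMod T.r)) := by
      rw [← h2]; rfl
    rw [h3] at h1
    exact hr _ _ h1 0
  have hhalf : T.uu ^ (T.r / 2) = -1 := Subtype.ext T.u_pow_half
  have hz : ∀ (w : ℕ) (m : ℤ) a, A a → A (a + m * T.uu ^ w) := by
    intro w m a ha
    obtain ⟨k, rfl | rfl⟩ := m.eq_nat_or_neg
    · induction k with
      | zero => simpa using ha
      | succ k ih =>
        have := hA _ w ih
        push_cast at this ⊢
        rwa [add_mul, one_mul, ← add_assoc]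
    · induction k with
      | zero => simpa using ha
      | succ k ih =>
        have := hA _ (w + T.r / 2) ih
        rw [pow_add, hhalf] at this
        convert this using 1
        push_cast
        ring
  obtain ⟨a, k⟩ := c
  obtain ⟨a, rfl⟩ := Ideal.Quotient.mk_surjective a
  obtain ⟨m, n, h⟩ := (T.mem_cuspRing_iff a).1 a.2
  have ha : a = 0 + (m : T.cuspRing) * T.uu ^ 0 + n * T.uu ^ 1 := by
    apply Subtype.ext
    push_cast
    rw [h]
    show _ = 0 + _ * T.u ^ 0 + _ * T.u ^ 1
    ring
  have h1 : A a := by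
    rw [ha]
    exact hz 1 n _ (hz 0 m 0 h0)
  exact hr _ _ h1 k

/-- The base flag of the `n`-th stage. -/
noncomputable def baseFlag (T : TessType) (z : T.cuspRing) (n : ℕ) : (stage T z n).Flag :=
  initialFlag T z n ((0, 0) : (nanotube T z).Flag)

/-- The stages are connected. -/
lemma stage_induction {n : ℕ} {S : (stage T z n).Flag → Prop} (h0 : S (baseFlag T z n))
    (hrot : ∀ c, S c → S ((stage T z n).rot c)) (hflip : ∀ c, S c → S ((stage T z n).flip c))
    (hglued : ∀ c d, (stage T z n).Glued c d → S c → S d) (c : (stage T z n).Flag) : S c := by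
  induction n with
  | zero => exact nanotube_induction h0 hrot hflip c
  | succ n ih =>
    have hold : ∀ c, S (flagNext T z n c) := ih (S := fun c => S (flagNext T z n c)) h0
      (fun c h => hrot _ h) (fun c h => hflip _ h) (fun c d hcd h => hglued _ _ (flagNext_glued hcd) h)
    obtain ⟨c, rfl⟩ := toClosed_surjective _ c
    rcases c with c | ⟨F, c⟩
    · exact hold c
    · refine nanotube_induction (S := fun c => S (toClosed T (X := (stage T z n).attach T z)
        (.inr (F, c)))) ?_ (fun c h => hrot _ h) (fun c h => hflip _ h) c
      have h1 : AttachGlued T z (stage T z n) (.inl F.flag) (.inr (F, (0, 0))) := by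
        simpa using AttachGlued.new (T := T) (z := z) F 0
      exact hglued (flagNext T z n F.flag) _
        (ClosedGlued.base (T := T) (X := (stage T z n).attach T z) _ _ h1) (hold _)

end NanoComplex
end RegTess

namespace RegTess

namespace NanoComplex

open TessType

/-! ### The limit of the stages -/

variable {T : TessType} {z : T.cuspRing}

/-- A complex of nanotubes without open faces, with `p` nanotubes around each edge. -/
structure IsComplete (T : TessType) (z : T.cuspRing) (X : NanoComplex) : Prop where
  nanotube : IsNanotubeUnion T z X
  symm : ∀ c d, X.Glued c d → X.Glued d c
  unique : ∀ c d d', X.Glued c d → X.Glued c d' → d = d'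
  exists_glued : ∀ c, ∃ d, X.Glued c d
  rot : ∀ c d, X.Glued c d → X.Glued (X.rot c) (X.rot^[T.r - 1] d)
  edge : ∀ c : ℕ → X.Flag, (∀ i, i + 1 < T.p → X.Glued (X.flip (c i)) (c (i + 1))) →
    X.Glued (X.flip (c (T.p - 1))) (c 0)

section Complete

variable {X : NanoComplex}

/-- The rotation group acts from the right on the flags of a complete complex, and the
translation by `z` acts trivially. -/
lemma IsComplete.exists_action (h : IsComplete T z X) :
    ∃ η : T.Γ →* (Equiv.Perm X.Flag)ᵐᵒᵖ, (∀ c, (η (T.genΓ 2)).unop c = X.rot c) ∧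
      (∀ c, (η (T.genΓ 1)).unop c = X.flip c) ∧
      (∀ c d, X.Glued c d → (η (T.genΓ 0)).unop c = d) ∧ η (T.parabolicΓ z) = 1 := by
  have hX := h.nanotube
  have hr1 : 1 ≤ T.r := NeZero.one_le
  let R : Equiv.Perm X.Flag :=
    { toFun := X.rot
      invFun := X.rot^[T.r - 1]
      left_inv := fun c => by
        rw [← Function.iterate_succ_apply, Nat.succ_eq_add_one, Nat.sub_add_cancel hr1,
          hX.rot_iterate]
      right_inv := fun c => by
        rw [← Function.iterate_succ_apply' X.rot, Nat.succ_eq_add_one, Nat.sub_add_cancel hr1,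
          hX.rot_iterate] }
  let F : Equiv.Perm X.Flag := Function.Involutive.toPerm X.flip hX.flip_flip
  choose glue hglue using h.exists_glued
  have hglue' : ∀ c d, X.Glued c d → glue c = d := fun c d hcd => h.unique _ _ _ (hglue c) hcd
  let E : Equiv.Perm X.Flag := Function.Involutive.toPerm glue
    fun c => hglue' _ _ (h.symm _ _ (hglue c))
  -- The opposite group, since moves correspond to multiplication from the right.
  let a : Fin 4 → (Equiv.Perm X.Flag)ᵐᵒᵖ := ![.op E, .op F, .op R, 1]
  have hpow : ∀ (f : Equiv.Perm X.Flag) (n : ℕ) (c : X.Flag), (f ^ n) c = f^[n] c := fun f n c => by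
    rw [Equiv.Perm.iterate_eq_pow]
  have ha : T.IsRotationSystem a := by
    apply isRotationSystem_of_lt
    · rfl
    · apply MulOpposite.unop_injective
      ext c : 1
      show (R ^ T.r) c = c
      rw [hpow]; exact hX.rot_iterate c
    · apply MulOpposite.unop_injective
      ext c : 1
      exact hX.flip_flip c
    · apply MulOpposite.unop_injective
      ext c : 1
      exact hglue' _ _ (h.symm _ _ (hglue c))
    · apply MulOpposite.unop_injective
      ext c : 1
      show ((R⁻¹ * F) ^ T.q) c = c
      rw [hpow]; exact hX.rot_flip_iterate c
    · apply MulOpposite.unop_injective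
      ext c : 1
      show ((F * E) ^ T.p) c = c
      have hp : 0 < T.p := NeZero.pos _
      have h1 : (E * F) ^ T.p = 1 := by
        ext c : 1
        -- Flipping and then crossing the face runs through the successive nanotubes around an edge;
        -- the `edge` rule says that this closes up after p steps.
        have h1 := h.edge (fun i => ((E * F) ^ i) c) fun i _ => by
          rw [pow_succ']; exact hglue _
        have h2 := hglue' _ _ h1
        rw [← Nat.sub_add_cancel hp, pow_succ']
        exact h2
      have h2 : F * E = F * (E * F) * F⁻¹ := by group
      rw [h2, conj_pow, h1, mul_one, mul_inv_cancel]
      rfl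
    · apply MulOpposite.unop_injective
      ext c : 1
      show ((R⁻¹ * E) ^ 2) c = c
      rw [pow_two]
      show R⁻¹ (E (R⁻¹ (E c))) = c
      have h1 := h.rot _ _ (hglue c)
      have h2 : E (R⁻¹ (E c)) = R c := hglue' _ _ (h.symm _ _ h1)
      rw [h2]
      exact R.symm_apply_apply c
  obtain ⟨η, hη⟩ := T.exists_hom_of_isRotationSystem ha
  refine ⟨η, fun c => ?_, fun c => ?_, fun c d hcd => ?_, ?_⟩
  · rw [hη]; rfl
  · rw [hη]; rfl
  · rw [hη]; exact hglue' c d hcd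
  · apply MulOpposite.unop_injective
    ext c : 1
    obtain ⟨ν, h1, h2, h3, x, rfl⟩ := hX.exists_cover c
    have step : ∀ i ∈ ({0}ᶜ : Set (Fin 4)), ∃ f : T.cuspRing × ZMod T.r → T.cuspRing × ZMod T.r,
        Function.Surjective f ∧ (∀ y, T.cuspElt (f y) = T.cuspElt y * T.genΓ i) ∧
        ∀ y, (η (T.genΓ i)).unop (ν y) = ν (f y) := by
      intro i hi
      fin_cases i
      · exact absurd rfl hi
      · refine ⟨T.coverFlip, fun y => ⟨T.coverFlip y, T.cuspElt_injective ?_⟩, T.cuspElt_coverFlip,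
          fun y => ?_⟩
        · rw [cuspElt_coverFlip, cuspElt_coverFlip, mul_assoc,
            T.isRotationSystem_genΓ.one_mul_one, mul_one]
        · show (η (T.genΓ 1)).unop (ν y) = _
          rw [hη, h2]; rfl
      · refine ⟨T.coverRot, fun y => ⟨(y.1, y.2 - 1), Prod.ext rfl (sub_add_cancel _ _)⟩,
          T.cuspElt_coverRot, fun y => ?_⟩
        show (η (T.genΓ 2)).unop (ν y) = _
        rw [hη, h1]; rfl
      · have h3 : T.genΓ 3 = 1 := rfl
        refine ⟨id, Function.surjective_id, fun y => ?_, fun y => ?_⟩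
        · show T.cuspElt y = T.cuspElt y * T.genΓ 3
          rw [h3, mul_one]
        · show (η (T.genΓ 3)).unop (ν y) = _
          rw [h3, map_one]; rfl
    -- The cusp group moves flags of one nanotube just as right multiplication does on its cover.
    -- For the translation by z the end point on the cover lies over the initial flag.
    have key : ∀ g ∈ T.cuspGroup, ∀ hg : g ∈ T.Γ, ∀ y : T.cuspRing × ZMod T.r,
        ∃ y', T.cuspElt y' = T.cuspElt y * ⟨g, hg⟩ ∧ (η ⟨g, hg⟩).unop (ν y) = ν y' := by
      intro g hg
      induction hg using Subgroup.closure_induction_right with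
      | one => exact fun hg y => ⟨y, (mul_one _).symm, by
          rw [show (⟨1, hg⟩ : T.Γ) = 1 from rfl, map_one]; rfl⟩
      | mul_right g hgc s hs ih =>
        intro hg y
        obtain ⟨i, hi, rfl⟩ := hs
        obtain ⟨f, -, hf, hf'⟩ := step i hi
        obtain ⟨y', hy, hy'⟩ := ih (T.cuspGroup_le hgc) y
        have e : (⟨g * T.gens i, hg⟩ : T.Γ) = ⟨g, T.cuspGroup_le hgc⟩ * T.genΓ i := rfl
        refine ⟨f y', by rw [hf, hy, e, mul_assoc], ?_⟩
        rw [e, map_mul, MulOpposite.unop_mul, Equiv.Perm.mul_apply, hy', hf']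
      | mul_inv_cancel g hgc s hs ih =>
        intro hg y
        obtain ⟨i, hi, rfl⟩ := hs
        obtain ⟨f, hsurj, hf, hf'⟩ := step i hi
        obtain ⟨y', hy, hy'⟩ := ih (T.cuspGroup_le hgc) y
        obtain ⟨y', rfl⟩ := hsurj y'
        have e : (⟨g * (T.gens i)⁻¹, hg⟩ : T.Γ) = ⟨g, T.cuspGroup_le hgc⟩ * (T.genΓ i)⁻¹ := rfl
        refine ⟨y', by rw [e, ← mul_assoc, ← hy, hf, mul_inv_cancel_right], ?_⟩
        rw [e, map_mul, MulOpposite.unop_mul, Equiv.Perm.mul_apply, hy', map_inv,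
          MulOpposite.unop_inv, Equiv.Perm.inv_eq_iff_eq, hf']
    obtain ⟨y, hy, hy'⟩ := key _ (T.parabolic_mem_cuspGroup z) (T.parabolicΓ z).2 x
    have h4 := T.cuspElt_mul_parabolicΓ x z
    have h5 : y = (x.1 + T.uu ^ x.2.val * z, x.2) := T.cuspElt_injective (hy.trans h4)
    have h6 := h3 x 1
    rw [one_mul, ← h5] at h6
    exact hy'.trans h6

end Complete

/-- Sequences of flags that are eventually compatible with the maps between the stages. -/
def LimitSeq (T : TessType) (z : T.cuspRing) : Type :=
  {s : ∀ n, (stage T z n).Flag // ∃ N, ∀ n ≥ N, s (n + 1) = flagNext T z n (s n)}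

/-- The next side of a face. -/
noncomputable def LimitSeq.rot (s : LimitSeq T z) : LimitSeq T z :=
  ⟨fun n => (stage T z n).rot (s.1 n), s.2.imp fun _ h n hn =>
    congrArg (stage T z (n + 1)).rot (h n hn)⟩

/-- The other face with the same side. -/
noncomputable def LimitSeq.flip (s : LimitSeq T z) : LimitSeq T z :=
  ⟨fun n => (stage T z n).flip (s.1 n), s.2.imp fun _ h n hn =>
    congrArg (stage T z (n + 1)).flip (h n hn)⟩

/-- Two sequences are identified if they eventually agree. -/
def limitSetoid (T : TessType) (z : T.cuspRing) : Setoid (LimitSeq T z) where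
  r s t := ∃ N, ∀ n ≥ N, s.1 n = t.1 n
  iseqv := ⟨fun _ => ⟨0, fun _ _ => rfl⟩, fun ⟨N, h⟩ => ⟨N, fun n hn => (h n hn).symm⟩,
    fun ⟨N, h⟩ ⟨N', h'⟩ => ⟨max N N', fun n hn => (h n (le_of_max_le_left hn)).trans
      (h' n (le_of_max_le_right hn))⟩⟩

/-- The direct limit of the stages. -/
noncomputable def limit (T : TessType) (z : T.cuspRing) : NanoComplex where
  Flag := Quotient (limitSetoid T z)
  rot := Quotient.map LimitSeq.rot fun _ _ ⟨N, h⟩ => ⟨N, fun n hn => congrArg (stage T z n).rot (h n hn)⟩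
  flip := Quotient.map LimitSeq.flip fun _ _ ⟨N, h⟩ =>
    ⟨N, fun n hn => congrArg (stage T z n).flip (h n hn)⟩
  Glued := Quotient.lift₂ (fun s t => ∃ N, ∀ n ≥ N, (stage T z n).Glued (s.1 n) (t.1 n))
    fun s t s' t' ⟨N, h⟩ ⟨N', h'⟩ => propext
      ⟨fun ⟨M, g⟩ => ⟨max M (max N N'), fun n hn => by
        have := g n (by omega)
        rwa [h n (by omega), h' n (by omega)] at this⟩,
      fun ⟨M, g⟩ => ⟨max M (max N N'), fun n hn => by
        have := g n (by omega)
        rwa [← h n (by omega), ← h' n (by omega)] at this⟩⟩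

/-- The flag of the limit represented by a sequence. -/
def limitMk (s : LimitSeq T z) : (limit T z).Flag := Quotient.mk (limitSetoid T z) s

lemma limitMk_surjective : Function.Surjective (limitMk : LimitSeq T z → _) :=
  Quotient.mk_surjective

lemma limitMk_eq_iff (s t : LimitSeq T z) :
    limitMk s = limitMk t ↔ ∃ N, ∀ n ≥ N, s.1 n = t.1 n :=
  ⟨fun h => Quotient.exact h, fun h => Quotient.sound h⟩

lemma limit_glued_iff (s t : LimitSeq T z) : (limit T z).Glued (limitMk s) (limitMk t) ↔
    ∃ N, ∀ n ≥ N, (stage T z n).Glued (s.1 n) (t.1 n) := Iff.rfl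

/-- The sequence that starts with a given flag. -/
noncomputable def pushSeq (n : ℕ) (c : (stage T z n).Flag) : LimitSeq T z :=
  ⟨fun k => if h : n ≤ k then Nat.leRec (motive := fun k _ => (stage T z k).Flag) c
    (fun k _ x => flagNext T z k x) h else baseFlag T z k, n, fun k hk => by
      simp only [dif_pos (show n ≤ k + 1 by omega), dif_pos (show n ≤ k from hk)]
      exact Nat.leRec_succ _ _ _⟩

lemma pushSeq_self (n : ℕ) (c : (stage T z n).Flag) : (pushSeq n c).1 n = c := by
  simp [pushSeq]

lemma pushSeq_succ {n k : ℕ} (h : n ≤ k) (c : (stage T z n).Flag) :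
    (pushSeq n c).1 (k + 1) = flagNext T z k ((pushSeq n c).1 k) := by
  simp only [pushSeq, dif_pos (show n ≤ k + 1 by omega), dif_pos h]
  exact Nat.leRec_succ _ _ _

lemma pushSeq_eq {n : ℕ} (c : (stage T z n).Flag) (s : ∀ k, (stage T z k).Flag) (hs : s n = c)
    (h : ∀ k ≥ n, s (k + 1) = flagNext T z k (s k)) {k : ℕ} (hk : n ≤ k) :
    (pushSeq n c).1 k = s k := by
  induction k, hk using Nat.le_induction with
  | base => rw [pushSeq_self, hs]
  | succ k hk ih => rw [pushSeq_succ hk, h k hk, ih]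

/-- The map from a stage to the limit. -/
noncomputable def push (n : ℕ) (c : (stage T z n).Flag) : (limit T z).Flag := limitMk (pushSeq n c)

lemma push_eq_limitMk {n : ℕ} (s : LimitSeq T z)
    (h : ∀ k ≥ n, s.1 (k + 1) = flagNext T z k (s.1 k)) : push n (s.1 n) = limitMk s :=
  (limitMk_eq_iff _ _).2 ⟨n, fun _ hk => pushSeq_eq _ s.1 rfl h hk⟩

lemma exists_push_eq (x : (limit T z).Flag) : ∃ n c, x = push n c := by
  obtain ⟨s, rfl⟩ := limitMk_surjective x
  obtain ⟨N, h⟩ := s.2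
  exact ⟨N, s.1 N, (push_eq_limitMk s h).symm⟩

lemma push_rot (n : ℕ) (c : (stage T z n).Flag) :
    push n ((stage T z n).rot c) = (limit T z).rot (push n c) :=
  (limitMk_eq_iff _ _).2 ⟨n, fun _ hk => pushSeq_eq _
    (fun k => (stage T z k).rot ((pushSeq n c).1 k)) (by rw [pushSeq_self])
    (fun k hk => by rw [pushSeq_succ hk, flagNext_rot]) hk⟩

lemma push_flip (n : ℕ) (c : (stage T z n).Flag) :
    push n ((stage T z n).flip c) = (limit T z).flip (push n c) :=
  (limitMk_eq_iff _ _).2 ⟨n, fun _ hk => pushSeq_eq _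
    (fun k => (stage T z k).flip ((pushSeq n c).1 k)) (by rw [pushSeq_self])
    (fun k hk => by rw [pushSeq_succ hk, flagNext_flip]) hk⟩

lemma push_glued {n : ℕ} {c d : (stage T z n).Flag} (h : (stage T z n).Glued c d) :
    (limit T z).Glued (push n c) (push n d) := by
  refine (limit_glued_iff _ _).2 ⟨n, fun k hk => ?_⟩
  induction k, hk using Nat.le_induction with
  | base => rwa [pushSeq_self, pushSeq_self]
  | succ k hk ih => rw [pushSeq_succ hk, pushSeq_succ hk]; exact flagNext_glued ih

lemma push_baseFlag (n : ℕ) : push n (baseFlag T z n) = push 0 (baseFlag T z 0) :=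
  (limitMk_eq_iff _ _).2 ⟨n, fun k hk => by
    rw [pushSeq_eq _ (baseFlag T z) rfl (fun _ _ => rfl) hk,
      pushSeq_eq _ (baseFlag T z) rfl (fun _ _ => rfl) (Nat.zero_le k)]⟩

lemma isNanotubeUnion_limit : IsNanotubeUnion T z (limit T z) := by
  intro x
  obtain ⟨n, c, rfl⟩ := exists_push_eq x
  obtain ⟨ν, h1, h2, y, rfl⟩ := isNanotubeUnion_stage n c
  exact ⟨push n ∘ ν, fun y => (congrArg (push n) (h1 y)).trans (push_rot n _),
    fun y => (congrArg (push n) (h2 y)).trans (push_flip n _), y, rfl⟩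

lemma limit_rot_iterate (m : ℕ) (s : LimitSeq T z) : ∃ t : LimitSeq T z,
    (limit T z).rot^[m] (limitMk s) = limitMk t ∧ ∀ n, t.1 n = (stage T z n).rot^[m] (s.1 n) := by
  induction m with
  | zero => exact ⟨s, rfl, fun _ => rfl⟩
  | succ m ih =>
    obtain ⟨t, h1, h2⟩ := ih
    refine ⟨t.rot, ?_, fun n => ?_⟩
    · rw [Function.iterate_succ_apply', h1]; rfl
    · rw [Function.iterate_succ_apply', ← h2]; rfl

/-- Stages from 1 on are of the form `closeEdges`, hence the bound N + 1, and satisfy all closing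
rules; these involve finitely many flags at a time and pass to the limit. No face stays open since
faces of stage n are glued in stage n + 1. -/
lemma isComplete_limit : IsComplete T z (limit T z) where
  nanotube := isNanotubeUnion_limit
  symm c d h := by
    obtain ⟨s, rfl⟩ := limitMk_surjective c
    obtain ⟨t, rfl⟩ := limitMk_surjective d
    obtain ⟨N, h⟩ := (limit_glued_iff _ _).1 h
    refine (limit_glued_iff _ _).2 ⟨N + 1, fun n hn => ?_⟩
    obtain ⟨n, rfl⟩ := Nat.exists_eq_add_of_le' (by omega : 1 ≤ n)
    exact closeEdges_glued_symm (h (n + 1) (by omega))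
  unique c d d' h h' := by
    obtain ⟨s, rfl⟩ := limitMk_surjective c
    obtain ⟨t, rfl⟩ := limitMk_surjective d
    obtain ⟨t', rfl⟩ := limitMk_surjective d'
    obtain ⟨N, h⟩ := (limit_glued_iff _ _).1 h
    obtain ⟨N', h'⟩ := (limit_glued_iff _ _).1 h'
    refine (limitMk_eq_iff _ _).2 ⟨max N N' + 1, fun n hn => ?_⟩
    obtain ⟨n, rfl⟩ := Nat.exists_eq_add_of_le' (by omega : 1 ≤ n)
    exact closeEdges_glued_unique (h (n + 1) (by omega)) (h' (n + 1) (by omega))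
  exists_glued c := by
    obtain ⟨n, c, rfl⟩ := exists_push_eq c
    obtain ⟨d, hd⟩ := exists_glued_flagNext n c
    refine ⟨push (n + 1) d, ?_⟩
    have := push_glued hd
    have h1 : push (n + 1) (flagNext T z n c) = push n c := by
      have h2 := push_eq_limitMk (n := n + 1) (pushSeq n c) fun k hk => pushSeq_succ (by omega) c
      rwa [pushSeq_succ le_rfl, pushSeq_self] at h2
    rwa [h1] at this
  rot c d h := by
    obtain ⟨s, rfl⟩ := limitMk_surjective c
    obtain ⟨t, rfl⟩ := limitMk_surjective d
    obtain ⟨N, h⟩ := (limit_glued_iff _ _).1 h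
    obtain ⟨t', h1, h2⟩ := limit_rot_iterate (T.r - 1) t
    rw [h1]
    refine (limit_glued_iff s.rot t').2 ⟨N + 1, fun n hn => ?_⟩
    rw [h2]
    obtain ⟨n, rfl⟩ := Nat.exists_eq_add_of_le' (by omega : 1 ≤ n)
    exact closeEdges_glued_rot (h (n + 1) (by omega))
  edge c h := by
    choose s hs using fun i => limitMk_surjective (c i)
    obtain rfl : (fun i => limitMk (s i)) = c := funext hs
    have h1 : ∀ i, ∃ N, i + 1 < T.p → ∀ n ≥ N,
        (stage T z n).Glued ((stage T z n).flip ((s i).1 n)) ((s (i + 1)).1 n) := fun i => by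
      by_cases hi : i + 1 < T.p
      · obtain ⟨N, hN⟩ := h i hi
        exact ⟨N, fun _ => hN⟩
      · exact ⟨0, fun h => absurd h hi⟩
    choose N hN using h1
    -- The sum is a common bound for the finitely many stages `N i`.
    refine ⟨(∑ i ∈ Finset.range T.p, N i) + 1, fun n hn => ?_⟩
    have hle : ∀ i, i + 1 < T.p → N i ≤ n := fun i hi => by
      have := Finset.single_le_sum (f := N) (fun _ _ => Nat.zero_le _)
        (Finset.mem_range.2 (by omega : i < T.p))
      omega
    obtain ⟨n, rfl⟩ := Nat.exists_eq_add_of_le' (by omega : 1 ≤ n)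
    exact closeEdges_glued_edge (fun i => (s i).1 (n + 1)) fun i hi => hN i hi _ (hle i hi)

/-- If the limit is finite, then from some stage on no face is open and the map to the limit is
injective. -/
lemma exists_stage_of_finite [Finite (limit T z).Flag] : ∃ N, ∀ n ≥ N,
    (∀ c : (stage T z n).Flag, ∃ d, (stage T z n).Glued c d) ∧
    Function.Injective (push n : (stage T z n).Flag → (limit T z).Flag) := by
  obtain ⟨_⟩ := nonempty_fintype (limit T z).Flag
  choose s hs using limitMk_surjective (T := T) (z := z)
  choose g hg using isComplete_limit (T := T) (z := z).exists_glued
  have e1 : ∀ x, ∀ᶠ n in Filter.atTop, ∀ k ≥ n, (s x).1 (k + 1) = flagNext T z k ((s x).1 k) := by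
    intro x
    obtain ⟨N, h⟩ := (s x).2
    exact Filter.eventually_atTop.2 ⟨N, fun n hn k hk => h k (hn.trans hk)⟩
  have e2 : ∀ x, ∀ᶠ n in Filter.atTop,
      (s ((limit T z).rot x)).1 n = (stage T z n).rot ((s x).1 n) := by
    intro x
    rw [Filter.eventually_atTop]
    exact (limitMk_eq_iff (s ((limit T z).rot x)) (s x).rot).1
      ((hs _).trans (congrArg (limit T z).rot (hs x).symm))
  have e3 : ∀ x, ∀ᶠ n in Filter.atTop,
      (s ((limit T z).flip x)).1 n = (stage T z n).flip ((s x).1 n) := by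
    intro x
    rw [Filter.eventually_atTop]
    exact (limitMk_eq_iff (s ((limit T z).flip x)) (s x).flip).1
      ((hs _).trans (congrArg (limit T z).flip (hs x).symm))
  have e4 : ∀ x, ∀ᶠ n in Filter.atTop, (stage T z n).Glued ((s x).1 n) ((s (g x)).1 n) := by
    intro x
    rw [Filter.eventually_atTop]
    apply (limit_glued_iff _ _).1
    rw [hs, hs]
    exact hg x
  have e5 : ∀ᶠ n in Filter.atTop, (s (push 0 (baseFlag T z 0))).1 n = baseFlag T z n := by
    rw [Filter.eventually_atTop]
    refine (limitMk_eq_iff _ ⟨baseFlag T z, 0, fun _ _ => rfl⟩).1 ?_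
    rw [hs]
    exact push_eq_limitMk (n := 0) ⟨baseFlag T z, 0, fun _ _ => rfl⟩ fun _ _ => rfl
  obtain ⟨N, hN⟩ := Filter.eventually_atTop.1 ((Filter.eventually_all.2 e1).and
    ((Filter.eventually_all.2 e2).and ((Filter.eventually_all.2 e3).and
      ((Filter.eventually_all.2 e4).and e5))))
  refine ⟨N + 1, fun n hn => ?_⟩
  obtain ⟨n, rfl⟩ := Nat.exists_eq_add_of_le' (by omega : 1 ≤ n)
  obtain ⟨h1, h2, h3, h4, h5⟩ := hN (n + 1) (by omega)
  -- The chosen representatives of limit flags contain the base flag and are by now closed under all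
  -- moves, so by connectedness they are all flags of the stage.
  have key : ∀ c : (stage T z (n + 1)).Flag, ∃ x, c = (s x).1 (n + 1) := by
    refine stage_induction ⟨_, h5.symm⟩ ?_ ?_ ?_
    · rintro _ ⟨x, rfl⟩
      exact ⟨_, (h2 x).symm⟩
    · rintro _ ⟨x, rfl⟩
      exact ⟨_, (h3 x).symm⟩
    · rintro _ d hd ⟨x, rfl⟩
      exact ⟨g x, closeEdges_glued_unique hd (h4 x)⟩
  refine ⟨fun c => ?_, fun c d hcd => ?_⟩
  · obtain ⟨x, rfl⟩ := key c
    exact ⟨_, h4 x⟩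
  · obtain ⟨x, rfl⟩ := key c
    obtain ⟨y, rfl⟩ := key d
    rw [push_eq_limitMk _ (h1 x), push_eq_limitMk _ (h1 y), hs, hs] at hcd
    rw [hcd]

end NanoComplex
end RegTess

namespace RegTess

namespace NanoComplex

open TessType

variable {T : TessType} {z : T.cuspRing}

/-! ### Finite quotients -/

/-- The normal closure of the translation by `z` in the rotation group. -/
def cuspClosure (T : TessType) (z : T.cuspRing) : Subgroup T.Γ :=
  Subgroup.normalClosure {g : T.Γ | (g : PGL(2, ℂ)) = parabolic (z : ℂ)}

instance (T : TessType) (z : T.cuspRing) : (cuspClosure T z).Normal :=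
  Subgroup.normalClosure_normal

lemma cuspClosure_le_iff {N : Subgroup T.Γ} [N.Normal] :
    cuspClosure T z ≤ N ↔ T.parabolicΓ z ∈ N := by
  refine ⟨fun h => h (Subgroup.subset_normalClosure rfl), fun h => Subgroup.normalClosure_le_normal ?_⟩
  intro g hg
  obtain rfl : g = T.parabolicΓ z := Subtype.ext hg
  exact h

/-- A stage is connected under moves, and a flag map has to follow them. This yields the uniqueness
of f_n. -/
lemma IsFlagMap.eq_of_baseFlag {G : Type*} [Group G] {π : T.Γ →* G} {n : ℕ}
    {φ ψ : (stage T z n).Flag → G} (h : IsFlagMap π _ φ) (h' : IsFlagMap π _ ψ)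
    (h0 : φ (baseFlag T z n) = ψ (baseFlag T z n)) : φ = ψ := by
  refine funext (stage_induction h0 ?_ ?_ ?_)
  · intro c hc
    rw [h.rot, h'.rot, hc]
  · intro c hc
    rw [h.flip, h'.flip, hc]
  · intro c d hcd hc
    rw [h.glued c d hcd, h'.glued c d hcd, hc]

/-- The element γ records a path of moves from the base flag to c; the same path computes the limit
flag and the value of the flag map. -/
lemma push_baseFlag_stage (n : ℕ) {η : T.Γ →* (Equiv.Perm (limit T z).Flag)ᵐᵒᵖ}
    (h2 : ∀ c, (η (T.genΓ 2)).unop c = (limit T z).rot c)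
    (h1 : ∀ c, (η (T.genΓ 1)).unop c = (limit T z).flip c)
    (h0 : ∀ c d, (limit T z).Glued c d → (η (T.genΓ 0)).unop c = d)
    {G : Type*} [Group G] {π : T.Γ →* G} {φ : (stage T z n).Flag → G} (h : IsFlagMap π _ φ)
    (c : (stage T z n).Flag) : ∃ γ : T.Γ,
      push n c = (η γ).unop (push 0 (baseFlag T z 0)) ∧ φ c = φ (baseFlag T z n) * π γ := by
  refine stage_induction (S := fun c => ∃ γ : T.Γ,
      push n c = (η γ).unop (push 0 (baseFlag T z 0)) ∧ φ c = φ (baseFlag T z n) * π γ)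
    ⟨1, ?_, ?_⟩ ?_ ?_ ?_ c
  · rw [push_baseFlag, map_one]; rfl
  · rw [map_one, mul_one]
  · rintro c ⟨γ, hp, hφ⟩
    refine ⟨γ * T.genΓ 2, ?_, ?_⟩
    · rw [push_rot, ← h2, hp, map_mul]; rfl
    · rw [h.rot, hφ, map_mul, mul_assoc]
  · rintro c ⟨γ, hp, hφ⟩
    refine ⟨γ * T.genΓ 1, ?_, ?_⟩
    · rw [push_flip, ← h1, hp, map_mul]; rfl
    · rw [h.flip, hφ, map_mul, mul_assoc]
  · rintro c d hcd ⟨γ, hp, hφ⟩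
    refine ⟨γ * T.genΓ 0, ?_, ?_⟩
    · rw [← h0 _ _ (push_glued hcd), hp, map_mul]; rfl
    · rw [h.glued c d hcd, hφ, map_mul, mul_assoc]

/-- If the translation by `z` generates a normal subgroup of finite index, then the construction
terminates, and eventually flags are determined by their values under flag maps. -/
lemma exists_stage_complete [Finite (T.Γ ⧸ cuspClosure T z)] : ∃ N, ∀ n ≥ N,
    (∀ c : (stage T z n).Flag, ∃ d, (stage T z n).Glued c d) ∧
    ∀ {G : Type} [Group G] {π : T.Γ →* G} {φ : (stage T z n).Flag → G}, IsFlagMap π _ φ →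
      π.ker ≤ cuspClosure T z → Function.Injective φ := by
  obtain ⟨η, h2, h1, h0, hz⟩ := (isComplete_limit (T := T) (z := z)).exists_action
  have hη : cuspClosure T z ≤ η.ker := cuspClosure_le_iff.2 hz
  have hπ : QuotientGroup.mk' (cuspClosure T z) (T.parabolicΓ z) = 1 :=
    (QuotientGroup.eq_one_iff _).2 (cuspClosure_le_iff.1 le_rfl)
  have horbit : ∀ x, ∃ γ : T.Γ, x = (η γ).unop (push 0 (baseFlag T z 0)) := by
    intro x
    obtain ⟨n, c, rfl⟩ := exists_push_eq x
    obtain ⟨φ, hφ, -⟩ := exists_isFlagMap hπ (nanotubeMap_isFlagMap hπ 1) n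
    obtain ⟨γ, h, -⟩ := push_baseFlag_stage n h2 h1 h0 hφ c
    exact ⟨γ, h⟩
  -- The transitive action on the limit factors through a finite quotient, so the limit is finite.
  have hsurj : Function.Surjective fun a : T.Γ ⧸ cuspClosure T z =>
      (η a.out).unop (push 0 (baseFlag T z 0)) := by
    intro x
    obtain ⟨γ, rfl⟩ := horbit x
    refine ⟨QuotientGroup.mk γ, ?_⟩
    have h := QuotientGroup.eq.1 (QuotientGroup.mk (s := cuspClosure T z) γ).out_eq'
    have h3 : η ((QuotientGroup.mk (s := cuspClosure T z) γ).out⁻¹ * γ) = 1 := hη h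
    rw [map_mul, map_inv, inv_mul_eq_one] at h3
    simp only [h3]
  have := Finite.of_surjective _ hsurj
  obtain ⟨N, hN⟩ := exists_stage_of_finite (T := T) (z := z)
  refine ⟨N, fun n hn => ⟨(hN n hn).1, fun {G} _ {π φ} hφ hπ c d hcd => (hN n hn).2 ?_⟩⟩
  obtain ⟨γ, hc, hc'⟩ := push_baseFlag_stage n h2 h1 h0 hφ c
  obtain ⟨δ, hd, hd'⟩ := push_baseFlag_stage n h2 h1 h0 hφ d
  -- Equal values mean that γ and δ differ by an element of the kernel of π, which acts trivially on
  -- the limit.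
  rw [hc', hd', mul_right_inj, ← inv_mul_eq_one, ← map_inv, ← map_mul] at hcd
  have h3 : η (γ⁻¹ * δ) = 1 := hη (hπ hcd)
  rw [map_mul, map_inv, inv_mul_eq_one] at h3
  rw [hc, hd, h3]

/-- Compatible flag maps to a finite group are eventually surjective. -/
lemma exists_stage_surjective {G : Type*} [Group G] [Finite G] {π : T.Γ →* G}
    (hπ : Function.Surjective π) (φ : ∀ n, (stage T z n).Flag → G) (h : ∀ n, IsFlagMap π _ (φ n))
    (hφ : ∀ n c, φ (n + 1) (flagNext T z n c) = φ n c) :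
    ∃ N, ∀ n ≥ N, Function.Surjective (φ n) := by
  have hmono : Monotone fun n => Set.range (φ n) := by
    refine monotone_nat_of_le_succ fun n => ?_
    rintro _ ⟨c, rfl⟩
    exact ⟨_, hφ n c⟩
  -- An increasing sequence of subsets of a finite group stabilises.
  obtain ⟨N, hN⟩ := WellFoundedGT.monotone_chain_condition ⟨_, hmono⟩
  have hN' : Set.range (φ (N + 1)) = Set.range (φ N) := (hN (N + 1) (Nat.le_succ N)).symm
  have key : ∀ γ : T.Γ, Set.MapsTo (· * π γ) (Set.range (φ N)) (Set.range (φ N)) := by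
    refine T.Γ_induction ?_ ?_ ?_ ?_
    · rintro i _ ⟨c, rfl⟩
      fin_cases i
      -- The face of c may be open in stage N, but is glued in stage N + 1, which has the same
      -- range.
      · obtain ⟨d, hd⟩ := exists_glued_flagNext N c
        rw [← hN']
        exact ⟨d, ((h (N + 1)).glued _ _ hd).trans (by rw [hφ]; rfl)⟩
      · exact ⟨_, (h N).flip c⟩
      · exact ⟨_, (h N).rot c⟩
      · refine ⟨c, ?_⟩
        have h3 : T.genΓ 3 = 1 := rfl
        show φ N c = φ N c * π (T.genΓ 3)
        rw [h3, map_one, mul_one]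
    · intro x hx
      simpa using hx
    · intro a b ha hb x hx
      have := hb (ha hx)
      simpa [mul_assoc] using this
    · intro a ha x hx
      -- An injective self-map of a finite set is onto, so the range is also closed under inverses.
      obtain ⟨y, hy, rfl⟩ := (((Set.toFinite _).injOn_iff_bijOn_of_mapsTo ha).1
        (mul_left_injective _).injOn).surjOn hx
      simpa using hy
  refine ⟨N, fun n hn g => ?_⟩
  obtain ⟨γ, hγ⟩ := hπ ((φ N (baseFlag T z N))⁻¹ * g)
  have h1 := key γ ⟨baseFlag T z N, rfl⟩
  rw [hγ] at h1
  have h2 : g ∈ Set.range (φ N) := by simpa using h1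
  exact hmono hn h2

/-! ### Finiteness of the stages -/

instance : Module.Finite ℤ T.cuspRing := by
  have h : IsIntegral ℤ T.u := ⟨Polynomial.X ^ T.r - 1,
    Polynomial.monic_X_pow_sub_C 1 (NeZero.ne T.r), by simp [T.u_pow_r]⟩
  exact Algebra.finite_adjoin_simple_of_isIntegral h

lemma finite_nanotube (hz : z ≠ 0) : Finite (nanotube T z).Flag := by
  have : Finite (T.cuspRing ⧸ Ideal.span {z}) := Ideal.finiteQuotientOfFreeOfNeBot _
    fun h => hz (Ideal.span_singleton_eq_bot.1 h)
  show Finite ((T.cuspRing ⧸ Ideal.span {z}) × ZMod T.r)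
  infer_instance

lemma finite_stage (hz : z ≠ 0) (n : ℕ) : Finite (stage T z n).Flag := by
  have h0 := finite_nanotube hz
  induction n with
  | zero => exact h0
  | succ n ih =>
    have h1 : Finite (stage T z n).Face := Quot.finite _
    have h2 : Finite (stage T z n).OpenFace := Subtype.finite
    have h3 : Finite ((stage T z n).attach T z).Flag :=
      inferInstanceAs (Finite ((stage T z n).Flag ⊕ ((stage T z n).OpenFace × (nanotube T z).Flag)))
    exact Quotient.finite _

end NanoComplex
end RegTess

-- The tiling of hyperbolic space by pieces, and the Ford domain.

namespace RegTess

namespace HypSpace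

instance : ContinuousConstSMul PGL(2, ℂ) HypSpace where
  continuous_const_smul g := by
    induction g using Matrix.ProjGenLinGroup.induction_on with
    | mk A =>
    show Continuous (moebius A)
    have hd : Continuous (denom A) := by
      have := Complex.continuous_normSq
      unfold denom
      fun_prop
    refine Continuous.subtype_mk (Continuous.prodMk (Continuous.div ?_ ?_ fun x => ?_)
      (Continuous.div ?_ hd fun x => (denom_pos A x).ne')) _
    · have := Complex.continuous_conj
      have := continuous_horiz
      have := Complex.continuous_ofReal.comp continuous_height
      fun_prop
    · exact Complex.continuous_ofReal.comp hd
    · exact Complex.ofReal_ne_zero.2 (denom_pos A x).ne'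
    · fun_prop

end HypSpace

namespace TessType

open HypSpace

variable {T : TessType}

lemma toW_injective : Function.Injective T.toW := fun a b h => Subtype.ext <| pgl_ext fun x => by
  rw [← toW_smul, ← toW_smul, h]

/-- The two chambers of a piece. -/
noncomputable def side (T : TessType) (ε : Bool) : T.W := bif ε then T.cs.simple 3 else 1

lemma side_mul_side (ε : Bool) : T.side ε * T.side ε = 1 := by
  cases ε
  · exact one_mul 1
  · exact T.cs.simple_mul_simple_self 3

lemma side_smul_side_smul (ε : Bool) (x : HypSpace) : T.side ε • T.side ε • x = x := by
  rw [← mul_smul, side_mul_side, one_smul]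

lemma mem_Piece_iff_exists_side (x : HypSpace) : x ∈ Piece T ↔ ∃ ε, T.side ε • x ∈ T.chamber := by
  rw [mem_Piece_iff, Bool.exists_bool]
  simp [side, simple_three_smul]

lemma side_smul_mem_Piece {x : HypSpace} (hx : x ∈ T.chamber) (ε : Bool) :
    T.side ε • x ∈ Piece T :=
  (mem_Piece_iff_exists_side _).2 ⟨ε, by rwa [side_smul_side_smul]⟩

lemma exists_side_smul {x : HypSpace} (hx : x ∈ Piece T) :
    ∃ ε, ∃ y ∈ T.chamber, x = T.side ε • y := by
  obtain ⟨ε, h⟩ := (mem_Piece_iff_exists_side _).1 hx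
  exact ⟨ε, _, h, (side_smul_side_smul _ _).symm⟩

lemma side_height (ε : Bool) (x : HypSpace) : (T.side ε • x).height = x.height := by
  cases ε
  · exact congrArg _ (one_smul _ x)
  · exact (congrArg _ (T.simple_three_smul x)).trans (conjH_height x)

/-- Each element of the Coxeter group is a rotation, possibly preceded by the reflection `3`. -/
lemma exists_eq_mul_side (w : T.W) : ∃ (γ : T.Γ) (ε : Bool), w = T.toW γ * T.side ε := by
  have hw : w ∈ Subgroup.closure (T.cs.simple '' Set.univ) := by
    rw [Set.image_univ, T.cs.subgroup_closure_range_simple]; trivial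
  obtain ⟨γ, hγ, h | h⟩ := T.exists_gens_smul_eq hw
  all_goals rw [Set.image_univ, closure_gens] at hγ
  · refine ⟨⟨γ, hγ⟩, false, T.W_eq_of_smul fun x => ?_⟩
    rw [h, mul_smul, toW_smul]
    exact congrArg _ (one_smul _ x).symm
  · refine ⟨⟨γ, hγ⟩, true, T.W_eq_of_smul fun x => ?_⟩
    rw [h, mul_smul, toW_smul]
    exact congrArg _ (T.simple_three_smul x).symm

lemma side_injective_of_toW {γ δ : T.Γ} {ε ε' : Bool} (h : T.toW γ * T.side ε = T.toW δ * T.side ε') :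
    ε = ε' := by
  have h1 := congrArg T.cs.lengthParity h
  rw [map_mul, map_mul, lengthParity_toW, lengthParity_toW, one_mul, one_mul] at h1
  have h2 : T.cs.lengthParity (T.cs.simple 3) ≠ 1 := by
    rw [T.cs.lengthParity_simple]
    decide
  cases ε <;> cases ε' <;> simp [side, h2, h2.symm] at h1 ⊢

/-- The pieces cover hyperbolic space. -/
lemma exists_smul_Piece (x : HypSpace) :
    ∃ (γ : T.Γ) (y : Piece T), x = (γ : PGL(2, ℂ)) • (y : HypSpace) := by
  obtain ⟨w, hw⟩ := T.exists_smul_mem_chamber x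
  obtain ⟨γ, ε, h⟩ := T.exists_eq_mul_side w⁻¹
  refine ⟨γ, ⟨_, side_smul_mem_Piece hw ε⟩, ?_⟩
  rw [← toW_smul, ← mul_smul, ← h, inv_smul_smul]

lemma finite_smul_Piece (D : ℝ) :
    {γ : T.Γ | ∃ x ∈ Piece T, coshDist ((γ : PGL(2, ℂ)) • x) T.basePt ≤ D}.Finite := by
  refine Set.Finite.subset ((Set.finite_univ (α := Bool)).biUnion fun ε _ =>
    (T.finite_smul_chamber D).preimage
      (f := fun γ => T.toW γ * T.side ε) fun γ _ δ _ h => toW_injective (mul_right_cancel h)) ?_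
  rintro γ ⟨x, hx, h⟩
  obtain ⟨ε, y, hy, rfl⟩ := exists_side_smul hx
  refine Set.mem_biUnion (Set.mem_univ ε) ⟨y, hy, ?_⟩
  rwa [mul_smul, toW_smul]

lemma isClosed_Piece : IsClosed (Piece T) := by
  have h1 := Complex.continuous_re.comp continuous_horiz
  have h2 := Complex.continuous_im.comp continuous_horiz
  have h3 := Complex.continuous_normSq.comp continuous_horiz
  have h4 := continuous_height
  convert ((isClosed_le (continuous_abs.comp h2) (h1.const_mul _)).inter
    (isClosed_le h1 continuous_const)).inter
      (isClosed_le continuous_const (h3.add (h4.pow 2)))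
  ext x
  exact and_assoc.symm

/-- Allows continuity on hyperbolic space to be checked piece by piece, as needed for the inverse of
`realize`. -/
lemma locallyFinite_smul_Piece :
    LocallyFinite fun γ : T.Γ => (fun x => (γ : PGL(2, ℂ)) • x) '' Piece T := by
  intro x
  refine ⟨{y | coshDist y T.basePt < coshDist x T.basePt + 1}, ?_, ?_⟩
  · refine (isOpen_lt ?_ continuous_const).mem_nhds (lt_add_one (coshDist x T.basePt))
    exact continuous_coshDist.comp (Continuous.prodMk_left _)
  · refine (T.finite_smul_Piece (coshDist x T.basePt + 1)).subset ?_
    rintro γ ⟨_, ⟨y, hy, rfl⟩, h⟩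
    exact ⟨y, hy, le_of_lt h⟩

lemma isClosed_smul_Piece (γ : PGL(2, ℂ)) : IsClosed ((fun x => γ • x) '' Piece T) :=
  (Homeomorph.smul γ).isClosedMap _ isClosed_Piece

lemma exists_cuspElt {γ : PGL(2, ℂ)} (h : γ ∈ T.cuspGroup) : ∃ x, (T.cuspElt x : PGL(2, ℂ)) = γ := by
  induction h using Subgroup.closure_induction_right with
  | one => exact ⟨(0, 0), by simp [coe_cuspElt, parabolic_zero]⟩
  | mul_right γ _ s hs ih =>
    obtain ⟨i, hi, rfl⟩ := hs
    obtain ⟨x, rfl⟩ := ih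
    fin_cases i
    · exact absurd rfl hi
    · exact ⟨_, congrArg Subtype.val (T.cuspElt_coverFlip x)⟩
    · exact ⟨_, congrArg Subtype.val (T.cuspElt_coverRot x)⟩
    · exact ⟨x, (mul_one _).symm⟩
  | mul_inv_cancel γ _ s hs ih =>
    obtain ⟨i, hi, rfl⟩ := hs
    obtain ⟨x, rfl⟩ := ih
    fin_cases i
    · exact absurd rfl hi
    · refine ⟨T.coverFlip x, (congrArg Subtype.val (T.cuspElt_coverFlip x)).trans ?_⟩
      show _ * T.genΓ 1 = _ * ((T.genΓ 1 : T.Γ) : PGL(2, ℂ))⁻¹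
      rw [← Subgroup.coe_inv, inv_eq_of_mul_eq_one_left T.isRotationSystem_genΓ.one_mul_one]
    · refine ⟨(x.1, x.2 - 1), ?_⟩
      have h := congrArg Subtype.val (T.cuspElt_coverRot (x.1, x.2 - 1))
      have h1 : T.coverRot (x.1, x.2 - 1) = x := Prod.ext rfl (sub_add_cancel _ _)
      rw [h1] at h
      rw [h]
      exact (mul_inv_cancel_right _ _).symm
    · exact ⟨x, by simp [gens]⟩

lemma cuspElt_mem_cuspGroup (x : T.cuspRing × ZMod T.r) : (T.cuspElt x : PGL(2, ℂ)) ∈ T.cuspGroup :=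
  mul_mem (T.parabolic_mem_cuspGroup _) (pow_mem T.gR_mem_cuspGroup _)

/-- The Ford domain consists of the pieces at the cusp `∞`. -/
lemma mem_fordDomain_iff (x : HypSpace) :
    x ∈ fordDomain T ↔ ∃ (a : T.cuspRing × ZMod T.r) (y : Piece T),
      x = (T.cuspElt a : PGL(2, ℂ)) • (y : HypSpace) := by
  constructor
  · intro hx
    obtain ⟨w, hw⟩ := T.exists_smul_mem_chamber x
    obtain ⟨γ, ε, h⟩ := T.exists_eq_mul_side w⁻¹
    have hxw : x = w⁻¹ • w • x := (inv_smul_smul _ _).symm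
    have h1 : (w • x).height ≤ x.height := by
      have h2 := hx (γ⁻¹ : T.Γ) (γ⁻¹ : T.Γ).2
      have h3 : ((γ⁻¹ : T.Γ) : PGL(2, ℂ)) • x = T.side ε • w • x := by
        rw [← toW_smul, map_inv, inv_smul_eq_iff, ← mul_smul, ← h, inv_smul_smul]
      rwa [h3, side_height] at h2
    -- The chamber point `w • x` is a highest point of its orbit, and so is x; equality of heights
    -- gives an element of the stabilizer of ∞ taking one to the other.
    obtain ⟨h4, h5⟩ := T.height_smul_le hw w⁻¹
    rw [inv_smul_smul] at h4 h5
    obtain ⟨w', hw', h6⟩ := h5 (le_antisymm h4 h1)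
    obtain ⟨δ, hδ, h | h⟩ := T.exists_gens_smul_eq hw'
    · obtain ⟨a, rfl⟩ := exists_cuspElt hδ
      exact ⟨a, ⟨_, (T.mem_Piece_iff _).2 (.inl hw)⟩, h6.trans (h _)⟩
    · obtain ⟨a, rfl⟩ := exists_cuspElt hδ
      refine ⟨a, ⟨_, (T.mem_Piece_iff _).2 (.inr ?_)⟩, h6.trans (h _)⟩
      rwa [show conjH (conjH (w • x)) = w • x from DFunLike.congr_fun conjH_mul_self _]
  · rintro ⟨a, ⟨y, hy⟩, rfl⟩ γ hγ
    rw [T.cuspGroup_height (cuspElt_mem_cuspGroup a)]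
    obtain ⟨ε, y, hy', rfl⟩ := exists_side_smul hy
    have h := (T.height_smul_le hy' (T.toW (⟨γ, hγ⟩ * T.cuspElt a) * T.side ε)).1
    rw [mul_smul, toW_smul] at h
    rw [side_height]
    simpa [mul_smul] using h

end TessType
end RegTess

namespace RegTess

open TessType HypSpace

variable {T : TessType}

/-! ### Cosets and points of the quotient space -/

section Coset

variable {M : Subgroup PGL(2, ℂ)} [hM : (M.subgroupOf T.Γ).Normal]

/-- The map of a fundamental piece to the quotient space given by a coset. -/
noncomputable def cosetProj (g : T.Γ ⧸ M.subgroupOf T.Γ) (x : HypSpace) : QuotientSpace M :=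
  proj M ((g.out : PGL(2, ℂ)) • x)

omit hM in
lemma proj_eq_iff (x y : HypSpace) : proj M x = proj M y ↔ ∃ m ∈ M, m • y = x := by
  refine Quotient.eq.trans ⟨fun ⟨m, h⟩ => ⟨m, m.2, h⟩, fun ⟨m, hm, h⟩ => ⟨⟨m, hm⟩, h⟩⟩

/-- An element of M relating the two image points is trivial in the quotient group, so it disappears
from the equation between cosets. -/
lemma cosetProj_eq_iff (hle : M ≤ T.Γ) (g h : T.Γ ⧸ M.subgroupOf T.Γ) (x y : HypSpace) :
    cosetProj g x = cosetProj h y ↔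
      ∃ ε : T.Γ, h = g * (ε : T.Γ ⧸ M.subgroupOf T.Γ) ∧ x = (ε : PGL(2, ℂ)) • y := by
  rw [cosetProj, cosetProj, proj_eq_iff]
  have hg := g.out_eq'
  have hh := h.out_eq'
  generalize g.out = γ at *
  generalize h.out = δ at *
  subst hg hh
  constructor
  · rintro ⟨m, hm, h⟩
    refine ⟨γ⁻¹ * ⟨m, hle hm⟩ * δ, ?_, ?_⟩
    · have h1 : ((⟨m, hle hm⟩ : T.Γ) : T.Γ ⧸ M.subgroupOf T.Γ) = 1 := (QuotientGroup.eq_one_iff _).2 hm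
      rw [QuotientGroup.mk_mul, QuotientGroup.mk_mul, h1, mul_one, QuotientGroup.mk_inv,
        mul_inv_cancel_left]
    · rw [Subgroup.coe_mul, mul_smul, Subgroup.coe_mul, mul_smul, Subgroup.coe_inv, eq_inv_smul_iff,
        ← h]
  · rintro ⟨ε, h, rfl⟩
    rw [← QuotientGroup.mk_mul] at h
    have h1 : γ * ε * δ⁻¹ ∈ M.subgroupOf T.Γ := by
      rw [← QuotientGroup.eq_one_iff, QuotientGroup.mk_mul, ← h, ← QuotientGroup.mk_mul,
        mul_inv_cancel, QuotientGroup.mk_one]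
    refine ⟨(γ * ε * δ⁻¹ : T.Γ), h1, ?_⟩
    simp [mul_smul]

lemma cosetProj_mk (γ : T.Γ) (x : HypSpace) :
    cosetProj (γ : T.Γ ⧸ M.subgroupOf T.Γ) x = proj M ((γ : PGL(2, ℂ)) • x) := by
  have h := QuotientGroup.out_eq' (γ : T.Γ ⧸ M.subgroupOf T.Γ)
  rw [cosetProj, proj_eq_iff]
  generalize Quotient.out (γ : T.Γ ⧸ M.subgroupOf T.Γ) = δ at *
  have h1 : δ * γ⁻¹ ∈ M.subgroupOf T.Γ := by
    rw [← QuotientGroup.eq_one_iff, QuotientGroup.mk_mul, h, ← QuotientGroup.mk_mul,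
      mul_inv_cancel, QuotientGroup.mk_one]
  exact ⟨(δ * γ⁻¹ : T.Γ), h1, by simp [mul_smul]⟩

lemma cosetProj_mul (hle : M ≤ T.Γ) (g : T.Γ ⧸ M.subgroupOf T.Γ) (ε : T.Γ) (x : HypSpace) :
    cosetProj (g * (ε : T.Γ ⧸ M.subgroupOf T.Γ)) x = cosetProj g ((ε : PGL(2, ℂ)) • x) :=
  ((cosetProj_eq_iff hle _ _ _ _).2 ⟨ε, rfl, rfl⟩).symm

omit hM in
lemma continuous_proj : Continuous (proj M) := continuous_quotient_mk'

omit hM in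
lemma continuous_cosetProj (g : T.Γ ⧸ M.subgroupOf T.Γ) : Continuous (cosetProj g) :=
  continuous_proj.comp (continuous_const_smul _)

/-- A coset is determined by the image of a point with trivial stabilizer. -/
lemma cosetProj_injective_left (hle : M ≤ T.Γ) {g h : T.Γ ⧸ M.subgroupOf T.Γ} {x : HypSpace}
    (hx : ∀ γ ∈ T.Γ, γ • x = x → γ = 1) (e : cosetProj g x = cosetProj h x) : g = h := by
  obtain ⟨ε, h1, h2⟩ := (cosetProj_eq_iff hle _ _ _ _).1 e
  obtain rfl : ε = 1 := Subtype.ext (hx _ ε.2 h2.symm)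
  rw [h1, QuotientGroup.mk_one, mul_one]

end Coset

namespace NanoComplex

/-! ### Tessellation maps and flag maps -/

section Realize

variable {X : NanoComplex}

/-- The move from one flag to another one that corresponds to a generator. -/
def IsMove (X : NanoComplex) : Fin 4 → X.Flag → X.Flag → Prop :=
  ![X.Glued, fun c d => d = X.flip c, fun c d => d = X.rot c, fun c d => d = c]

lemma IsMove.mk_eq {i : Fin 4} {c d : X.Flag} (h : IsMove X i c d) {x y : Piece T}
    (hxy : (x : HypSpace) = T.gens i • (y : HypSpace)) :
    (Space.mk c x : Space T X) = Space.mk d y := by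
  fin_cases i
  · exact Quot.sound (RealRel.glue c d x y h hxy)
  · obtain rfl := h
    exact Quot.sound (RealRel.flip c x y hxy)
  · obtain rfl := h
    exact Quot.sound (RealRel.rot c x y hxy)
  · obtain rfl := h
    rw [show x = y from Subtype.ext (hxy.trans (one_smul PGL(2, ℂ) _))]

lemma exists_isMove_of_realRel {a b : Σ _ : X.Flag, Piece T} (h : RealRel T X a b) :
    ∃ i ≠ 3, IsMove X i a.1 b.1 ∧ (a.2 : HypSpace) = T.gens i • (b.2 : HypSpace) := by
  cases h with
  | rot c x y h => exact ⟨2, by decide, rfl, h⟩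
  | flip c x y h => exact ⟨1, by decide, rfl, h⟩
  | glue c d x y hg h => exact ⟨0, by decide, hg, h⟩

lemma isFlagMap_iff {G : Type*} [Group G] {π : T.Γ →* G} {φ : X.Flag → G} :
    IsFlagMap π X φ ↔ ∀ i ≠ 3, ∀ c d, IsMove X i c d → φ d = φ c * π (T.genΓ i) := by
  refine ⟨fun h i hi c d hcd => ?_, fun h => ⟨fun c => h 2 (by decide) _ _ rfl,
    fun c => h 1 (by decide) _ _ rfl, fun c d hcd => h 0 (by decide) _ _ hcd⟩⟩
  fin_cases i
  · exact h.glued c d hcd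
  · obtain rfl := hcd
    exact h.flip c
  · obtain rfl := hcd
    exact h.rot c
  · exact absurd rfl hi

lemma IsFlagMap.move {G : Type*} [Group G] {π : T.Γ →* G} {φ : X.Flag → G} (h : IsFlagMap π X φ)
    {i : Fin 4} {c d : X.Flag} (hcd : IsMove X i c d) : φ d = φ c * π (T.genΓ i) := by
  by_cases hi : i = 3
  · subst hi
    obtain rfl := hcd
    have h3 : T.genΓ 3 = 1 := rfl
    rw [h3, map_one, mul_one]
  · exact isFlagMap_iff.1 h i hi c d hcd

lemma Space.mk_surjective (p : Space T X) : ∃ (c : X.Flag) (x : Piece T), p = Space.mk c x := by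
  obtain ⟨⟨c, x⟩, rfl⟩ := Quot.mk_surjective p
  exact ⟨c, x, rfl⟩

lemma Space.continuous_mk (c : X.Flag) : Continuous (Space.mk c : Piece T → Space T X) :=
  continuous_quot_mk.comp (continuous_sigmaMk (σ := fun _ : X.Flag => Piece T))

variable {M : Subgroup PGL(2, ℂ)} [hM : (M.subgroupOf T.Γ).Normal]

/-- The map of spaces given by a flag map. -/
noncomputable def realize (hle : M ≤ T.Γ) {φ : X.Flag → T.Γ ⧸ M.subgroupOf T.Γ}
    (h : IsFlagMap (QuotientGroup.mk' (M.subgroupOf T.Γ)) X φ) : Space T X → QuotientSpace M :=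
  Quot.lift (fun a => cosetProj (φ a.1) a.2) fun a b hab => by
    obtain ⟨i, -, h1, h2⟩ := exists_isMove_of_realRel hab
    rw [h.move h1, h2]
    exact (cosetProj_mul hle (φ a.1) (T.genΓ i) b.2).symm

lemma realize_mk (hle : M ≤ T.Γ) {φ : X.Flag → T.Γ ⧸ M.subgroupOf T.Γ}
    (h : IsFlagMap (QuotientGroup.mk' (M.subgroupOf T.Γ)) X φ) (c : X.Flag) (x : Piece T) :
    realize hle h (Space.mk c x) = cosetProj (φ c) x := rfl

lemma isTessellationMap_realize (hle : M ≤ T.Γ) {φ : X.Flag → T.Γ ⧸ M.subgroupOf T.Γ}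
    (h : IsFlagMap (QuotientGroup.mk' (M.subgroupOf T.Γ)) X φ) :
    IsTessellationMap T M (realize hle h) := by
  refine ⟨?_, fun c => ⟨(φ c).out, (φ c).out.2, fun x => rfl⟩⟩
  exact continuous_quot_lift _ (continuous_sigma fun c =>
    (continuous_cosetProj (φ c)).comp continuous_subtype_val)

/-- The isometries on two adjacent pieces must agree modulo M on the common wall. Testing at one
generic wall point determines how their cosets differ. -/
lemma IsTessellationMap.exists_isFlagMap (hle : M ≤ T.Γ) {f : Space T X → QuotientSpace M}
    (hf : IsTessellationMap T M f) : ∃ φ : X.Flag → T.Γ ⧸ M.subgroupOf T.Γ,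
      ∃ h : IsFlagMap (QuotientGroup.mk' (M.subgroupOf T.Γ)) X φ, f = realize hle h := by
  choose γ hγ hf' using hf.2
  let φ : X.Flag → T.Γ ⧸ M.subgroupOf T.Γ := fun c => ((⟨γ c, hγ c⟩ : T.Γ) : T.Γ ⧸ M.subgroupOf T.Γ)
  have hφ : ∀ c (x : Piece T), f (Space.mk c x) = cosetProj (φ c) x := fun c x =>
    (hf' c x).trans (cosetProj_mk ⟨γ c, hγ c⟩ x).symm
  have h : IsFlagMap (QuotientGroup.mk' (M.subgroupOf T.Γ)) X φ := by
    refine isFlagMap_iff.2 fun i hi c d hcd => ?_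
    obtain ⟨x, hx0, hx⟩ := T.exists_wall_point hi
    have hx1 : x ∈ T.chamber := fun j => by
      by_cases hj : j = i
      · rw [hj, hx0]
      · exact (hx j hj).le
    have hx2 : x ∈ Piece T := (T.mem_Piece_iff x).2 (.inl hx1)
    -- `s_i` fixes x. So x in the piece of c and its mirror image in the piece of d are the same
    -- point of the space.
    have hx3 : x = T.gens i • conjH x := by
      rw [← simple_smul, T.simple_smul_of_root_eq_zero i x hx0]
    have hx4 : conjH x ∈ Piece T := (T.mem_Piece_iff _).2 (.inr (by
      rwa [show conjH (conjH x) = x from DFunLike.congr_fun conjH_mul_self x]))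
    have h1 := hcd.mk_eq (T := T) (x := ⟨x, hx2⟩) (y := ⟨conjH x, hx4⟩) hx3
    have h2 : cosetProj (φ c) x = cosetProj (φ d) (conjH x) := by
      rw [← hφ c ⟨x, hx2⟩, h1, hφ]
    obtain ⟨ε, h3, h4⟩ := (cosetProj_eq_iff hle _ _ _ _).1 h2
    -- Both ε and the generator map `conjH x` to x, whose rotation stabilizer is trivial.
    have h5 : ε * (T.genΓ i)⁻¹ = 1 := Subtype.ext <|
      T.eq_one_of_smul_eq (x := x) (k := i) hx0.ge hx (ε * (T.genΓ i)⁻¹).2 (by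
        have h6 : (T.gens i)⁻¹ • x = conjH x := by rw [inv_smul_eq_iff, ← hx3]
        rw [Subgroup.coe_mul, mul_smul, Subgroup.coe_inv]
        exact (congrArg _ h6).trans h4.symm)
    rw [h3, mul_inv_eq_one.1 h5]; rfl
  refine ⟨φ, h, funext fun p => ?_⟩
  obtain ⟨c, x, rfl⟩ := Space.mk_surjective p
  exact hφ c x

lemma basePt_mem_Piece : T.basePt ∈ Piece T := (T.mem_Piece_iff _).2 (.inl T.basePt_mem)

lemma eq_one_of_smul_basePt_Γ {γ : PGL(2, ℂ)} (hγ : γ ∈ T.Γ) (h : γ • T.basePt = T.basePt) :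
    γ = 1 :=
  T.eq_one_of_smul_eq (k := 0) (T.root_basePt_pos 0).le (fun i _ => T.root_basePt_pos i) hγ h

lemma eq_of_cosetProj_basePt (hle : M ≤ T.Γ) {g h : T.Γ ⧸ M.subgroupOf T.Γ}
    (e : cosetProj g T.basePt = cosetProj h T.basePt) : g = h :=
  cosetProj_injective_left hle (fun _ => eq_one_of_smul_basePt_Γ) e

lemma realize_surjective (hle : M ≤ T.Γ) {φ : X.Flag → T.Γ ⧸ M.subgroupOf T.Γ}
    (h : IsFlagMap (QuotientGroup.mk' (M.subgroupOf T.Γ)) X φ) (hφ : Function.Surjective φ) :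
    Function.Surjective (realize hle h) := by
  intro p
  obtain ⟨x, rfl⟩ := Quotient.mk_surjective p
  obtain ⟨γ, y, rfl⟩ := T.exists_smul_Piece x
  obtain ⟨c, hc⟩ := hφ γ
  refine ⟨Space.mk c y, ?_⟩
  rw [realize_mk, hc, cosetProj_mk]
  rfl

/-- Following a chain of moves that fix a point of the boundary of a chamber. -/
lemma exists_chain {G : Type*} [Group G] {π : T.Γ →* G} {φ : X.Flag → G} (h : IsFlagMap π X φ)
    {I : Set (Fin 4)} (hI : ∀ i ∈ I, ∀ c, (∃ d, IsMove X i c d) ∧ ∃ d, IsMove X i d c)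
    {x : HypSpace} (hx : x ∈ T.chamber) (hxI : ∀ i ∈ I, T.root i x = 0) {w : T.W}
    (hw : w ∈ Subgroup.closure (T.cs.simple '' I)) (c : X.Flag) (ε : Bool) :
    ∃ (d : X.Flag) (δ : Bool) (γ : T.Γ), T.side ε * w = T.toW γ * T.side δ ∧ φ d = φ c * π γ ∧
      (Space.mk c ⟨_, side_smul_mem_Piece hx ε⟩ : Space T X) =
        Space.mk d ⟨_, side_smul_mem_Piece hx δ⟩ := by
  have step : ∀ w : T.W, ∀ i ∈ I, (∃ (d : X.Flag) (δ : Bool) (γ : T.Γ),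
      T.side ε * w = T.toW γ * T.side δ ∧ φ d = φ c * π γ ∧
      (Space.mk c ⟨_, side_smul_mem_Piece hx ε⟩ : Space T X) =
        Space.mk d ⟨_, side_smul_mem_Piece hx δ⟩) → ∃ (d : X.Flag) (δ : Bool) (γ : T.Γ),
      T.side ε * (w * T.cs.simple i) = T.toW γ * T.side δ ∧ φ d = φ c * π γ ∧
      (Space.mk c ⟨_, side_smul_mem_Piece hx ε⟩ : Space T X) =
        Space.mk d ⟨_, side_smul_mem_Piece hx δ⟩ := by
    rintro w i hi ⟨d, δ, γ, h1, h2, h3⟩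
    have hs := T.simple_smul_of_root_eq_zero i x (hxI i hi)
    have hx3 : x = T.gens i • T.cs.simple 3 • x := by
      rw [simple_three_smul, ← simple_smul, hs]
    -- δ tells which half of the piece the chain has reached. As `s_i s_3` is generator i, a
    -- reflection amounts to a forward move from the first half and to a backward move from the
    -- mirror half.
    cases δ
    · obtain ⟨d', hd'⟩ := (hI i hi d).1
      refine ⟨d', true, γ * T.genΓ i, ?_, ?_, h3.trans (hd'.mk_eq ?_)⟩
      · rw [← mul_assoc, h1, map_mul, toW_genΓ]
        simp [side, mul_assoc]
      · rw [h.move hd', h2, map_mul, mul_assoc]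
      · show (1 : T.W) • x = T.gens i • T.cs.simple 3 • x
        rw [one_smul, ← hx3]
    · obtain ⟨d', hd'⟩ := (hI i hi d).2
      refine ⟨d', false, γ * (T.genΓ i)⁻¹, ?_, ?_, h3.trans (hd'.mk_eq ?_).symm⟩
      · rw [← mul_assoc, h1, map_mul, map_inv, toW_genΓ]
        simp [side, mul_assoc]
      · rw [map_mul, map_inv, ← mul_assoc, ← h2, h.move hd', mul_inv_cancel_right]
      · show (1 : T.W) • x = T.gens i • T.cs.simple 3 • x
        rw [one_smul, ← hx3]
  induction hw using Subgroup.closure_induction_right with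
  | one => exact ⟨c, ε, 1, by simp, by simp, rfl⟩
  | mul_right w _ v hv ih =>
    obtain ⟨i, hi, rfl⟩ := hv
    exact step w i hi ih
  | mul_inv_cancel w _ v hv ih =>
    obtain ⟨i, hi, rfl⟩ := hv
    rw [CoxeterSystem.inv_simple]
    exact step w i hi ih

lemma IsNanotubeUnion.exists_isMove {z : T.cuspRing} (hX : IsNanotubeUnion T z X) {i : Fin 4}
    (hi : i ≠ 0) (c : X.Flag) : (∃ d, IsMove X i c d) ∧ ∃ d, IsMove X i d c := by
  fin_cases i
  · exact absurd rfl hi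
  · exact ⟨⟨_, rfl⟩, X.flip c, (hX.flip_flip c).symm⟩
  · refine ⟨⟨_, rfl⟩, X.rot^[T.r - 1] c, ?_⟩
    show c = X.rot _
    rw [← Function.iterate_succ_apply' X.rot, Nat.succ_eq_add_one,
      Nat.sub_add_cancel NeZero.one_le, hX.rot_iterate]
  · exact ⟨⟨c, rfl⟩, c, rfl⟩

lemma root_zero_side (ε : Bool) (x : HypSpace) : T.root 0 (T.side ε • x) = T.root 0 x := by
  cases ε
  · exact congrArg _ (one_smul _ x)
  · refine (congrArg _ (T.simple_three_smul x)).trans ?_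
    rw [root_zero, root_zero, conjH_horiz, conjH_height, Complex.normSq_conj]

/-- An injective flag map gives an injective map on the interior of the complex. -/
lemma realize_inj {z : T.cuspRing} (hX : IsNanotubeUnion T z X) (hle : M ≤ T.Γ)
    {φ : X.Flag → T.Γ ⧸ M.subgroupOf T.Γ}
    (h : IsFlagMap (QuotientGroup.mk' (M.subgroupOf T.Γ)) X φ) (hφ : Function.Injective φ)
    {c d : X.Flag} {x y : Piece T}
    (h0 : T.root 0 x = 0 → ∀ c, (∃ d, X.Glued c d) ∧ ∃ d, X.Glued d c)
    (e : realize hle h (Space.mk c x) = realize hle h (Space.mk d y)) :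
    (Space.mk c x : Space T X) = Space.mk d y := by
  obtain ⟨ε, h1, h2⟩ := (cosetProj_eq_iff hle _ _ _ _).1 e
  obtain ⟨x, hx⟩ := x
  obtain ⟨y, hy⟩ := y
  obtain ⟨a, x, hx', rfl⟩ := exists_side_smul hx
  obtain ⟨b, y, hy', rfl⟩ := exists_side_smul hy
  simp only at h2 h0
  have h3 : (T.side a * T.toW ε * T.side b) • y = x := by
    rw [mul_smul, mul_smul, toW_smul, ← h2, side_smul_side_smul]
  -- Up to mirror images both points are one chamber point, and the connecting element is a product
  -- of reflections in walls through it, which `exists_chain` follows. Gluings are used only if wall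
  -- 0 is among these.
  obtain ⟨h4, h5⟩ := T.stabilizer_chamber hy' (h3 ▸ hx' : _ ∈ T.chamber)
  obtain rfl : x = y := h3.symm.trans h4
  rw [root_zero_side] at h0
  obtain ⟨d', δ, γ, h6, h7, h8⟩ := exists_chain h (fun i (hi : T.root i x = 0) c' => by
    by_cases hi0 : i = 0
    · subst hi0; exact h0 hi c'
    · exact hX.exists_isMove hi0 c') hx' (fun i hi => hi) h5 c a
  have h9 : T.toW ε * T.side b = T.toW γ * T.side δ := by
    rw [← h6, ← mul_assoc, ← mul_assoc, side_mul_side, one_mul]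
  obtain rfl := side_injective_of_toW h9
  obtain rfl := toW_injective (mul_right_cancel h9)
  obtain rfl : d' = d := hφ (h7.trans h1.symm)
  exact h8

/-- A bijective flag map on a complex without open faces gives a homeomorphism. -/
lemma isHomeomorph_realize {z : T.cuspRing} (hX : IsNanotubeUnion T z X) (hle : M ≤ T.Γ)
    {φ : X.Flag → T.Γ ⧸ M.subgroupOf T.Γ}
    (h : IsFlagMap (QuotientGroup.mk' (M.subgroupOf T.Γ)) X φ) (hφ : Function.Bijective φ)
    (h0 : ∀ c, (∃ d, X.Glued c d) ∧ ∃ d, X.Glued d c) :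
    IsHomeomorph (realize hle h) := by
  have hcont := (isTessellationMap_realize hle h).1
  have hsurj := realize_surjective hle h hφ.2
  have hinj : Function.Injective (realize hle h) := by
    intro p p' e
    obtain ⟨c, x, rfl⟩ := Space.mk_surjective p
    obtain ⟨d, y, rfl⟩ := Space.mk_surjective p'
    exact realize_inj hX hle h hφ.1 (fun _ => h0) e
  let F := Equiv.ofBijective _ ⟨hinj, hsurj⟩
  -- Precompose with the projection from hyperbolic space: on each closed translate of the piece,
  -- the inverse is given by a single flag.
  have hF : Continuous F.symm := by
    refine (isQuotientMap_quotient_mk' (s := MulAction.orbitRel M HypSpace)).continuous_iff.2 ?_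
    refine T.locallyFinite_smul_Piece.continuous ?_ (fun γ => isClosed_smul_Piece _) fun γ => ?_
    · refine Set.eq_univ_of_forall fun x => ?_
      obtain ⟨γ, y, rfl⟩ := T.exists_smul_Piece x
      exact Set.mem_iUnion.2 ⟨γ, y, y.2, rfl⟩
    · obtain ⟨c, hc⟩ := hφ.2 γ
      have hmem : ∀ p : (fun x => (γ : PGL(2, ℂ)) • x) '' Piece T,
          (γ : PGL(2, ℂ))⁻¹ • (p : HypSpace) ∈ Piece T := by
        rintro ⟨_, y, hy, rfl⟩
        simpa using hy
      rw [continuousOn_iff_continuous_domRestrict]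
      have heq : ∀ p : (fun x => (γ : PGL(2, ℂ)) • x) '' Piece T,
          F.symm (proj M p) = (Space.mk c ⟨_, hmem p⟩ : Space T X) := by
        intro p
        refine F.symm_apply_eq.2 (Eq.symm ((realize_mk hle h c ⟨_, hmem p⟩).trans ?_))
        rw [hc, cosetProj_mk, smul_inv_smul]
      refine Continuous.congr ?_ fun p => (heq p).symm
      exact (Space.continuous_mk c).comp
        ((continuous_subtype_val.const_smul (γ : PGL(2, ℂ))⁻¹).subtype_mk hmem)
  exact isHomeomorph_iff_exists_inverse.2 ⟨hcont, F.symm, F.left_inv, F.right_inv, hF⟩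

end Realize

end NanoComplex
end RegTess

-- Cusp moduli, Ford identifications and their extensions.

namespace RegTess

open TessType HypSpace

variable {T : TessType} {z : T.cuspRing}

namespace TessType

lemma cuspElt_height (x : T.cuspRing × ZMod T.r) (y : HypSpace) :
    ((T.cuspElt x : PGL(2, ℂ)) • y).height = y.height :=
  T.cuspGroup_height (cuspElt_mem_cuspGroup x) y

/-- An element of the cusp group that is not a translation has finite order. -/
lemma isOfFinOrder_cuspElt {x : T.cuspRing × ZMod T.r} (hx : x.2 ≠ 0) :
    IsOfFinOrder (T.cuspElt x : PGL(2, ℂ)) := by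
  have hv : T.u ^ x.2.val ≠ 1 := fun h => hx <| by
    have h1 := (T.isPrimitiveRoot_u.pow_eq_one_iff_dvd _).1 h
    have h2 := Nat.eq_zero_of_dvd_of_lt h1 (ZMod.val_lt _)
    rwa [ZMod.val_eq_zero] at h2
  have hvr : (T.u ^ x.2.val) ^ T.r = 1 := by rw [← pow_mul, mul_comm, pow_mul, u_pow_r, one_pow]
  refine isOfFinOrder_iff_pow_eq_one.2 ⟨T.r, NeZero.pos _, pgl_ext fun y => ?_⟩
  -- Horizontally the element is an affine map w ↦ ζ w + a with ζ ≠ 1 and ζ^r = 1; for n = r the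
  -- geometric sum vanishes.
  have key : ∀ n : ℕ, (((T.cuspElt x : PGL(2, ℂ)) ^ n) • y).horiz =
      (T.u ^ x.2.val) ^ n * y.horiz + x.1 * ∑ i ∈ Finset.range n, (T.u ^ x.2.val) ^ i ∧
      (((T.cuspElt x : PGL(2, ℂ)) ^ n) • y).height = y.height := by
    intro n
    induction n with
    | zero => simp
    | succ n ih =>
      rw [pow_succ', mul_smul, cuspElt_horiz, cuspElt_height, ih.1, ih.2, Finset.sum_range_succ',
        pow_zero]
      refine ⟨?_, rfl⟩
      simp only [pow_succ', ← Finset.mul_sum]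
      ring
  rw [one_smul]
  refine ext' ?_ (key _).2
  rw [(key _).1, hvr, geom_sum_eq hv, hvr]
  simp

end TessType

section Tessellation

variable {M : Subgroup PGL(2, ℂ)}

lemma HasCuspModulus.parabolic_mem_iff (h : HasCuspModulus T M z) (a : T.cuspRing) :
    parabolic a ∈ M ↔ a ∈ Ideal.span {z} := by
  constructor
  · intro ha
    have h1 : parabolic a ∈ (M : Set PGL(2, ℂ)) ∩ Set.range parabolic := ⟨ha, _, rfl⟩
    rw [h] at h1
    obtain ⟨w, hw, e⟩ := h1
    rwa [← Subtype.ext (parabolic_injective e)]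
  · intro ha
    have h1 : parabolic a ∈ (M : Set PGL(2, ℂ)) ∩ Set.range parabolic := by
      rw [h]; exact ⟨a, ha, rfl⟩
    exact h1.1

variable [hM : (M.subgroupOf T.Γ).Normal]

lemma HasCuspModulus.mk_parabolicΓ (h : HasCuspModulus T M z) :
    QuotientGroup.mk' (M.subgroupOf T.Γ) (T.parabolicΓ z) = 1 :=
  (QuotientGroup.eq_one_iff _).2 ((h.parabolic_mem_iff z).2 (Ideal.mem_span_singleton_self z))

namespace NanoComplex

/-- Two flags with equal values differ by a cusp element in M. As M is torsion-free it is a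
translation, and by the cusp modulus a translation in ⟨z⟩. -/
lemma nanotubeMap_injective (hT : IsRegularTessellation T M) (h : HasCuspModulus T M z)
    (g : T.Γ ⧸ M.subgroupOf T.Γ) :
    Function.Injective (nanotubeMap (z := z) (QuotientGroup.mk' (M.subgroupOf T.Γ)) g) := by
  intro c d e
  obtain ⟨x, rfl⟩ := nanotubeProj_surjective c
  obtain ⟨y, rfl⟩ := nanotubeProj_surjective d
  rw [nanotubeMap_proj h.mk_parabolicΓ, nanotubeMap_proj h.mk_parabolicΓ, mul_right_inj] at e
  obtain ⟨w, hw⟩ := exists_cuspElt (mul_mem (cuspElt_mem_cuspGroup y)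
    (inv_mem (cuspElt_mem_cuspGroup x)))
  have hw' : T.cuspElt w = T.cuspElt y * (T.cuspElt x)⁻¹ := Subtype.ext hw
  have hwM : T.cuspElt w ∈ M.subgroupOf T.Γ := by
    rw [← QuotientGroup.ker_mk' (M.subgroupOf T.Γ), MonoidHom.mem_ker, hw', map_mul, map_inv, ← e,
      mul_inv_cancel]
  have hw2 : w.2 = 0 := by
    by_contra hne
    have h1 : (T.cuspElt w : PGL(2, ℂ)) = 1 := by
      by_contra h1
      exact hT.torsionFree _ hwM h1 (isOfFinOrder_cuspElt hne)
    have h2 : T.cuspElt w = T.cuspElt (0, 0) := Subtype.ext (by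
      rw [h1]; simp [coe_cuspElt, parabolic_zero])
    rw [T.cuspElt_injective h2] at hne
    exact hne rfl
  have hw3 : T.cuspElt w = T.parabolicΓ w.1 := by
    rw [cuspElt, hw2]; simp
  rw [hw3] at hwM hw'
  have hw1 : w.1 ∈ Ideal.span {z} := (h.parabolic_mem_iff _).1 hwM
  have hyx : y = (w.1 + x.1, x.2) := T.cuspElt_injective (by
    have e1 : T.cuspElt (w.1 + x.1, x.2) = T.parabolicΓ w.1 * T.cuspElt x := by
      simp only [cuspElt, parabolicΓ_add, mul_assoc]
    rw [e1, hw', inv_mul_cancel_right])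
  rw [hyx]
  refine Prod.ext (Ideal.Quotient.eq.2 ?_) rfl
  rw [sub_add_cancel_right]
  exact neg_mem hw1

lemma fromInitial_mk (n : ℕ) (c : (stage T z 0).Flag) (x : Piece T) :
    fromInitial T z n (Space.mk c x) = Space.mk (initialFlag T z n c) x := by
  induction n with
  | zero => rfl
  | succ n ih => exact congrArg (next T z n) ih

omit hM in
lemma mk_notMem_boundary_stage_zero {c : (nanotube T z).Flag} {x : Piece T}
    (h : (Space.mk c x : Space T (stage T z 0)) ∈ (boundary T (stage T z 0))ᶜ) :
    T.root 0 x ≠ 0 := by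
  intro h0
  refine h ⟨c, x, fun d hd => hd.elim, ?_, rfl⟩
  rw [root_zero, div_eq_zero_iff, mul_eq_zero, or_iff_left T.cos_p_pos.ne',
    or_iff_left (height_pos _).ne', sub_eq_zero] at h0
  exact h0

lemma boundary_eq_empty {X : NanoComplex} (h : ∀ c, ∃ d, X.Glued c d) : boundary T X = ∅ := by
  refine Set.eq_empty_of_forall_notMem ?_
  rintro _ ⟨c, x, hc, -⟩
  obtain ⟨d, hd⟩ := h c
  exact hc d hd

/-- The flag map of the initial nanotube gives an identification with a Ford domain. -/
lemma isFordIdentification_realize (hT : IsRegularTessellation T M) (h : HasCuspModulus T M z) :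
    IsFordIdentification T z M
      (realize hT.le (nanotubeMap_isFlagMap (z := z) h.mk_parabolicΓ 1)) := by
  refine ⟨isTessellationMap_realize _ _, ?_, 1, one_mem _, ?_⟩
  · intro p hp p' hp' e
    obtain ⟨c, x, rfl⟩ := Space.mk_surjective p
    obtain ⟨d, y, rfl⟩ := Space.mk_surjective p'
    exact realize_inj (isNanotubeUnion_stage (z := z) 0) hT.le _ (nanotubeMap_injective hT h 1)
      (fun h0 => absurd h0 (mk_notMem_boundary_stage_zero hp)) e
  · have key : ∀ (a : T.cuspRing × ZMod T.r) (x : Piece T),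
        realize hT.le (nanotubeMap_isFlagMap (z := z) h.mk_parabolicΓ 1)
          (Space.mk (nanotubeProj T z a) x) = proj M ((T.cuspElt a : PGL(2, ℂ)) • (x : HypSpace)) := by
      intro a x
      rw [realize_mk, nanotubeMap_proj h.mk_parabolicΓ, one_mul]
      exact cosetProj_mk _ _
    ext p
    constructor
    · rintro ⟨p, rfl⟩
      obtain ⟨c, x, rfl⟩ := Space.mk_surjective p
      obtain ⟨a, rfl⟩ := nanotubeProj_surjective c
      exact ⟨_, (mem_fordDomain_iff _).2 ⟨a, x, rfl⟩, (congrArg (proj M) (one_smul _ _)).trans (key a x).symm⟩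
    · rintro ⟨x, hx, rfl⟩
      obtain ⟨a, y, rfl⟩ := (mem_fordDomain_iff _).1 hx
      exact ⟨_, (key a y).trans (congrArg (proj M) (one_smul _ _)).symm⟩

lemma subgroupOf_universalGroup : (universalGroup T z).subgroupOf T.Γ = cuspClosure T z := by
  ext γ
  rw [Subgroup.mem_subgroupOf, universalGroup]
  constructor
  · rintro ⟨δ, hδ, e⟩
    rwa [← Subtype.ext e]
  · exact fun h => ⟨γ, h, rfl⟩

lemma universalGroup_le : universalGroup T z ≤ T.Γ := by
  rintro _ ⟨γ, -, rfl⟩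
  exact γ.2

lemma isFlagMap_comp_flagNext {G : Type*} [Group G] {π : T.Γ →* G} {n : ℕ}
    {ψ : (stage T z (n + 1)).Flag → G} (h : IsFlagMap π _ ψ) :
    IsFlagMap π (stage T z n) (ψ ∘ flagNext T z n) where
  rot c := h.rot (flagNext T z n c)
  flip c := h.flip (flagNext T z n c)
  glued _ _ hcd := h.glued _ _ (flagNext_glued hcd)

/-- Existence, uniqueness, surjectivity and bijectivity of the extensions of an identification of
the initial nanotube with a Ford domain. -/
lemma exists_extensions (hT : IsRegularTessellation T M) (h : HasCuspModulus T M z)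
    [Finite (T.Γ ⧸ M.subgroupOf T.Γ)] {f₀ : Space T (stage T z 0) → QuotientSpace M}
    (hf₀ : IsFordIdentification T z M f₀) :
    ∃ f : (n : ℕ) → Space T (stage T z n) → QuotientSpace M,
      (∀ n, IsTessellationMap T M (f n) ∧ f n ∘ fromInitial T z n = f₀ ∧
        ∀ g : Space T (stage T z n) → QuotientSpace M,
          IsTessellationMap T M g → g ∘ fromInitial T z n = f₀ → g = f n) ∧
      (∃ N, ∀ n ≥ N, Function.Surjective (f n)) ∧
      (M = universalGroup T z →
        ∃ N, ∀ n ≥ N, IsHomeomorph (f n) ∧ boundary T (stage T z n) = ∅) := by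
  obtain ⟨φ₀, h₀, rfl⟩ := hf₀.1.exists_isFlagMap hT.le
  choose ψ hψ hψ' using exists_isFlagMap h.mk_parabolicΓ h₀
  -- The `ψ n` were chosen separately for each n; uniqueness makes them compatible.
  have hnext : ∀ n c, ψ (n + 1) (flagNext T z n c) = ψ n c := fun n => congrFun <|
    (isFlagMap_comp_flagNext (hψ (n + 1))).eq_of_baseFlag (hψ n)
      ((hψ' (n + 1) _).trans (hψ' n _).symm)
  obtain ⟨N, hN⟩ := exists_stage_surjective (QuotientGroup.mk'_surjective _) ψ hψ hnext
  refine ⟨fun n => realize hT.le (hψ n), fun n => ⟨isTessellationMap_realize _ _, ?_, ?_⟩,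
    ⟨N, fun n hn => realize_surjective _ _ (hN n hn)⟩, ?_⟩
  · funext p
    obtain ⟨c, x, rfl⟩ := Space.mk_surjective p
    rw [Function.comp_apply, fromInitial_mk]
    exact congrArg (fun g => cosetProj g (x : HypSpace)) (hψ' n c)
  · intro g hg e
    obtain ⟨χ, hχ, rfl⟩ := hg.exists_isFlagMap hT.le
    -- Since `basePt` has trivial stabilizer in Γ, the image of this point in the base flag
    -- determines the coset.
    obtain rfl : χ = ψ n := by
      refine hχ.eq_of_baseFlag (hψ n) (Eq.trans ?_ (hψ' n _).symm)
      apply eq_of_cosetProj_basePt hT.le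
      have h1 := congrFun e (Space.mk ((0, 0) : (nanotube T z).Flag) ⟨_, basePt_mem_Piece⟩)
      rw [Function.comp_apply] at h1
      exact (congrArg _ (fromInitial_mk n _ _)).symm.trans h1
    rfl
  · rintro hMz
    have hker : M.subgroupOf T.Γ = cuspClosure T z := by
      rw [hMz]; exact subgroupOf_universalGroup
    have : Finite (T.Γ ⧸ cuspClosure T z) := hker ▸ inferInstance
    obtain ⟨N', hN'⟩ := exists_stage_complete (T := T) (z := z)
    -- One more than the bounds, so that the stage is a `closeEdges` and its gluing is symmetric.
    refine ⟨max N N' + 1, fun n hn => ?_⟩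
    obtain ⟨n, rfl⟩ := Nat.exists_eq_add_of_le' (by omega : 1 ≤ n)
    obtain ⟨h1, h2⟩ := hN' (n + 1) (by omega)
    refine ⟨isHomeomorph_realize (isNanotubeUnion_stage (z := z) (n + 1)) _ _
      ⟨h2 (hψ (n + 1)) ?_, hN _ (by omega)⟩ fun c => ⟨h1 c, ?_⟩, boundary_eq_empty h1⟩
    · rw [QuotientGroup.ker_mk', hker]
    · obtain ⟨d, hd⟩ := h1 c
      exact ⟨d, closeEdges_glued_symm hd⟩

end NanoComplex

end Tessellation

end RegTess

namespace RegTess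

/-! ### Hyperbolic volume -/

namespace HypSpace

open MeasureTheory TessType

instance : BorelSpace HypSpace := inferInstanceAs (BorelSpace {x : ℂ × ℝ // 0 < x.2})

/-- The coordinates of a point. -/
def coords (x : HypSpace) : ℂ × ℝ := x.1

lemma coords_injective : Function.Injective coords := Subtype.val_injective

lemma coords_pos (x : HypSpace) : 0 < x.coords.2 := x.2

lemma measurableSet_pos : MeasurableSet {x : ℂ × ℝ | 0 < x.2} :=
  measurableSet_lt measurable_const measurable_snd

lemma measurableEmbedding_coords : MeasurableEmbedding coords :=
  MeasurableEmbedding.subtype_coe measurableSet_pos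

/-- The density of the hyperbolic volume. -/
noncomputable def density (x : ℂ × ℝ) : ℝ≥0∞ := ENNReal.ofReal (1 / x.2 ^ 3)

lemma measurableSet_image_coords {s : Set HypSpace} (hs : MeasurableSet s) :
    MeasurableSet (coords '' s) :=
  measurableEmbedding_coords.measurableSet_image.2 hs

lemma volume_apply {s : Set HypSpace} (hs : MeasurableSet s) :
    volume s = ∫⁻ x in (coords '' s), density x := by
  rw [← withDensity_apply _ (measurableSet_image_coords hs)]
  exact measurableEmbedding_coords.comap_apply _ s

/-- For maps that keep heights: the hyperbolic density depends on the height alone. -/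
lemma volume_preimage_of_measurePreserving {f : HypSpace → HypSpace} (hf : Continuous f)
    {F : ℂ × ℝ → ℂ × ℝ} (hF : MeasurePreserving F) (hF2 : ∀ x, (F x).2 = x.2)
    (hfF : ∀ x, (f x).coords = F x.coords) {s : Set HypSpace} (hs : MeasurableSet s) :
    volume (f ⁻¹' s) = volume s := by
  have h1 : coords '' (f ⁻¹' s) = F ⁻¹' (coords '' s) := by
    ext x
    constructor
    · rintro ⟨x, hx, rfl⟩
      exact ⟨f x, hx, hfF x⟩
    · rintro ⟨y, hy, h⟩
      have hx : 0 < x.2 := by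
        rw [← hF2, ← h]; exact y.coords_pos
      refine ⟨⟨x, hx⟩, ?_, rfl⟩
      have h2 : f ⟨x, hx⟩ = y := coords_injective ((hfF _).trans h.symm)
      show f ⟨x, hx⟩ ∈ s
      rwa [h2]
  have hd : ∀ x, density (F x) = density x := fun x => by rw [density, hF2]; rfl
  have hm : Measurable density := by unfold density; fun_prop
  rw [volume_apply hs, volume_apply (hs.preimage hf.measurable), h1,
    ← hF.setLIntegral_comp_preimage (measurableSet_image_coords hs) hm]
  simp only [hd]

/-- Change of variables for an involution, whose preimages are images. The assumed Jacobian exactly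
compensates the density 1 / t³. -/
lemma volume_image_of_hasFDerivAt {f : HypSpace → HypSpace} (hf : Continuous f)
    (hff : ∀ x, f (f x) = x)
    {F : ℂ × ℝ → ℂ × ℝ} {F' : ℂ × ℝ → (ℂ × ℝ →L[ℝ] ℂ × ℝ)}
    (hF : ∀ x, 0 < x.2 → HasFDerivAt F (F' x) x)
    (hF' : ∀ x, 0 < x.2 → |(F' x).det| = ((F x).2 / x.2) ^ 3)
    (hfF : ∀ x, (f x).coords = F x.coords) {s : Set HypSpace} (hs : MeasurableSet s) :
    volume (f ⁻¹' s) = volume s := by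
  have h1 : coords '' (f ⁻¹' s) = F '' (coords '' s) := by
    ext x
    constructor
    · rintro ⟨x, hx, rfl⟩
      exact ⟨_, ⟨f x, hx, rfl⟩, by rw [← hfF, hff]⟩
    · rintro ⟨_, ⟨y, hy, rfl⟩, rfl⟩
      refine ⟨f y, ?_, hfF y⟩
      rwa [Set.mem_preimage, hff]
  have hinj : Set.InjOn F (coords '' s) := by
    rintro _ ⟨x, -, rfl⟩ _ ⟨y, -, rfl⟩ h
    rw [← hfF, ← hfF] at h
    have := congrArg f (coords_injective h)
    rw [hff, hff] at this
    rw [this]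
  have : (MeasureTheory.volume : Measure (ℂ × ℝ)).IsAddHaarMeasure :=
    inferInstanceAs (((MeasureTheory.volume : Measure ℂ).prod
      (MeasureTheory.volume : Measure ℝ)).IsAddHaarMeasure)
  rw [volume_apply hs, volume_apply (hs.preimage hf.measurable), h1,
    lintegral_image_eq_lintegral_abs_det_fderiv_mul _ (measurableSet_image_coords hs) (f' := F') ?_ hinj]
  · refine setLIntegral_congr_fun (measurableSet_image_coords hs) ?_
    rintro _ ⟨x, -, rfl⟩
    have hx := x.coords_pos
    have hfx : 0 < (F x.coords).2 := by rw [← hfF]; exact (f x).coords_pos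
    simp only [density]
    rw [hF' _ hx, ← ENNReal.ofReal_mul (by positivity)]
    congr 1
    field_simp
  · rintro _ ⟨x, -, rfl⟩
    exact (hF _ x.coords_pos).hasFDerivWithinAt

/-- The inversion at a sphere with centre on the boundary. -/
noncomputable def inversion (κ : ℝ) (x : ℂ × ℝ) : ℂ × ℝ :=
  (κ / (Complex.normSq x.1 + x.2 ^ 2)) • x

/-- The derivative of an inversion is a scalar times a reflection, in dimension 3. The computation
takes place in `WithLp 2 (ℂ × ℝ)` because the product norm on `ℂ × ℝ` is not Euclidean. -/
lemma exists_hasFDerivAt_inversion {κ : ℝ} (hκ : 0 < κ) (x : ℂ × ℝ) (hx : 0 < x.2) :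
    ∃ F' : ℂ × ℝ →L[ℝ] ℂ × ℝ, HasFDerivAt (inversion κ) F' x ∧
      |F'.det| = ((inversion κ x).2 / x.2) ^ 3 := by
  let L := WithLp.prodContinuousLinearEquiv 2 ℝ ℂ ℝ
  have hnorm : ∀ y : ℂ × ℝ, ‖L.symm y‖ ^ 2 = Complex.normSq y.1 + y.2 ^ 2 := fun y => by
    rw [WithLp.prod_norm_sq_eq_of_L2, Complex.normSq_eq_norm_sq]
    show ‖y.1‖ ^ 2 + ‖y.2‖ ^ 2 = _
    rw [Real.norm_eq_abs, sq_abs]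
  have hc : ∀ y : ℂ × ℝ, (√κ / dist (L.symm y) 0) ^ 2 = κ / (Complex.normSq y.1 + y.2 ^ 2) :=
    fun y => by rw [dist_zero_right, div_pow, Real.sq_sqrt hκ.le, hnorm]
  have heq : inversion κ = L ∘ EuclideanGeometry.inversion 0 (√κ) ∘ L.symm := by
    funext y
    rw [inversion, Function.comp_apply, Function.comp_apply, EuclideanGeometry.inversion, hc,
      vsub_eq_sub, sub_zero, vadd_eq_add, add_zero, map_smul, L.apply_symm_apply]
  have hx0 : L.symm x ≠ 0 := fun h => by
    have := (map_eq_zero_iff L.symm L.symm.injective).1 h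
    rw [this] at hx
    exact lt_irrefl _ hx
  have h1 := EuclideanGeometry.hasFDerivAt_inversion (R := √κ) hx0
  rw [hc, sub_zero] at h1
  have h2 := L.hasFDerivAt.comp x (h1.comp x L.symm.hasFDerivAt)
  rw [← heq] at h2
  refine ⟨_, h2, ?_⟩
  have hdet : ∀ (K : Submodule ℝ (WithLp 2 (ℂ × ℝ))) [K.HasOrthogonalProjection], (((L : WithLp 2 (ℂ × ℝ) →L[ℝ] ℂ × ℝ).comp
      (((κ / (Complex.normSq x.1 + x.2 ^ 2)) •
        (K.reflection : WithLp 2 (ℂ × ℝ) →L[ℝ] WithLp 2 (ℂ × ℝ))).comp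
      (L.symm : ℂ × ℝ →L[ℝ] WithLp 2 (ℂ × ℝ)))).det) =
      (κ / (Complex.normSq x.1 + x.2 ^ 2)) ^ 3 * LinearMap.det K.reflection.toLinearMap := by
    intro K _
    have h3 : Module.finrank ℝ (WithLp 2 (ℂ × ℝ)) = 3 := by
      rw [L.toLinearEquiv.finrank_eq, Module.finrank_prod, Complex.finrank_real_complex,
        Module.finrank_self]
    rw [← h3, ← LinearMap.det_smul]
    exact LinearMap.det_conj _ L.toLinearEquiv
  rw [hdet, abs_mul, Submodule.det_reflection, abs_neg_one_pow, mul_one]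
  have hpos : 0 < κ / (Complex.normSq x.1 + x.2 ^ 2) := by
    have := Complex.normSq_nonneg x.1
    positivity
  rw [abs_of_pos (by positivity)]
  show _ = (κ / (Complex.normSq x.1 + x.2 ^ 2) * x.2 / x.2) ^ 3
  rw [mul_div_cancel_right₀ _ hx.ne']

lemma continuous_conjH : Continuous conjH :=
  Continuous.subtype_mk ((Complex.continuous_conj.comp continuous_horiz).prodMk continuous_height) _

lemma volume_preimage_conjH {s : Set HypSpace} (hs : MeasurableSet s) :
    volume (conjH ⁻¹' s) = volume s :=
  volume_preimage_of_measurePreserving continuous_conjH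
    (F := Prod.map Complex.conjLIE id)
    (Complex.conjLIE.measurePreserving.prod (MeasurePreserving.id _)) (fun _ => rfl)
    (fun _ => rfl) hs

variable {T : TessType}

lemma continuous_simple_smul (i : Fin 4) : Continuous fun x : HypSpace => T.cs.simple i • x := by
  have h : (fun x : HypSpace => T.cs.simple i • x) = fun x => T.gens i • conjH x :=
    funext (T.simple_smul i)
  rw [h]
  exact continuous_conjH.const_smul (T.gens i)

lemma volume_preimage_simple_zero {s : Set HypSpace} (hs : MeasurableSet s) :
    volume ((T.cs.simple 0 • ·) ⁻¹' s) = volume s := by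
  choose! F' h1 h2 using exists_hasFDerivAt_inversion T.κ_pos
  refine volume_image_of_hasFDerivAt (continuous_simple_smul 0) (fun x => ?_)
    (F := inversion T.κ) h1 h2 (fun x => ?_) hs
  · rw [← mul_smul, T.cs.simple_mul_simple_self, one_smul]
  · refine Prod.ext ((T.simple_zero_horiz x).trans ?_) ((T.simple_zero_height x).trans ?_)
    · show _ = _ • x.horiz
      rw [Complex.real_smul, Complex.ofReal_div, div_mul_eq_mul_div]
      rfl
    · show _ = _ * x.height
      rw [div_mul_eq_mul_div]; rfl

lemma volume_preimage_gens (i : Fin 4) {s : Set HypSpace} (hs : MeasurableSet s) :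
    volume ((T.gens i • ·) ⁻¹' s) = volume s := by
  fin_cases i
  · have h1 : (T.gens 0 • · : HypSpace → HypSpace) ⁻¹' s =
        conjH ⁻¹' ((T.cs.simple 0 • ·) ⁻¹' s) := by
      ext x
      show _ ↔ T.cs.simple 0 • conjH x ∈ s
      rw [simple_smul, show conjH (conjH x) = x from DFunLike.congr_fun conjH_mul_self x]
      rfl
    show volume ((T.gens 0 • · : HypSpace → HypSpace) ⁻¹' s) = _
    rw [h1, volume_preimage_conjH (hs.preimage (continuous_simple_smul 0).measurable),
      volume_preimage_simple_zero hs]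
  · refine volume_preimage_of_measurePreserving (continuous_const_smul _)
      (F := Prod.map (fun w => 1 - w) id)
      ((Measure.measurePreserving_sub_left MeasureTheory.volume (1 : ℂ)).prod (MeasurePreserving.id _)) (fun _ => rfl)
      (fun x => Prod.ext (T.gF_horiz x) (T.gF_height x)) hs
  · refine volume_preimage_of_measurePreserving (continuous_const_smul _)
      (F := Prod.map (rotation (⟨T.u, mem_sphere_zero_iff_norm.2 T.norm_u⟩ : Circle)) id)
      ((rotation _).measurePreserving.prod (MeasurePreserving.id _)) (fun _ => rfl)
      (fun x => Prod.ext (T.gR_horiz x) (T.gR_height x)) hs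
  · have h1 : (fun x : HypSpace => T.gens 3 • x) = id := funext fun x => one_smul PGL(2, ℂ) x
    show volume ((fun x : HypSpace => T.gens 3 • x) ⁻¹' s) = _
    rw [h1]; rfl

lemma volume_preimage_smul {γ : PGL(2, ℂ)} (hγ : γ ∈ T.Γ) {s : Set HypSpace} (hs : MeasurableSet s) :
    volume ((γ • ·) ⁻¹' s) = volume s := by
  rw [← T.closure_gens] at hγ
  induction hγ using Subgroup.closure_induction generalizing s with
  | mem _ h => obtain ⟨i, rfl⟩ := h; exact volume_preimage_gens i hs
  | one => simp
  | mul a b _ _ ha hb =>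
    have h1 : (fun x : HypSpace => (a * b) • x) ⁻¹' s = (b • ·) ⁻¹' ((a • ·) ⁻¹' s) := by
      ext x; simp [mul_smul]
    rw [h1, hb (hs.preimage (continuous_const_smul a).measurable), ha hs]
  | inv a _ ha =>
    have h1 : (fun x : HypSpace => a • x) ⁻¹' ((a⁻¹ • ·) ⁻¹' s) = s := by
      ext x; simp
    rw [← ha (hs.preimage (continuous_const_smul a⁻¹).measurable), h1]

lemma continuous_root (i : Fin 4) : Continuous (T.root i) := by
  have h1 := Complex.continuous_re.comp continuous_horiz
  have h2 := Complex.continuous_im.comp continuous_horiz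
  have h3 := Complex.continuous_normSq.comp continuous_horiz
  have h4 := continuous_height
  fin_cases i
  · exact (((h3.add (h4.pow 2)).sub continuous_const).mul continuous_const).div h4
      fun x => x.height_pos.ne'
  · exact (continuous_const.sub h1).div h4 fun x => x.height_pos.ne'
  · exact ((continuous_const.mul h1).sub (continuous_const.mul h2)).div h4 fun x => x.height_pos.ne'
  · exact h2.div h4 fun x => x.height_pos.ne'

/-- The interior of the fundamental chamber. -/
def openChamber (T : TessType) : Set HypSpace := {x | ∀ i, 0 < T.root i x}

lemma isOpen_openChamber : IsOpen (openChamber T) := by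
  have : openChamber T = ⋂ i, {x | 0 < T.root i x} := by
    ext x; simp [openChamber]
  rw [this]
  exact isOpen_iInter_of_finite fun i => isOpen_lt continuous_const (continuous_root i)

lemma volume_pos_of_isOpen {U : Set HypSpace} (hU : IsOpen U) (hne : U.Nonempty) :
    0 < volume U := by
  have hm : Measurable density := by unfold density; fun_prop
  have hopen : IsOpen (coords '' U) :=
    (isOpen_lt continuous_const continuous_snd).isOpenMap_subtype_val U hU
  have : (MeasureTheory.volume : Measure (ℂ × ℝ)).IsAddHaarMeasure :=
    inferInstanceAs (((MeasureTheory.volume : Measure ℂ).prod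
      (MeasureTheory.volume : Measure ℝ)).IsAddHaarMeasure)
  rw [volume_apply hU.measurableSet, setLIntegral_pos_iff hm]
  refine (hopen.measure_pos _ (hne.image _)).trans_le (measure_mono ?_)
  rintro _ ⟨x, hx, rfl⟩
  refine ⟨?_, x, hx, rfl⟩
  have := x.coords_pos
  exact (ENNReal.ofReal_pos.2 (by positivity)).ne'

lemma eq_of_smul_openChamber {γ δ : T.Γ} {x y : HypSpace} (hx : x ∈ openChamber T)
    (hy : y ∈ openChamber T) (h : (γ : PGL(2, ℂ)) • x = (δ : PGL(2, ℂ)) • y) : γ = δ := by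
  have h1 : T.toW (δ⁻¹ * γ) • x = y := by
    rw [toW_smul, Subgroup.coe_mul, mul_smul, h, Subgroup.coe_inv, inv_smul_smul]
  have h2 := (T.stabilizer_chamber (fun i => (hx i).le) (w := T.toW (δ⁻¹ * γ))
    (h1 ▸ fun i => (hy i).le)).2
  have h3 : {i | T.root i x = 0} = ∅ := Set.eq_empty_of_forall_notMem fun i hi => (hx i).ne' hi
  rw [h3, Set.image_empty, Subgroup.closure_empty, Subgroup.mem_bot, ← map_one T.toW] at h2
  exact (inv_mul_eq_one.1 (toW_injective h2)).symm

instance : Countable T.Γ := by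
  rw [← Set.countable_univ_iff]
  refine Set.Countable.mono ?_ (Set.countable_iUnion fun n : ℕ =>
    (T.finite_smul_Piece n).countable)
  intro γ _
  obtain ⟨n, hn⟩ := exists_nat_ge (coshDist ((γ : PGL(2, ℂ)) • T.basePt) T.basePt)
  exact Set.mem_iUnion.2 ⟨n, T.basePt, basePt_mem_Piece, hn⟩

end HypSpace

open MeasureTheory TessType HypSpace in
/-- A normal subgroup of the rotation group whose quotient space has finite volume is of finite
index. -/
lemma FiniteVolume.finite_quotient {T : TessType} {M : Subgroup PGL(2, ℂ)} (hle : M ≤ T.Γ)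
    [(M.subgroupOf T.Γ).Normal] (h : FiniteVolume M) : Finite (T.Γ ⧸ M.subgroupOf T.Γ) := by
  obtain ⟨D, hD, hDfin⟩ := h
  have : Countable M := (Subgroup.inclusion_injective hle).countable
  have : MeasurableConstSMul M HypSpace :=
    ⟨fun m => (continuous_const_smul (m : PGL(2, ℂ))).measurable⟩
  have : SMulInvariantMeasure M HypSpace HypSpace.volume :=
    ⟨fun m s hs => volume_preimage_smul (hle m.2) hs⟩
  -- One translate of the open chamber for each coset; by `hsep`, no two of them overlap even modulo
  -- M.
  let t : T.Γ ⧸ M.subgroupOf T.Γ → Set HypSpace := fun q =>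
    (fun x => (q.out : PGL(2, ℂ))⁻¹ • x) ⁻¹' openChamber T
  have htm : ∀ q, MeasurableSet (t q) := fun q =>
    isOpen_openChamber.measurableSet.preimage (continuous_const_smul _).measurable
  have hsep : ∀ (m n : M) q q' x y, x ∈ t q → y ∈ t q' → m • x = n • y → m = n ∧ q = q' := by
    intro m n q q' x y hx hy hxy
    have h1 : (⟨m, hle m.2⟩ * q.out : T.Γ) = ⟨n, hle n.2⟩ * q'.out := by
      refine eq_of_smul_openChamber hx hy ?_
      simp only [Subgroup.coe_mul, mul_smul, smul_inv_smul]
      exact hxy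
    have h2 : ∀ m : M, ((⟨m, hle m.2⟩ : T.Γ) : T.Γ ⧸ M.subgroupOf T.Γ) = 1 := fun m =>
      (QuotientGroup.eq_one_iff _).2 m.2
    have h3 := congrArg (QuotientGroup.mk (s := M.subgroupOf T.Γ)) h1
    rw [QuotientGroup.mk_mul, QuotientGroup.mk_mul, h2, h2, one_mul, one_mul, QuotientGroup.out_eq',
      QuotientGroup.out_eq'] at h3
    subst h3
    have h4 : (⟨m, hle m.2⟩ : T.Γ) = ⟨n, hle n.2⟩ := mul_right_cancel h1
    exact ⟨Subtype.ext (Subtype.mk.inj h4), rfl⟩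
  have : Countable (T.Γ ⧸ M.subgroupOf T.Γ) := QuotientGroup.mk_surjective.countable
  -- The M-translates of the union are pairwise disjoint, so its volume is at most that of a
  -- fundamental domain.
  have hle' : HypSpace.volume (⋃ q, t q) ≤ HypSpace.volume D := by
    refine hD.measure_le_of_pairwise_disjoint
      (MeasurableSet.iUnion htm).nullMeasurableSet (Pairwise.aedisjoint fun m n hmn => ?_)
    refine (Disjoint.inf_left _ ?_).inf_right _
    rw [Set.disjoint_left]
    rintro _ ⟨x, hx, rfl⟩ ⟨y, hy, hxy⟩
    obtain ⟨q, hq⟩ := Set.mem_iUnion.1 hx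
    obtain ⟨q', hq'⟩ := Set.mem_iUnion.1 hy
    exact hmn (hsep m n q q' x y hq hq' hxy.symm).1
  have hdisj : Pairwise (Function.onFun Disjoint t) := by
    intro q q' hqq'
    rw [Function.onFun, Set.disjoint_left]
    exact fun x hx hx' => hqq' (hsep 1 1 q q' x x hx hx' rfl).2
  have hvol : ∀ q, HypSpace.volume (t q) = HypSpace.volume (openChamber T) := fun q =>
    volume_preimage_smul (inv_mem q.out.2) isOpen_openChamber.measurableSet
  rw [measure_iUnion hdisj htm] at hle'
  simp only [hvol] at hle'
  -- Infinitely many cosets would contribute the same positive volume each.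
  by_contra hinf
  rw [not_finite_iff_infinite] at hinf
  rw [ENNReal.tsum_const_eq_top_of_ne_zero
    (volume_pos_of_isOpen isOpen_openChamber ⟨_, T.root_basePt_pos⟩).ne', top_le_iff] at hle'
  exact hDfin.ne hle'

end RegTess

theorem mainTheorem8 (T : TessType) (z : T.cuspRing) (hz : z ≠ 0) :
    (∀ M : Subgroup PGL(2, ℂ), IsRegularTessellation T M → FiniteVolume M → HasCuspModulus T M z →
      (∃ f₀, IsFordIdentification T z M f₀) ∧
      ∀ f₀, IsFordIdentification T z M f₀ →
        ∃ f : (n : ℕ) → Space T (stage T z n) → QuotientSpace M,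
          (∀ n, IsTessellationMap T M (f n) ∧ f n ∘ fromInitial T z n = f₀ ∧
            ∀ g : Space T (stage T z n) → QuotientSpace M,
              IsTessellationMap T M g → g ∘ fromInitial T z n = f₀ → g = f n) ∧
          (∃ N, ∀ n ≥ N, Function.Surjective (f n)) ∧
          (M = universalGroup T z →
            ∃ N, ∀ n ≥ N, IsHomeomorph (f n) ∧ boundary T (stage T z n) = ∅)) ∧
    (∀ n, Finite (stage T z n).Flag) ∧
    (FiniteVolume (universalGroup T z) → ∃ N, ∀ n ≥ N, boundary T (stage T z n) = ∅) := by
  refine ⟨fun M hT hvol hmod => ?_, finite_stage hz, fun hvol => ?_⟩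
  · have := hT.normal
    have := hvol.finite_quotient hT.le
    exact ⟨⟨_, isFordIdentification_realize hT hmod⟩, fun f₀ hf₀ => exists_extensions hT hmod hf₀⟩
  · have hn : ((universalGroup T z).subgroupOf T.Γ).Normal := by
      rw [subgroupOf_universalGroup]; infer_instance
    have hfin := hvol.finite_quotient universalGroup_le
    rw [subgroupOf_universalGroup] at hfin
    obtain ⟨N, hN⟩ := exists_stage_complete (T := T) (z := z)
    exact ⟨N, fun n hn => boundary_eq_empty (hN n hn).1⟩
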